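/- For $n\in\mathbb N=\{0,1,2,\dots\}$ let $H_n(x)=(-1)^n e^{x^2}\frac{d^n}{dx^n}e^{-x^2}$ be the (physicists') Hermite polynomials. Let $V:\mathbb R\to\mathbb R$ satisfy $V\in L^2(\mathbb R,e^{-x^2}dx)$ and $V(x)\to\infty$ as $|x|\to\infty$. Then $V$ has a Hermite expansion $V=\sum_{j=0}^\infty v_jH_j$, convergent in $L^2(\mathbb R,e^{-x^2}dx)$, and the eigenvalues of the Schrödinger operator $-d^2/dx^2+V$ on $L^2(\mathbb R)$ (the numbers $\lambda$ for which $-u''+Vu=\lambda u$ a.e. on $\mathbb R$ has a nonzero solution $u\in L^2(\mathbb R)$ with $u,u'$ locally absolutely continuous) can be listed, with multiplicity, as a sequence $\lambda_0\le\lambda_1\le\lambda_2\le\dots\to\infty$. For this expansion and this sequence, and for every $n\in\mathbb N$, $$\sum_{k=0}^n\lambda_k\;\le\;\sum_{k=0}^n\frac{2^k(2k)!}{k!}\binom{n+1}{k+1}v_{2k}+\frac12(n+1)^2 .$$ For $V(x)=x^2$, which satisfies the hypotheses, equality holds for every $n\in\mathbb N$. -/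

import Mathlib

open MeasureTheory Filter Topology Polynomial

noncomputable section

/-- The physicists' Hermite polynomials `H_n(x) = (-1)^n e^{x^2} (d/dx)^n e^{-x^2}`, generated by
`H_0 = 1` and `H_{n+1} = 2 x H_n - H_n'`. -/
def physHermite : ℕ → ℝ[X]
  | 0 => 1
  | n + 1 => 2 * X * physHermite n - derivative (physHermite n)

/-- The measure `e^{-x^2} dx` on the real line. -/
def hermiteMeasure : Measure ℝ :=
  volume.withDensity fun x => ENNReal.ofReal (Real.exp (-x ^ 2))

/-- `V = ∑ v_j H_j`, the series converging in `L²(ℝ, e^{-x^2} dx)`. -/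
def HasHermiteExpansion (V : ℝ → ℝ) (v : ℕ → ℝ) : Prop :=
  Tendsto
    (fun N : ℕ => eLpNorm
      (fun x => V x - ∑ j ∈ Finset.range N, v j * (physHermite j).eval x) 2 hermiteMeasure)
    atTop (𝓝 0)

/-- `u` belongs to `L²(ℝ)`, `u` and `u'` are (locally) absolutely continuous, and
`-u'' + V u = μ u` almost everywhere on the real line. Such a `u` lies in the domain
`{u ∈ L² : u, u' locally absolutely continuous, -u'' + V u ∈ L²}` of the Schrödinger operator
`-d²/dx² + V`, and the nonzero ones are its eigenfunctions for the eigenvalue `μ`.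
(That `u` itself is absolutely continuous follows, as `u'` is continuous.) -/
structure IsL2Solution (V : ℝ → ℝ) (μ : ℝ) (u : ℝ → ℝ) : Prop where
  memLp : MemLp u 2 volume
  differentiable : Differentiable ℝ u
  absolutelyContinuous_deriv : ∀ a b : ℝ, AbsolutelyContinuousOnInterval (deriv u) a b
  equation : ∀ᵐ x : ℝ, -deriv (deriv u) x + V x * u x = μ * u x

lemma IsL2Solution.ae_differentiableAt {V : ℝ → ℝ} {μ : ℝ} {u : ℝ → ℝ}
    (h : IsL2Solution V μ u) : ∀ᵐ x : ℝ, DifferentiableAt ℝ (deriv u) x := by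
  have h1 : ∀ n : ℕ, ∀ᵐ x : ℝ, x ∈ Set.uIcc (-(n : ℝ)) n → DifferentiableAt ℝ (deriv u) x :=
    fun n => (h.absolutelyContinuous_deriv _ _).ae_differentiableAt
  filter_upwards [ae_all_iff.2 h1] with x hx
  obtain ⟨n, hn⟩ := exists_nat_ge |x|
  refine hx n ?_
  rw [Set.uIcc_of_le (by linarith [abs_nonneg x])]
  exact abs_le.1 hn

/-- The eigenspace of the Schrödinger operator `-d²/dx² + V` on `L²(ℝ)` for the number `μ`
(a continuous function is determined by its class in `L²`, so functions may be used). -/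
def schrodingerEigenspace (V : ℝ → ℝ) (μ : ℝ) : Submodule ℝ (ℝ → ℝ) where
  carrier := {u | IsL2Solution V μ u}
  zero_mem' := by
    have h0 : deriv (0 : ℝ → ℝ) = fun _ => 0 := by
      ext x
      simp
    refine ⟨MemLp.zero, differentiable_const (0 : ℝ), fun a b => ?_, ?_⟩
    · rw [h0]
      exact (contDiffOn_const).absolutelyContinuousOnInterval
    · rw [h0]
      simp
  add_mem' := by
    intro u w hu hw
    have hd : deriv (u + w) = deriv u + deriv w := by
      ext x
      exact deriv_add (hu.differentiable x) (hw.differentiable x)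
    refine ⟨hu.memLp.add hw.memLp, hu.differentiable.add hw.differentiable, fun a b => ?_, ?_⟩
    · rw [hd]
      exact (hu.absolutelyContinuous_deriv a b).add (hw.absolutelyContinuous_deriv a b)
    · filter_upwards [hu.equation, hw.equation, hu.ae_differentiableAt, hw.ae_differentiableAt]
        with x h1 h2 h3 h4
      rw [hd, deriv_add h3 h4, Pi.add_apply]
      linarith
  smul_mem' := by
    intro c u hu
    have hd : deriv (c • u) = fun x => c • deriv u x := by
      ext x
      exact deriv_const_smul c (hu.differentiable x)
    refine ⟨hu.memLp.const_smul c, hu.differentiable.const_smul c, fun a b => ?_, ?_⟩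
    · rw [hd]
      exact (hu.absolutelyContinuous_deriv a b).const_smul c
    · filter_upwards [hu.equation, hu.ae_differentiableAt] with x h1 h3
      have h5 : deriv (fun y => c • deriv u y) x = c • deriv (deriv u) x :=
        deriv_const_smul c h3
      rw [hd, h5, Pi.smul_apply, smul_eq_mul, smul_eq_mul]
      linear_combination c * h1

/-- `lam 0 ≤ lam 1 ≤ ⋯ → ∞` lists the eigenvalues of `-d²/dx² + V` on `L²(ℝ)`, every eigenvalue
occurring as often as its multiplicity (and no other number occurring). -/
structure IsEigenvalueSequence (V : ℝ → ℝ) (lam : ℕ → ℝ) : Prop where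
  monotone : Monotone lam
  tendsto : Tendsto lam atTop atTop
  multiplicity : ∀ μ : ℝ,
    Cardinal.mk {k : ℕ // lam k = μ} = Module.rank ℝ (schrodingerEigenspace V μ)

/-- The explicit bound
`∑_{k=0}^n (2^k (2k)! / k!) binom(n+1, k+1) v_{2k} + (n+1)^2 / 2`. -/
def hermiteBound (v : ℕ → ℝ) (n : ℕ) : ℝ :=
  ∑ k ∈ Finset.range (n + 1),
      (2 ^ k * ((2 * k).factorial : ℝ) / (k.factorial : ℝ)) * ((n + 1).choose (k + 1) : ℝ)
        * v (2 * k)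
    + ((n : ℝ) + 1) ^ 2 / 2

end

/-! ### Hermite polynomials and Gaussian integrals of polynomials -/

/-! The bound is the variational principle for sums of eigenvalues, evaluated on Hermite functions.
For `n + 1` orthonormal vectors in the form domain, the sum of their energies is at least the sum of
the `n + 1` lowest eigenvalues (`sum_le_sum_of_orthonormal`, `sum_le_sum_hermiteEnergy`). The trial
vectors are the normalized functions `H_k e^{-x²/2}` with `k ≤ n`.

Their energies are explicit. The kinetic part is `k + 1/2`, and these numbers add up to `(n+1)²/2`.
The potential part is the Gaussian mean of `V H_k²`, so only the integrals of `H_j H_k²` are needed.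
Integrating by parts `j` times turns such an integral into that of the `j`-th derivative of `H_k²`.
In the Leibniz expansion each derivative of `H_k` is a multiple of a lower Hermite polynomial, and
orthogonality leaves only the middle term. Hence odd `j` contribute nothing, and `j = 2r`
contributes `2^r (2r)!/r! · binom(k, r)` after normalization (`gaussInt_physHermite_even_mul_sq`).
Summing `binom(k, r)` over `k ≤ n` gives `binom(n+1, r+1)`, and the total is exactly the stated
bound (`hermiteBound_eq_sum_hermiteEnergy`).

The variational principle requires a basis of eigenfunctions. The form `∫ u'v' + ∫ V u v + c ∫ u v`
is coercive for a suitable `c`, because the negative part of `V` is integrable and hence a small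
perturbation of the kinetic energy. The form domain embeds compactly in `L²` since `V → ∞`.
Lax–Milgram then gives a compact, symmetric, injective resolvent `T`, to which the spectral theorem
applies. The eigenspaces of `T` match the pointwise notion of eigenfunction
(`rank_schrodingerEigenspace`): an `L²` solution has finite energy by a cutoff argument and solves
the weak equation, while a weak solution is regular by the du Bois-Reymond argument.

Completeness of the Hermite polynomials gives the expansion of `V` and the density of the form
domain. It rests on the fact that measures with all exponential moments are determined by their
moments.

For `V = x²` the trial functions are eigenfunctions of energy `2k + 1`. Completeness shows that all
eigenvalues are simple and of the form `2j + 1`, so `λ_k ≥ 2k + 1`, and this is the reverse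
inequality. -/

lemma derivative_physHermite_succ (n : ℕ) :
    derivative (physHermite (n + 1)) = C (2 * ((n : ℝ) + 1)) * physHermite n := by
  induction n with
  | zero => simp [physHermite, derivative_mul]; rfl
  | succ n ih =>
    have h1 : physHermite (n + 2) = 2 * X * physHermite (n + 1) - derivative (physHermite (n + 1)) :=
      rfl
    have h2 : physHermite (n + 1) = 2 * X * physHermite n - derivative (physHermite n) := rfl
    have h3 : derivative (2 : ℝ[X]) = 0 := derivative_ofNat 2
    rw [h1]
    simp only [derivative_sub, derivative_mul, ih, derivative_X, h3, derivative_C]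
    rw [h2]
    simp only [map_mul, map_add, map_ofNat, map_one, map_natCast]
    push_cast
    ring

/-- For `r > n` the falling factorial vanishes, so the truncated subtraction `n - r` does no harm.
-/
lemma iterate_derivative_physHermite (r n : ℕ) :
    derivative^[r] (physHermite n) =
      C (2 ^ r * (n.descFactorial r : ℝ)) * physHermite (n - r) := by
  induction r with
  | zero => simp
  | succ r ih =>
    rw [Function.iterate_succ_apply', ih, derivative_mul, derivative_C, zero_mul, zero_add]
    rcases Nat.lt_or_ge r n with h | h
    · obtain ⟨m, rfl⟩ : ∃ m, n = r + 1 + m := ⟨n - (r + 1), by omega⟩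
      have e1 : r + 1 + m - r = m + 1 := by omega
      have e2 : r + 1 + m - (r + 1) = m := by omega
      rw [e1, e2, derivative_physHermite_succ, ← mul_assoc, ← C_mul]
      rw [Nat.descFactorial_succ, e1]
      push_cast
      ring_nf
    · have e1 : n - r = 0 := by omega
      have e2 : n.descFactorial (r + 1) = 0 := Nat.descFactorial_of_lt (by omega)
      rw [e1, e2]
      simp [physHermite]

lemma integrable_polynomial_mul_gaussian (P : ℝ[X]) :
    Integrable fun x : ℝ => P.eval x * Real.exp (-x ^ 2) := by
  induction P using Polynomial.induction_on' with
  | add p q hp hq =>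
    simp only [eval_add, add_mul]
    exact hp.add hq
  | monomial n a =>
    have h := (integrable_rpow_mul_exp_neg_mul_sq (b := 1) one_pos (s := n)
      (by have : (0 : ℝ) ≤ n := n.cast_nonneg; linarith)).const_mul a
    simpa [mul_assoc] using h

/-- The integral of a polynomial against the Gaussian weight `e^{-x^2}`. -/
noncomputable def gaussInt (P : ℝ[X]) : ℝ := ∫ x : ℝ, P.eval x * Real.exp (-x ^ 2)

lemma gaussInt_add (P Q : ℝ[X]) : gaussInt (P + Q) = gaussInt P + gaussInt Q := by
  unfold gaussInt
  rw [← integral_add (integrable_polynomial_mul_gaussian P) (integrable_polynomial_mul_gaussian Q)]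
  simp [add_mul]

lemma gaussInt_C_mul (a : ℝ) (P : ℝ[X]) : gaussInt (C a * P) = a * gaussInt P := by
  unfold gaussInt
  rw [← integral_const_mul]
  simp [mul_assoc]

lemma gaussInt_sub (P Q : ℝ[X]) : gaussInt (P - Q) = gaussInt P - gaussInt Q := by
  have h : P - Q = P + C (-1) * Q := by simp [sub_eq_add_neg]
  rw [h, gaussInt_add, gaussInt_C_mul]
  ring

lemma gaussInt_sum {ι : Type*} (s : Finset ι) (P : ι → ℝ[X]) :
    gaussInt (∑ i ∈ s, P i) = ∑ i ∈ s, gaussInt (P i) := by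
  classical
  induction s using Finset.induction_on with
  | empty => simp [gaussInt]
  | insert a s ha ih => rw [Finset.sum_insert ha, gaussInt_add, ih, Finset.sum_insert ha]

lemma gaussInt_one : gaussInt 1 = √Real.pi := by
  have := integral_gaussian 1
  simpa [gaussInt] using this

/-- Up to sign, the integrand is the derivative of `P e^{-x²}`, which is itself integrable. This is
the adjointness of `d/dx` and `2x - d/dx` in the weighted space. -/
lemma gaussInt_two_X_mul_sub_derivative (P : ℝ[X]) :
    gaussInt (2 * X * P - derivative P) = 0 := by
  have h : ∀ x : ℝ, HasDerivAt (fun x : ℝ => P.eval x * Real.exp (-x ^ 2))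
      (-((2 * X * P - derivative P).eval x * Real.exp (-x ^ 2))) x := by
    intro x
    have h1 : HasDerivAt (fun x : ℝ => Real.exp (-x ^ 2)) (Real.exp (-x ^ 2) * (-(2 * x))) x := by
      have := ((hasDerivAt_pow 2 x).neg).exp
      simpa using this
    have h2 := (P.hasDerivAt x).mul h1
    refine h2.congr_deriv ?_
    simp
    ring
  have h2 := integral_eq_zero_of_hasDerivAt_of_integrable h
    (integrable_polynomial_mul_gaussian _).neg (integrable_polynomial_mul_gaussian _)
  rw [integral_neg] at h2
  unfold gaussInt
  linarith

/-- Repeated integration by parts: `H_{n+1} Q` is `(2x - d/dx)(H_n Q)`, of integral zero, plus `H_n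
Q'`. -/
lemma gaussInt_physHermite_mul (n : ℕ) (Q : ℝ[X]) :
    gaussInt (physHermite n * Q) = gaussInt (derivative^[n] Q) := by
  induction n generalizing Q with
  | zero => simp [physHermite]
  | succ n ih =>
    have h : physHermite (n + 1) * Q = (2 * X * (physHermite n * Q) -
        derivative (physHermite n * Q)) + physHermite n * derivative Q := by
      rw [derivative_mul, physHermite]
      ring
    rw [h, gaussInt_add, gaussInt_two_X_mul_sub_derivative, zero_add, ih,
      Function.iterate_succ_apply]

/-- The squared norm `2^n n! √π` of `H_n` in `L²(e^{-x^2} dx)`. -/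
noncomputable def hermiteNormSq (n : ℕ) : ℝ := 2 ^ n * (n.factorial : ℝ) * √Real.pi

lemma hermiteNormSq_pos (n : ℕ) : 0 < hermiteNormSq n := by
  unfold hermiteNormSq
  have := Real.pi_pos
  positivity

lemma gaussInt_physHermite_mul_physHermite (m n : ℕ) :
    gaussInt (physHermite m * physHermite n) = if m = n then hermiteNormSq n else 0 := by
  wlog h : n ≤ m generalizing m n
  · rw [mul_comm, this n m (by omega)]
    by_cases e : m = n
    · subst e; rfl
    · rw [if_neg e, if_neg (Ne.symm e)]
  rw [gaussInt_physHermite_mul, iterate_derivative_physHermite, gaussInt_C_mul]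
  rcases h.eq_or_lt with rfl | h
  · rw [Nat.sub_self, Nat.descFactorial_self, if_pos rfl]
    simp [physHermite, gaussInt_one, hermiteNormSq]
  · rw [Nat.descFactorial_of_lt h, if_neg h.ne']
    simp

/-- The two factors are multiples of `H_{k-i}` and `H_{k-j}`. With truncated subtraction these
indices can coincide only if `i` or `j` exceeds `k`, and then the corresponding derivative is zero.
-/
lemma gaussInt_iterate_derivative_mul (i j k : ℕ) (h : i ≠ j) :
    gaussInt (derivative^[i] (physHermite k) * derivative^[j] (physHermite k)) = 0 := by
  rw [iterate_derivative_physHermite, iterate_derivative_physHermite]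
  have e : ∀ (a b : ℝ) (P Q : ℝ[X]), C a * P * (C b * Q) = C (a * b) * (P * Q) := by
    intro a b P Q; rw [C_mul]; ring
  rw [e, gaussInt_C_mul, gaussInt_physHermite_mul_physHermite]
  split_ifs with h'
  · rcases Nat.lt_or_ge k i with hi | hi
    · simp [Nat.descFactorial_of_lt hi]
    · rcases Nat.lt_or_ge k j with hj | hj
      · simp [Nat.descFactorial_of_lt hj]
      · omega
  · simp

lemma gaussInt_physHermite_mul_sq (j k : ℕ) :
    gaussInt (physHermite j * (physHermite k * physHermite k)) =
      ∑ i ∈ Finset.range (j + 1), (j.choose i : ℝ) *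
        gaussInt (derivative^[j - i] (physHermite k) * derivative^[i] (physHermite k)) := by
  rw [gaussInt_physHermite_mul, iterate_derivative_mul, gaussInt_sum]
  refine Finset.sum_congr rfl fun i _ => ?_
  rw [← gaussInt_C_mul]
  congr 1
  simp [nsmul_eq_mul]

/-- An odd number of derivatives cannot be shared equally between the two factors, so every Leibniz
term vanishes. -/
lemma gaussInt_physHermite_odd_mul_sq (r k : ℕ) :
    gaussInt (physHermite (2 * r + 1) * (physHermite k * physHermite k)) = 0 := by
  rw [gaussInt_physHermite_mul_sq]
  refine Finset.sum_eq_zero fun i hi => ?_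
  rw [gaussInt_iterate_derivative_mul _ _ _ (by omega), mul_zero]

/-- Only the Leibniz term with `r` derivatives on each factor survives. -/
lemma gaussInt_physHermite_even_mul_sq (r k : ℕ) :
    gaussInt (physHermite (2 * r) * (physHermite k * physHermite k)) =
      2 ^ r * ((2 * r).factorial : ℝ) / (r.factorial : ℝ) * (k.choose r : ℝ) *
        hermiteNormSq k := by
  rw [gaussInt_physHermite_mul_sq, Finset.sum_eq_single r]
  · have e1 : 2 * r - r = r := by omega
    have e : ∀ (a : ℝ) (P : ℝ[X]), C a * P * (C a * P) = C (a * a) * (P * P) := by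
      intro a P; rw [C_mul]; ring
    rw [e1, iterate_derivative_physHermite, e, gaussInt_C_mul,
      gaussInt_physHermite_mul_physHermite, if_pos rfl]
    have hf : ((2 * r).factorial : ℝ) = ((2 * r).choose r : ℝ) * (r.factorial * r.factorial) := by
      have := Nat.choose_mul_factorial_mul_factorial (show r ≤ 2 * r by omega)
      rw [e1] at this
      rw [← this]; push_cast; ring
    have hd : (k.descFactorial r : ℝ) = r.factorial * (k.choose r : ℝ) := by
      rw [Nat.descFactorial_eq_factorial_mul_choose]; push_cast; ring
    rw [hf, hd]
    have hr : (r.factorial : ℝ) ≠ 0 := by positivity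
    rcases Nat.lt_or_ge k r with h | h
    · simp [Nat.choose_eq_zero_of_lt h]
    · have hk : (k.factorial : ℝ) = (k.choose r : ℝ) * r.factorial * (k - r).factorial := by
        rw [← Nat.choose_mul_factorial_mul_factorial h]; push_cast; ring
      have h2 : (2 : ℝ) ^ k = 2 ^ r * 2 ^ (k - r) := by rw [← pow_add]; congr 1; omega
      unfold hermiteNormSq
      rw [hk, h2]
      field_simp
  · intro i hi hne
    rw [gaussInt_iterate_derivative_mul _ _ _ (by omega), mul_zero]
  · intro h
    exact absurd (Finset.mem_range.2 (by omega)) h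

/-- The multiples of `H_n` by `x` are combinations of Hermite polynomials, so these span. -/
lemma span_physHermite_eq_top : Submodule.span ℝ (Set.range physHermite) = ⊤ := by
  have hX : ∀ P ∈ Submodule.span ℝ (Set.range physHermite),
      X * P ∈ Submodule.span ℝ (Set.range physHermite) := by
    intro P hP
    induction hP using Submodule.span_induction with
    | zero => simp
    | add p q _ _ hp hq => rw [mul_add]; exact add_mem hp hq
    | smul a p _ hp => rw [mul_smul_comm]; exact Submodule.smul_mem _ _ hp
    | mem p hp =>
      obtain ⟨n, rfl⟩ := hp
      have hm : ∀ m, physHermite m ∈ Submodule.span ℝ (Set.range physHermite) := fun m =>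
        Submodule.subset_span ⟨m, rfl⟩
      have hd : derivative (physHermite n) ∈ Submodule.span ℝ (Set.range physHermite) := by
        cases n with
        | zero => simp [physHermite]
        | succ n =>
          rw [derivative_physHermite_succ, ← smul_eq_C_mul]
          exact Submodule.smul_mem _ _ (hm n)
      have : X * physHermite n =
          (2⁻¹ : ℝ) • (physHermite (n + 1) + derivative (physHermite n)) := by
        rw [physHermite, sub_add_cancel, smul_eq_C_mul]
        have : (2 : ℝ[X]) = C 2 := rfl
        rw [this, ← mul_assoc, ← mul_assoc, ← C_mul]
        norm_num
      rw [this]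
      exact Submodule.smul_mem _ _ (add_mem (hm _) hd)
  have h1 : (1 : ℝ[X]) ∈ Submodule.span ℝ (Set.range physHermite) :=
    Submodule.subset_span ⟨0, rfl⟩
  rw [eq_top_iff]
  rintro P -
  induction P using Polynomial.induction_on' with
  | add p q hp hq => exact add_mem hp hq
  | monomial n a =>
    rw [← smul_X_eq_monomial]
    refine Submodule.smul_mem _ _ ?_
    induction n with
    | zero => simpa using h1
    | succ n ih => rw [pow_succ']; exact hX _ ih

/-! ### Completeness of the Hermite polynomials -/

/-- Two finite measures on the line with all exponential moments are equal as soon as they have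
the same moments. -/
lemma measure_eq_of_moments_eq {μ ν : Measure ℝ} [IsFiniteMeasure μ] [IsFiniteMeasure ν]
    (hμ : ∀ t : ℝ, Integrable (fun x => Real.exp (t * x)) μ)
    (hν : ∀ t : ℝ, Integrable (fun x => Real.exp (t * x)) ν)
    (h : ∀ n : ℕ, ∫ x, x ^ n ∂μ = ∫ x, x ^ n ∂ν) : μ = ν := by
  open ProbabilityTheory in
  have sμ : integrableExpSet id μ = Set.univ := Set.eq_univ_of_forall hμ
  have sν : integrableExpSet id ν = Set.univ := Set.eq_univ_of_forall hν
  have aμ : AnalyticOnNhd ℝ (mgf id μ) Set.univ := by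
    have := analyticOnNhd_mgf (X := id) (μ := μ)
    rwa [sμ, interior_univ] at this
  have aν : AnalyticOnNhd ℝ (mgf id ν) Set.univ := by
    have := analyticOnNhd_mgf (X := id) (μ := ν)
    rwa [sν, interior_univ] at this
  -- The moments are the Taylor coefficients at zero of the moment generating function, which is
  -- analytic on the whole line.
  have hmgf : mgf id μ = mgf id ν := by
    refine aμ.eq_of_eventuallyEq aν (z₀ := 0) ?_
    have p := hasFPowerSeriesAt_mgf (X := id) (μ := μ) (v := 0) (by simp [sμ])
    have q := hasFPowerSeriesAt_mgf (X := id) (μ := ν) (v := 0) (by simp [sν])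
    have e : (fun n => (∫ x, id x ^ n * Real.exp (0 * id x) ∂μ) / (n.factorial : ℝ)) =
        fun n => (∫ x, id x ^ n * Real.exp (0 * id x) ∂ν) / (n.factorial : ℝ) := by
      funext n
      simp [h n]
    beta_reduce at p q
    rw [e] at p
    have r := p.sub q
    rw [sub_self] at r
    have := r.eventually_eq_zero
    filter_upwards [this] with x hx
    simpa [sub_eq_zero] using hx
  have h0 : μ = 0 ↔ ν = 0 := by
    have := h 0
    simp only [pow_zero, integral_const, smul_eq_mul, mul_one, measureReal_def] at this
    rw [ENNReal.toReal_eq_toReal_iff' (measure_ne_top _ _) (measure_ne_top _ _)] at this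
    rw [← Measure.measure_univ_eq_zero, this, Measure.measure_univ_eq_zero]
  -- The real identity extends to the complex plane, and in particular to the imaginary axis, where
  -- it concerns characteristic functions.
  refine Measure.ext_of_complexMGF_id_eq ?_
  funext z
  exact eqOn_complexMGF_of_mgf' hmgf h0 (by simp [sμ])

/-! ### The Gaussian weight and its square integrable functions -/

lemma measurable_gaussian_density :
    Measurable fun x : ℝ => ENNReal.ofReal (Real.exp (-x ^ 2)) := by fun_prop

lemma ae_hermiteMeasure_iff {p : ℝ → Prop} : (∀ᵐ x ∂hermiteMeasure, p x) ↔ ∀ᵐ x, p x := by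
  unfold hermiteMeasure
  rw [ae_withDensity_iff measurable_gaussian_density]
  have : ∀ x : ℝ, ENNReal.ofReal (Real.exp (-x ^ 2)) ≠ 0 := fun x => by
    simp [Real.exp_pos]
  simp [this]

lemma volume_absolutelyContinuous_hermiteMeasure : volume ≪ hermiteMeasure := by
  refine Measure.AbsolutelyContinuous.mk fun s _ h => ?_
  have h2 : ∀ᵐ x ∂hermiteMeasure, x ∉ s := by
    rw [ae_iff]; simpa using h
  rw [ae_hermiteMeasure_iff, ae_iff] at h2
  simpa using h2

lemma hermiteMeasure_absolutelyContinuous_volume : hermiteMeasure ≪ volume :=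
  withDensity_absolutelyContinuous _ _

lemma integrable_hermiteMeasure_iff {f : ℝ → ℝ} :
    Integrable f hermiteMeasure ↔ Integrable fun x => f x * Real.exp (-x ^ 2) := by
  unfold hermiteMeasure
  rw [integrable_withDensity_iff measurable_gaussian_density (by simp)]
  simp [ENNReal.toReal_ofReal, Real.exp_nonneg]

lemma integral_hermiteMeasure (f : ℝ → ℝ) :
    ∫ x, f x ∂hermiteMeasure = ∫ x, f x * Real.exp (-x ^ 2) := by
  unfold hermiteMeasure
  rw [integral_withDensity_eq_integral_toReal_smul measurable_gaussian_density (by simp)]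
  refine integral_congr_ae (Eventually.of_forall fun x => ?_)
  simp [ENNReal.toReal_ofReal, Real.exp_nonneg, mul_comm]

/-- Multiplication by `e^{-x²/2}` is an isometry between the weighted and the unweighted `L²` space.
Measurability is recovered by multiplying back with `e^{x²/2}`. -/
lemma memLp_hermiteMeasure_iff {f : ℝ → ℝ} :
    MemLp f 2 hermiteMeasure ↔ MemLp (fun x => f x * Real.exp (-x ^ 2 / 2)) 2 volume := by
  have hexp : ∀ x : ℝ, Real.exp (-x ^ 2 / 2) ^ 2 = Real.exp (-x ^ 2) := fun x => by
    rw [← Real.exp_nat_mul]; congr 1; push_cast; ring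
  have hc : Continuous fun x : ℝ => Real.exp (-x ^ 2 / 2) := by fun_prop
  have hc' : Continuous fun x : ℝ => Real.exp (x ^ 2 / 2) := by fun_prop
  have hinv : ∀ x : ℝ, Real.exp (-x ^ 2 / 2) * Real.exp (x ^ 2 / 2) = 1 := fun x => by
    rw [← Real.exp_add]; simp; ring
  have key : AEStronglyMeasurable f volume →
      (MemLp f 2 hermiteMeasure ↔ MemLp (fun x => f x * Real.exp (-x ^ 2 / 2)) 2 volume) := by
    intro hf
    have hfc : AEStronglyMeasurable (fun x => f x * Real.exp (-x ^ 2 / 2)) volume :=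
      hf.mul hc.aestronglyMeasurable
    rw [memLp_two_iff_integrable_sq (hf.mono_ac hermiteMeasure_absolutelyContinuous_volume),
      memLp_two_iff_integrable_sq hfc, integrable_hermiteMeasure_iff]
    simp [mul_pow, hexp]
  refine ⟨fun h => (key ?_).1 h, fun h => (key ?_).2 h⟩
  · exact h.1.mono_ac volume_absolutelyContinuous_hermiteMeasure
  · refine (h.1.mul hc'.aestronglyMeasurable).congr (Eventually.of_forall fun x => ?_)
    simp [mul_assoc, hinv]

lemma memLp_polynomial_hermiteMeasure (P : ℝ[X]) :
    MemLp (fun x => P.eval x) 2 hermiteMeasure := by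
  rw [memLp_two_iff_integrable_sq P.continuous.aestronglyMeasurable, integrable_hermiteMeasure_iff]
  refine (integrable_polynomial_mul_gaussian (P * P)).congr (Eventually.of_forall fun x => ?_)
  simp only [eval_mul, sq]

instance : IsFiniteMeasure hermiteMeasure := by
  have h : Integrable (fun _ : ℝ => (1 : ℝ)) hermiteMeasure := by
    rw [integrable_hermiteMeasure_iff]
    simpa using integrable_polynomial_mul_gaussian 1
  exact (integrable_const_iff_isFiniteMeasure one_ne_zero).1 h

lemma memLp_exp_hermiteMeasure (t : ℝ) : MemLp (fun x => Real.exp (t * x)) 2 hermiteMeasure := by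
  rw [memLp_two_iff_integrable_sq (by fun_prop), integrable_hermiteMeasure_iff]
  -- Complete the square: `2tx - x² = t² - (x - t)²`.
  have h := ((integrable_exp_neg_mul_sq (b := 1) one_pos).comp_sub_right t).const_mul
    (Real.exp (t ^ 2))
  refine h.congr (Eventually.of_forall fun x => ?_)
  simp only [← Real.exp_nat_mul, ← Real.exp_add]
  congr 1; push_cast; ring

/-- A function in `L²(e^{-x^2} dx)` orthogonal to all polynomials vanishes. -/
lemma ae_eq_zero_of_forall_polynomial {g : ℝ → ℝ} (hg : MemLp g 2 hermiteMeasure)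
    (h : ∀ P : ℝ[X], ∫ x, P.eval x * g x ∂hermiteMeasure = 0) : ∀ᵐ x, g x = 0 := by
  have hm : AEMeasurable g hermiteMeasure := hg.1.aemeasurable
  have hp : ∀ f : ℝ → ℝ, MemLp f 2 hermiteMeasure → Integrable (fun x => f x * g x) hermiteMeasure :=
    fun f hf => hf.integrable_mul hg
  have hi : Integrable g hermiteMeasure := hg.integrable (by norm_num)
  -- The positive and negative parts of `g` are used as densities. Both measures integrate every
  -- `L²` function, exponentials included, and orthogonality to the powers of `x` says that their
  -- moments agree.
  have side : ∀ k : ℝ → ℝ, (k = g ∨ k = -g) → AEMeasurable k hermiteMeasure ∧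
      (∀ f : ℝ → ℝ, MemLp f 2 hermiteMeasure →
        Integrable f (hermiteMeasure.withDensity fun x => ENNReal.ofReal (k x))) ∧
      (∀ f : ℝ → ℝ, ∫ x, f x ∂(hermiteMeasure.withDensity fun x => ENNReal.ofReal (k x)) =
        ∫ x, max (k x) 0 * f x ∂hermiteMeasure) := by
    intro k hk
    have hkm : MemLp k 2 hermiteMeasure := by
      rcases hk with rfl | rfl
      · exact hg
      · exact hg.neg
    refine ⟨hkm.1.aemeasurable, fun f hf => ?_, fun f => ?_⟩
    · rw [integrable_withDensity_iff_integrable_smul₀' hkm.1.aemeasurable.ennreal_ofReal (by simp)]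
      have : MemLp (fun x => max (k x) 0) 2 hermiteMeasure := hkm.pos_part
      refine (this.integrable_mul hf).congr (Eventually.of_forall fun x => ?_)
      simp [ENNReal.toReal_ofReal']
    · rw [integral_withDensity_eq_integral_toReal_smul₀ hkm.1.aemeasurable.ennreal_ofReal (by simp)]
      refine integral_congr_ae (Eventually.of_forall fun x => ?_)
      simp [ENNReal.toReal_ofReal']
  obtain ⟨m1, i1, e1⟩ := side g (Or.inl rfl)
  obtain ⟨m2, i2, e2⟩ := side (-g) (Or.inr rfl)
  have hone : MemLp (fun _ : ℝ => (1 : ℝ)) 2 hermiteMeasure := memLp_const 1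
  have f1 : IsFiniteMeasure (hermiteMeasure.withDensity fun x => ENNReal.ofReal (g x)) :=
    (integrable_const_iff_isFiniteMeasure one_ne_zero).1 (i1 _ hone)
  have f2 : IsFiniteMeasure (hermiteMeasure.withDensity fun x => ENNReal.ofReal ((-g) x)) :=
    (integrable_const_iff_isFiniteMeasure one_ne_zero).1 (i2 _ hone)
  have heq := measure_eq_of_moments_eq
    (μ := hermiteMeasure.withDensity fun x => ENNReal.ofReal (g x))
    (ν := hermiteMeasure.withDensity fun x => ENNReal.ofReal ((-g) x))
    (fun t => i1 _ (memLp_exp_hermiteMeasure t)) (fun t => i2 _ (memLp_exp_hermiteMeasure t))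
    (fun n => by
      have hX : MemLp (fun x : ℝ => x ^ n) 2 hermiteMeasure := by
        simpa using memLp_polynomial_hermiteMeasure (X ^ n)
      rw [e1, e2, ← sub_eq_zero, ← integral_sub]
      · refine Eq.trans ?_ (h (X ^ n))
        refine integral_congr_ae (Eventually.of_forall fun x => ?_)
        simp only [Pi.neg_apply, eval_pow, eval_X]
        rcases le_total (g x) 0 with hx | hx
        · rw [max_eq_right hx, max_eq_left (by linarith)]; ring
        · rw [max_eq_left hx, max_eq_right (by linarith)]; ring
      · exact (hg.pos_part).integrable_mul hX
      · exact (hg.neg.pos_part).integrable_mul hX)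
  rw [withDensity_eq_iff_of_sigmaFinite m1.ennreal_ofReal m2.ennreal_ofReal,
    EventuallyEq, ae_hermiteMeasure_iff] at heq
  filter_upwards [heq] with x hx
  -- The positive and negative parts of `g x` are equal, and one of them is zero.
  rcases lt_trichotomy (g x) 0 with h' | h' | h'
  · rw [ENNReal.ofReal_of_nonpos h'.le] at hx
    have := ENNReal.ofReal_eq_zero.1 hx.symm
    simp at this; linarith
  · exact h'
  · rw [ENNReal.ofReal_of_nonpos (p := (-g) x) (by simp; linarith)] at hx
    have := ENNReal.ofReal_eq_zero.1 hx
    linarith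

/-- A function in `L²(e^{-x^2} dx)` orthogonal to all Hermite polynomials vanishes. -/
lemma ae_eq_zero_of_forall_physHermite {g : ℝ → ℝ} (hg : MemLp g 2 hermiteMeasure)
    (h : ∀ n, ∫ x, (physHermite n).eval x * g x ∂hermiteMeasure = 0) : ∀ᵐ x, g x = 0 := by
  refine ae_eq_zero_of_forall_polynomial hg fun P => ?_
  have hi : ∀ P : ℝ[X], Integrable (fun x => P.eval x * g x) hermiteMeasure := fun P =>
    (memLp_polynomial_hermiteMeasure P).integrable_mul hg
  have hP : P ∈ Submodule.span ℝ (Set.range physHermite) := by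
    rw [span_physHermite_eq_top]; trivial
  induction hP using Submodule.span_induction with
  | zero => simp
  | add p q _ _ hp hq =>
    simp only [eval_add, add_mul]
    rw [integral_add (hi p) (hi q), hp, hq, add_zero]
  | smul a p _ hp =>
    simp only [eval_smul, smul_eq_mul, mul_assoc]
    rw [integral_const_mul, hp, mul_zero]
  | mem p hp =>
    obtain ⟨n, rfl⟩ := hp
    exact h n

/-- Every function in `L²(e^{-x^2} dx)` has a Hermite expansion. -/
theorem exists_hasHermiteExpansion {V : ℝ → ℝ} (hV : MemLp V 2 hermiteMeasure) :
    ∃ v, HasHermiteExpansion V v := by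
  let e : ℕ → Lp ℝ 2 hermiteMeasure := fun n =>
    (√(hermiteNormSq n))⁻¹ • (memLp_polynomial_hermiteMeasure (physHermite n)).toLp
  have hinner : ∀ (f g : ℝ → ℝ) (hf : MemLp f 2 hermiteMeasure) (hg : MemLp g 2 hermiteMeasure),
      inner ℝ (hf.toLp f) (hg.toLp g) = ∫ x, f x * g x ∂hermiteMeasure := by
    intro f g hf hg
    rw [L2.inner_def]
    refine integral_congr_ae ?_
    filter_upwards [hf.coeFn_toLp, hg.coeFn_toLp] with x h1 h2
    rw [h1, h2]
    simp [mul_comm]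
  have hH : ∀ m n, inner ℝ ((memLp_polynomial_hermiteMeasure (physHermite m)).toLp)
      ((memLp_polynomial_hermiteMeasure (physHermite n)).toLp) =
        if m = n then hermiteNormSq n else 0 := by
    intro m n
    rw [hinner, ← gaussInt_physHermite_mul_physHermite, integral_hermiteMeasure]
    simp [gaussInt]
  have hs : ∀ n, √(hermiteNormSq n) * √(hermiteNormSq n) = hermiteNormSq n := fun n =>
    Real.mul_self_sqrt (hermiteNormSq_pos n).le
  have hs' : ∀ n, √(hermiteNormSq n) ≠ 0 := fun n => (Real.sqrt_pos.2 (hermiteNormSq_pos n)).ne'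
  have ho : Orthonormal ℝ e := by
    rw [orthonormal_iff_ite]
    intro m n
    simp only [e, real_inner_smul_left, real_inner_smul_right, hH]
    split_ifs with h
    · subst h
      have := hs m; have := hs' m
      field_simp
      nlinarith
    · simp
  have hspan : (Submodule.span ℝ (Set.range e))ᗮ = ⊥ := by
    rw [Submodule.eq_bot_iff]
    intro f hf
    have hz : ∀ᵐ x, f x = 0 := by
      refine ae_eq_zero_of_forall_physHermite (Lp.memLp f) fun n => ?_
      have h1 : inner ℝ (e n) f = 0 :=
        Submodule.inner_right_of_mem_orthogonal (Submodule.subset_span (Set.mem_range_self n)) hf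
      simp only [e, real_inner_smul_left, mul_eq_zero, inv_eq_zero, hs', false_or] at h1
      rw [← h1, ← hinner _ _ _ (Lp.memLp f), Lp.toLp_coeFn]
    rw [Lp.eq_zero_iff_ae_eq_zero]
    exact ae_hermiteMeasure_iff.2 hz
  let b := HilbertBasis.mkOfOrthogonalEqBot ho hspan
  have hb : ∀ n, b n = e n := fun n => by simp [b]
  let a : ℕ → ℝ := fun n => inner ℝ (b n) (hV.toLp V)
  -- `a n` is the coefficient of the normalized polynomial; the second factor passes to `H_n`
  -- itself.
  refine ⟨fun n => a n * (√(hermiteNormSq n))⁻¹, ?_⟩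
  have hsum := (b.hasSum_repr (hV.toLp V)).tendsto_sum_nat
  unfold HasHermiteExpansion
  have h1 : Tendsto (fun N => ‖hV.toLp V - ∑ i ∈ Finset.range N, b.repr (hV.toLp V) i • b i‖ₑ)
      atTop (𝓝 0) := by
    have h2 := (tendsto_const_nhds (x := hV.toLp V)).sub hsum
    rw [sub_self] at h2
    have h3 := h2.enorm
    rwa [enorm_zero] at h3
  refine h1.congr fun N => ?_
  have hS : ∀ N, MemLp (fun x => ∑ j ∈ Finset.range N, a j * (√(hermiteNormSq j))⁻¹ *
      (physHermite j).eval x) 2 hermiteMeasure := fun N =>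
    memLp_finsetSum _ fun j _ => (memLp_polynomial_hermiteMeasure (physHermite j)).const_mul _
  have hSe : ∀ N, ∑ i ∈ Finset.range N, b.repr (hV.toLp V) i • b i = (hS N).toLp := by
    intro N
    induction N with
    | zero =>
      rw [Finset.sum_range_zero, eq_comm, ← MemLp.toLp_zero (MemLp.zero' (p := 2))]
      congr 1
    | succ N ih =>
      rw [Finset.sum_range_succ, ih, b.repr_apply_apply, hb, smul_smul, ← MemLp.toLp_const_smul,
        ← MemLp.toLp_add]
      refine MemLp.toLp_congr _ _ (Eventually.of_forall fun x => ?_)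
      simp [Finset.sum_range_succ, a, hb]
  rw [hSe, ← MemLp.toLp_sub, Lp.enorm_toLp]
  rfl

/-! ### Compact symmetric operators: listing the spectrum -/

section Abstract

variable {L : Type} [NormedAddCommGroup L] [InnerProductSpace ℝ L]

lemma dist_sq_of_orthogonal {x y : L} (h : inner ℝ x y = 0) : dist x y ^ 2 = ‖x‖ ^ 2 + ‖y‖ ^ 2 := by
  rw [dist_eq_norm, @norm_sub_sq_real, h]
  ring

/-- A compact symmetric operator has only finitely many eigenvalues away from zero. -/
lemma finite_eigenvalues_of_isCompactOperator {T : L →L[ℝ] L} (hT : IsCompactOperator T)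
    (hs : T.IsSymmetric) {ε : ℝ} (hε : 0 < ε) :
    {τ : ℝ | ε ≤ τ ∧ Module.End.HasEigenvalue (T : Module.End ℝ L) τ}.Finite := by
  by_contra hinf
  have hinf : Set.Infinite _ := hinf
  let f := hinf.natEmbedding
  have hv : ∀ n, ∃ v : L, ‖v‖ = 1 ∧ T v = (f n : ℝ) • v := by
    intro n
    obtain ⟨w, hw⟩ := (f n).2.2.exists_hasEigenvector
    have hw0 : ‖w‖ ≠ 0 := norm_ne_zero_iff.2 hw.2
    refine ⟨‖w‖⁻¹ • w, ?_, ?_⟩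
    · rw [norm_smul, norm_inv, norm_norm, inv_mul_cancel₀ hw0]
    · have : T w = (f n : ℝ) • w := hw.apply_eq_smul
      rw [map_smul, this, smul_comm]
  choose v hv1 hv2 using hv
  have horth : ∀ m n, m ≠ n → inner ℝ (v m) (v n) = 0 := by
    intro m n hmn
    have h1 : inner ℝ (T (v m)) (v n) = inner ℝ (v m) (T (v n)) := hs (v m) (v n)
    rw [hv2, hv2, real_inner_smul_left, real_inner_smul_right] at h1
    have h2 : (f m : ℝ) ≠ f n := fun h => hmn (f.injective (Subtype.ext h))
    have h3 : ((f m : ℝ) - f n) * inner ℝ (v m) (v n) = 0 := by linarith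
    exact (mul_eq_zero.1 h3).resolve_left (sub_ne_zero.2 h2)
  -- The images of the orthonormal eigenvectors are orthogonal with norms at least `ε`, hence more
  -- than `ε` apart, so no subsequence of them converges.
  obtain ⟨K, hK, hKs⟩ := hT.image_closedBall_subset_compact 1
  have hmem : ∀ n, T (v n) ∈ K := fun n => hKs ⟨v n, by simp [hv1], rfl⟩
  obtain ⟨a, -, φ, hφ, hlim⟩ := hK.tendsto_subseq hmem
  obtain ⟨N, hN⟩ := Metric.tendsto_atTop.1 hlim (ε / 2) (by positivity)
  have h1 := hN N le_rfl
  have h2 := hN (N + 1) (by omega)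
  have hd : dist (T (v (φ N))) (T (v (φ (N + 1)))) < ε := by
    have := dist_triangle_right (T (v (φ N))) (T (v (φ (N + 1)))) a
    simp only [Function.comp_apply] at h1 h2
    linarith
  have hne : φ N ≠ φ (N + 1) := (hφ (Nat.lt_succ_self N)).ne
  have hsq : dist (T (v (φ N))) (T (v (φ (N + 1)))) ^ 2 = (f (φ N) : ℝ) ^ 2 + (f (φ (N + 1)) : ℝ) ^ 2 := by
    rw [dist_sq_of_orthogonal, hv2, hv2, norm_smul, norm_smul, hv1, hv1]
    · simp
    · rw [hv2, hv2, real_inner_smul_left, real_inner_smul_right, horth _ _ hne]; simp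
  have h5 : ε ≤ (f (φ N) : ℝ) := (f (φ N)).2.1
  have h6 : 0 ≤ dist (T (v (φ N))) (T (v (φ (N + 1)))) := dist_nonneg
  nlinarith [sq_nonneg (f (φ (N + 1)) : ℝ)]

/-- An infinite subset of a linear order with finite initial segments is listed by a monotone
sequence. -/
lemma nonempty_nat_orderIso {α : Type*} [LinearOrder α] [Infinite α]
    (h : ∀ a : α, (Set.Iic a).Finite) : Nonempty (ℕ ≃o α) := by
  classical
  let : LocallyFiniteOrder α := LocallyFiniteOrder.ofFiniteIcc fun a b =>
    (h b).subset Set.Icc_subset_Iic_self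
  have : NoMaxOrder α := ⟨fun a => by
    by_contra! hc
    exact Set.infinite_univ ((h a).subset fun b _ => hc b)⟩
  obtain ⟨a₀⟩ : Nonempty α := inferInstance
  obtain ⟨b, hb, hmin⟩ := Set.exists_min_image (Set.Iic a₀) id (h a₀) ⟨a₀, le_rfl⟩
  let : OrderBot α :=
    { bot := b
      bot_le := fun c => by
        rcases le_total c a₀ with hc | hc
        · exact hmin c hc
        · exact le_trans hb hc }
  let : SuccOrder α := LinearLocallyFiniteOrder.succOrder α
  let : PredOrder α := LinearLocallyFiniteOrder.predOrder α
  exact ⟨orderIsoNatOfLinearSuccPredArch.symm⟩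

/-- Real numbers with finite multiplicities that accumulate only at `+∞` form a sequence. -/
lemma exists_monotone_sequence_of_multiplicities (d : ℝ → ℕ)
    (hfin : ∀ R : ℝ, {μ | μ ≤ R ∧ d μ ≠ 0}.Finite) (hinf : {μ | d μ ≠ 0}.Infinite) :
    ∃ lam : ℕ → ℝ, Monotone lam ∧ Tendsto lam atTop atTop ∧
      ∀ μ, Cardinal.mk {k // lam k = μ} = d μ := by
  -- Each `μ` is replaced by `d μ` labelled copies, ordered lexicographically, so that an order
  -- isomorphism with `ℕ` lists it with multiplicity.
  let α := {p : ℝ ×ₗ ℕ // (ofLex p).2 < d (ofLex p).1}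
  have hle : ∀ R : ℝ, {p : α | (ofLex p.1).1 ≤ R}.Finite := by
    intro R
    have hF : (⋃ μ ∈ {μ | μ ≤ R ∧ d μ ≠ 0}, (fun i : ℕ => toLex (μ, i)) '' Set.Iio (d μ)).Finite :=
      (hfin R).biUnion fun μ _ => (Set.finite_Iio (d μ)).image _
    refine Set.Finite.of_finite_image (f := Subtype.val) (hF.subset ?_)
      Subtype.val_injective.injOn
    rintro _ ⟨⟨p, hp⟩, hpR, rfl⟩
    simp only [Set.mem_iUnion, Set.mem_image]
    exact ⟨(ofLex p).1, ⟨hpR, by omega⟩, (ofLex p).2, hp, rfl⟩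
  have hmono : ∀ p q : α, p ≤ q → (ofLex p.1).1 ≤ (ofLex q.1).1 := fun p q h =>
    (Prod.Lex.monotone_fst _ _ h)
  have : Infinite α := by
    by_contra hc
    have : Finite α := not_infinite_iff_finite.1 hc
    refine hinf ((Set.finite_range fun p : α => (ofLex p.1).1).subset fun μ hμ => ?_)
    exact ⟨⟨toLex (μ, 0), Nat.pos_of_ne_zero hμ⟩, rfl⟩
  obtain ⟨e⟩ := nonempty_nat_orderIso (α := α) fun a => (hle (ofLex a.1).1).subset fun p hp =>
    hmono p a hp
  have hm : Monotone fun k => (ofLex (e k).1).1 := fun i j hij => hmono _ _ (e.monotone hij)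
  refine ⟨fun k => (ofLex (e k).1).1, hm, ?_, fun μ => ?_⟩
  · refine tendsto_atTop_atTop_of_monotone hm fun R => ?_
    by_contra! hc
    have : Set.Finite (Set.univ : Set ℕ) := by
      refine Set.Finite.of_finite_image (f := e) ((hle R).subset ?_) e.injective.injOn
      rintro _ ⟨k, -, rfl⟩
      exact (hc k).le
    exact Set.infinite_univ this
  · let g : {k // (ofLex (e k).1).1 = μ} ≃ Fin (d μ) :=
      { toFun := fun k => ⟨(ofLex (e k.1).1).2, by
          have := (e k.1).2
          rwa [k.2] at this⟩
        invFun := fun i => ⟨e.symm ⟨toLex (μ, i.1), i.2⟩, by simp⟩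
        left_inv := fun k => by
          apply Subtype.ext
          apply e.injective
          simp only [OrderIso.apply_symm_apply]
          apply Subtype.ext
          exact congrArg toLex (Prod.ext k.2.symm rfl :
            (μ, (ofLex (e k.1).1).2) = ofLex (e k.1).1)
        right_inv := fun i => by simp }
    rw [Cardinal.mk_congr g]
    simp

/-- The list, with multiplicities, of the numbers `μ` for which `(μ + c)⁻¹` is an eigenvalue of a
positive compact operator. -/
lemma exists_sequence_of_isCompactOperator [CompleteSpace L] {T : L →L[ℝ] L} (hT : IsCompactOperator T)
    (hs : T.IsSymmetric) (hinj : ∀ f, T f = 0 → f = 0) (hpos : ∀ f, 0 ≤ inner ℝ f (T f))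
    (hdim : ¬ FiniteDimensional ℝ L) (c : ℝ) :
    ∃ lam : ℕ → ℝ, Monotone lam ∧ Tendsto lam atTop atTop ∧ ∀ μ, Cardinal.mk {k // lam k = μ} =
      (Module.finrank ℝ (Module.End.eigenspace (T : Module.End ℝ L) (μ + c)⁻¹)) := by
  have hev : ∀ τ, Module.End.eigenspace (T : Module.End ℝ L) τ ≠ ⊥ → 0 < τ := by
    intro τ hτ
    obtain ⟨f, hf, hf0⟩ := Submodule.exists_mem_ne_zero_of_ne_bot hτ
    have hf' : T f = τ • f := Module.End.mem_eigenspace_iff.1 hf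
    have h1 := hpos f
    rw [hf', real_inner_smul_right] at h1
    have h2 : 0 < inner ℝ f f := real_inner_self_pos.2 hf0
    have h3 : 0 ≤ τ := nonneg_of_mul_nonneg_left h1 h2
    refine h3.lt_of_ne fun h => hf0 (hinj f ?_)
    rw [hf', ← h, zero_smul]
  have hfd : ∀ τ, FiniteDimensional ℝ (Module.End.eigenspace (T : Module.End ℝ L) τ) := by
    intro τ
    by_cases h : Module.End.eigenspace (T : Module.End ℝ L) τ = ⊥
    · rw [h]; infer_instance
    · exact ContinuousLinearMap.finite_dimensional_eigenspace hT τ (hev τ h).ne'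
  have hbot : ∀ τ, Module.finrank ℝ (Module.End.eigenspace (T : Module.End ℝ L) τ) ≠ 0 ↔
      Module.End.eigenspace (T : Module.End ℝ L) τ ≠ ⊥ := by
    intro τ
    have := hfd τ
    rw [Ne, Submodule.finrank_eq_zero]
  refine exists_monotone_sequence_of_multiplicities
    (fun μ => Module.finrank ℝ (Module.End.eigenspace (T : Module.End ℝ L) (μ + c)⁻¹)) ?_ ?_
  · intro R
    -- The absolute value and the added `1` keep this lower bound for `(μ + c)⁻¹` positive when `R +
    -- c ≤ 0`.
    have hR : 0 < (|R + c| + 1)⁻¹ := by positivity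
    refine Set.Finite.of_finite_image (f := fun μ => (μ + c)⁻¹)
      ((finite_eigenvalues_of_isCompactOperator hT hs hR).subset ?_)
      (fun a _ b _ h => by simpa using h)
    rintro _ ⟨μ, ⟨hμ, hd⟩, rfl⟩
    have h1 := (hbot _).1 hd
    refine ⟨?_, h1⟩
    have h2 := inv_pos.1 (hev _ h1)
    refine inv_anti₀ h2 ?_
    have := le_abs_self (R + c)
    linarith
  -- Finitely many eigenvalues with finite-dimensional eigenspaces would span the whole space.
  · intro hfin
    apply hdim
    have hf2 : {τ : ℝ | Module.End.eigenspace (T : Module.End ℝ L) τ ≠ ⊥}.Finite := by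
      refine (hfin.image fun μ => (μ + c)⁻¹).subset fun τ hτ => ⟨τ⁻¹ - c, ?_, by simp⟩
      simpa [hbot] using hτ
    have h3 : (⨆ τ, Module.End.eigenspace (T : Module.End ℝ L) τ) =
        ⨆ τ ∈ {τ : ℝ | Module.End.eigenspace (T : Module.End ℝ L) τ ≠ ⊥},
          Module.End.eigenspace (T : Module.End ℝ L) τ := by
      refine le_antisymm (iSup_le fun τ => ?_) (iSup₂_le fun τ _ => le_iSup _ τ)
      by_cases h : Module.End.eigenspace (T : Module.End ℝ L) τ = ⊥
      · rw [h]; exact bot_le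
      · exact le_iSup₂_of_le τ h le_rfl
    have : Finite {τ : ℝ | Module.End.eigenspace (T : Module.End ℝ L) τ ≠ ⊥} := hf2
    have h4 : FiniteDimensional ℝ
        (⨆ τ, Module.End.eigenspace (T : Module.End ℝ L) τ : Submodule ℝ L) := by
      rw [h3, iSup_subtype']
      have := hfd
      exact Submodule.finiteDimensional_iSup _
    have h5 := ContinuousLinearMap.orthogonalComplement_iSup_eigenspaces_eq_bot hT hs
    have h6 := Submodule.orthogonal_eq_bot_iff.1 h5
    rw [h6] at h4
    exact LinearEquiv.finiteDimensional Submodule.topEquiv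

/-- If the eigenvalues of a compact symmetric operator are listed with multiplicity, there is a
Hilbert basis of eigenvectors that matches the list. -/
lemma exists_hilbertBasis_of_multiplicities [CompleteSpace L] {T : L →L[ℝ] L} (hT : IsCompactOperator T)
    (hs : T.IsSymmetric) (c : ℝ) {lam : ℕ → ℝ} (hlim : Tendsto lam atTop atTop)
    (hmult : ∀ μ, Cardinal.mk {k // lam k = μ} =
      Module.rank ℝ (Module.End.eigenspace (T : Module.End ℝ L) (μ + c)⁻¹)) :
    ∃ b : HilbertBasis ℕ ℝ L, ∀ k, T (b k) = (lam k + c)⁻¹ • b k := by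
  have hfib : ∀ μ, Finite {k // lam k = μ} := by
    intro μ
    obtain ⟨N, hN⟩ := eventually_atTop.1 (hlim.eventually_gt_atTop μ)
    refine Set.Finite.subset (Set.finite_Iio N) fun k (hk : lam k = μ) => ?_
    by_contra hc
    exact absurd hk (hN k (not_lt.1 hc)).ne'
  have hfd : ∀ μ, FiniteDimensional ℝ (Module.End.eigenspace (T : Module.End ℝ L) (μ + c)⁻¹) := by
    intro μ
    have := hfib μ
    rw [FiniteDimensional, ← Module.rank_lt_aleph0_iff, ← hmult]
    exact Cardinal.mk_lt_aleph0
  have hbasis : ∀ μ, ∃ b : {k // lam k = μ} → L, Orthonormal ℝ b ∧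
      Submodule.span ℝ (Set.range b) = Module.End.eigenspace (T : Module.End ℝ L) (μ + c)⁻¹ := by
    intro μ
    have := hfib μ
    have := hfd μ
    have := Fintype.ofFinite {k // lam k = μ}
    have hcard : Fintype.card (Fin (Module.finrank ℝ
        (Module.End.eigenspace (T : Module.End ℝ L) (μ + c)⁻¹))) =
          Fintype.card {k // lam k = μ} := by
      rw [Fintype.card_fin, Module.finrank, ← hmult, Cardinal.mk_fintype, Cardinal.toNat_natCast]
    let b := (stdOrthonormalBasis ℝ (Module.End.eigenspace (T : Module.End ℝ L) (μ + c)⁻¹)).reindex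
      (Fintype.equivOfCardEq hcard)
    refine ⟨fun k => (b k : L), b.orthonormal.comp_linearIsometry (Submodule.subtypeₗᵢ _), ?_⟩
    have h1 := congrArg (Submodule.map (Submodule.subtype _)) b.toBasis.span_eq
    rw [Submodule.map_span, ← Set.range_comp, Submodule.map_top, Submodule.range_subtype] at h1
    refine Eq.trans ?_ h1
    congr 2
  choose e heo hes using hbasis
  -- The basis of each eigenspace is indexed by the positions at which its eigenvalue is listed, so
  -- the bases glue to one family over `ℕ`.
  let ψ : ℕ → L := fun k => e (lam k) ⟨k, rfl⟩
  have hψ : ∀ μ k (hk : lam k = μ), ψ k = e μ ⟨k, hk⟩ := by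
    rintro μ k rfl; rfl
  have hψm : ∀ k, ψ k ∈ Module.End.eigenspace (T : Module.End ℝ L) (lam k + c)⁻¹ := fun k => by
    rw [← hes]; exact Submodule.subset_span ⟨⟨k, rfl⟩, rfl⟩
  have ho : Orthonormal ℝ ψ := by
    refine ⟨fun k => (heo _).1 _, fun i j hij => ?_⟩
    by_cases h : lam i = lam j
    · change inner ℝ (ψ i) (ψ j) = 0
      rw [hψ _ i h, hψ _ j rfl]
      exact (heo _).2 (by simpa using hij)
    · have h2 : (lam i + c)⁻¹ ≠ (lam j + c)⁻¹ := by simpa using h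
      exact hs.orthogonalFamily_eigenspaces h2 ⟨ψ i, hψm i⟩ ⟨ψ j, hψm j⟩
  have hsp : (Submodule.span ℝ (Set.range ψ))ᗮ = ⊥ := by
    rw [eq_bot_iff, ← ContinuousLinearMap.orthogonalComplement_iSup_eigenspaces_eq_bot hT hs]
    refine Submodule.orthogonal_le (iSup_le fun τ => ?_)
    -- Since `0⁻¹ = 0`, this covers `τ = 0` as well.
    have h1 : τ = (τ⁻¹ - c + c)⁻¹ := by simp
    rw [h1, ← hes]
    refine Submodule.span_mono ?_
    rintro _ ⟨⟨k, hk⟩, rfl⟩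
    exact ⟨k, hψ _ k hk⟩
  refine ⟨HilbertBasis.mkOfOrthogonalEqBot ho hsp, fun k => ?_⟩
  rw [HilbertBasis.coe_mkOfOrthogonalEqBot]
  exact Module.End.mem_eigenspace_iff.1 (hψm k)

/-- The variational principle for sums of eigenvalues, in terms of the coefficients of the trial
vectors in a Hilbert basis. -/
lemma sum_le_sum_of_orthonormal (b : HilbertBasis ℕ ℝ L) {a : ℕ → ℝ} (ha : Monotone a) (n : ℕ)
    {φ : ℕ → L} (hφ : Orthonormal ℝ φ) {q : ℕ → ℝ}
    (hq : ∀ i N, ∑ j ∈ Finset.range N, a j * inner ℝ (b j) (φ i) ^ 2 ≤ q i) :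
    ∑ j ∈ Finset.range (n + 1), a j ≤ ∑ i ∈ Finset.range (n + 1), q i := by
  -- These weights lie in `[0, 1]` by Bessel and have total mass `n + 1` by Parseval. Among such
  -- weights `∑ a_j w_j` is least when the mass sits on the first `n + 1` indices.
  let w : ℕ → ℝ := fun j => ∑ i ∈ Finset.range (n + 1), inner ℝ (b j) (φ i) ^ 2
  have hw0 : ∀ j, 0 ≤ w j := fun j => Finset.sum_nonneg fun i _ => sq_nonneg _
  have hw1 : ∀ j, w j ≤ 1 := by
    intro j
    have h1 := hφ.sum_inner_products_le (b j) (s := Finset.range (n + 1))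
    rw [b.orthonormal.1 j] at h1
    refine le_trans (le_of_eq ?_) (h1.trans_eq (by norm_num))
    refine Finset.sum_congr rfl fun i _ => ?_
    rw [real_inner_comm, Real.norm_eq_abs, sq_abs]
  have hlim : Tendsto (fun N => ∑ j ∈ Finset.range N, w j) atTop (𝓝 ((n : ℝ) + 1)) := by
    have h1 : ∀ i, HasSum (fun j => inner ℝ (b j) (φ i) ^ 2) 1 := by
      intro i
      have h2 := b.hasSum_inner_mul_inner (φ i) (φ i)
      rw [real_inner_self_eq_norm_sq, hφ.1 i, one_pow] at h2
      refine h2.congr_fun ?_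
      intro j
      rw [real_inner_comm, sq]
    have h3 := hasSum_sum (s := Finset.range (n + 1)) fun i _ => h1 i
    have := h3.tendsto_sum_nat
    simpa using this
  -- After subtracting `a n`, the coefficients are nonpositive up to `n`, where `w ≤ 1` is used, and
  -- nonnegative beyond, where `w ≥ 0` suffices. Truncating at `N` avoids any summability of `a j *
  -- w j`.
  have hkey : ∀ N, n + 1 ≤ N → ∑ j ∈ Finset.range (n + 1), (a j - a n) +
      a n * ∑ j ∈ Finset.range N, w j ≤ ∑ i ∈ Finset.range (n + 1), q i := by
    intro N hN
    have h1 : ∑ j ∈ Finset.range N, a j * w j ≤ ∑ i ∈ Finset.range (n + 1), q i := by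
      simp only [w, Finset.mul_sum]
      rw [Finset.sum_comm]
      exact Finset.sum_le_sum fun i _ => hq i N
    have h2 : ∑ j ∈ Finset.range (n + 1), (a j - a n) ≤
        ∑ j ∈ Finset.range N, (a j - a n) * w j := by
      rw [← Finset.sum_range_add_sum_Ico _ hN]
      have h3 : 0 ≤ ∑ j ∈ Finset.Ico (n + 1) N, (a j - a n) * w j := by
        refine Finset.sum_nonneg fun j hj => mul_nonneg ?_ (hw0 j)
        have := ha (show n ≤ j by have := (Finset.mem_Ico.1 hj).1; omega)
        linarith
      have h4 : ∑ j ∈ Finset.range (n + 1), (a j - a n) ≤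
          ∑ j ∈ Finset.range (n + 1), (a j - a n) * w j := by
        refine Finset.sum_le_sum fun j hj => ?_
        have := ha (show j ≤ n by have := Finset.mem_range.1 hj; omega)
        nlinarith [hw1 j]
      linarith
    have h5 : ∑ j ∈ Finset.range N, (a j - a n) * w j =
        ∑ j ∈ Finset.range N, a j * w j - a n * ∑ j ∈ Finset.range N, w j := by
      rw [Finset.mul_sum, ← Finset.sum_sub_distrib]
      exact Finset.sum_congr rfl fun j _ => by ring
    linarith
  have hfin := le_of_tendsto ((hlim.const_mul (a n)).const_add
    (∑ j ∈ Finset.range (n + 1), (a j - a n))) (eventually_atTop.2 ⟨n + 1, hkey⟩)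
  rw [Finset.sum_sub_distrib] at hfin
  simp only [Finset.sum_const, Finset.card_range, nsmul_eq_mul] at hfin
  push_cast at hfin
  linarith

/-! ### The operator of a coercive form -/

variable {H : Type} [NormedAddCommGroup H] [InnerProductSpace ℝ H]

/-- Bessel's inequality for a nonnegative symmetric form and eigenvectors of it. -/
lemma sum_mul_inner_sq_le (B : H →L[ℝ] H →L[ℝ] ℝ) (hsymm : ∀ h k, B h k = B k h)
    (hpos : ∀ h, 0 ≤ B h h) (J : H →L[ℝ] L) {ψ : ℕ → L} (hψ : Orthonormal ℝ ψ) {a : ℕ → ℝ}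
    {h : ℕ → H} (hJ : ∀ j, J (h j) = ψ j) (hB : ∀ j k, B (h j) k = a j * inner ℝ (ψ j) (J k))
    (k : H) (N : ℕ) :
    ∑ j ∈ Finset.range N, a j * inner ℝ (ψ j) (J k) ^ 2 ≤ B k k := by
  -- For this projection of `k`, both `B p k` and `B p p` equal the sum in question, and `0 ≤ B (k -
  -- p) (k - p)` is the claim.
  let p := ∑ j ∈ Finset.range N, inner ℝ (ψ j) (J k) • h j
  have h1 := hpos (k - p)
  have hpk : B p k = ∑ j ∈ Finset.range N, a j * inner ℝ (ψ j) (J k) ^ 2 := by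
    simp only [p, map_sum, map_smul, _root_.sum_apply, _root_.smul_apply,
      hB, smul_eq_mul]
    exact Finset.sum_congr rfl fun j _ => by ring
  have hpp : B p p = ∑ j ∈ Finset.range N, a j * inner ℝ (ψ j) (J k) ^ 2 := by
    have hin : ∀ j ∈ Finset.range N, inner ℝ (ψ j) (J p) = inner ℝ (ψ j) (J k) := by
      intro j hj
      simp only [p, map_sum, map_smul, hJ]
      exact hψ.inner_right_sum _ hj
    conv_lhs => enter [1]; simp only [p]
    simp only [map_sum, map_smul, _root_.sum_apply, _root_.smul_apply,
      hB, smul_eq_mul]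
    refine Finset.sum_congr rfl fun j hj => ?_
    rw [hin j hj]; ring
  simp only [map_sub, _root_.sub_apply] at h1
  rw [hsymm k p] at h1
  linarith

variable [CompleteSpace H]

/-- A coercive symmetric form whose domain embeds compactly and densely is the form of the inverse
of an injective compact operator. -/
lemma exists_compact_operator_of_form [CompleteSpace L] (B : H →L[ℝ] H →L[ℝ] ℝ) (hsymm : ∀ h k, B h k = B k h)
    (hco : IsCoercive B) (J : H →L[ℝ] L) (hJ : IsCompactOperator J)
    (hdense : ∀ f : L, (∀ k, inner ℝ f (J k) = 0) → f = 0) :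
    ∃ T : L →L[ℝ] L, IsCompactOperator T ∧ T.IsSymmetric ∧ (∀ f, T f = 0 → f = 0) ∧
      (∀ f, 0 ≤ inner ℝ f (T f)) ∧
      (∀ f, ∃ h, J h = T f ∧ ∀ k, B h k = inner ℝ f (J k)) ∧
      (∀ f h, (∀ k, B h k = inner ℝ f (J k)) → T f = J h) := by
  -- Lax–Milgram: `R f` represents the functional `k ↦ ⟨f, J k⟩` through the form `B`.
  let S := hco.continuousLinearEquivOfBilin
  let R : L →L[ℝ] H := (S.symm : H →L[ℝ] H).comp (ContinuousLinearMap.adjoint J)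
  have hR : ∀ f k, B (R f) k = inner ℝ f (J k) := by
    intro f k
    rw [← hco.continuousLinearEquivOfBilin_apply]
    simp [R, S, ContinuousLinearMap.adjoint_inner_left]
  have hpos : ∀ h, 0 ≤ B h h := by
    obtain ⟨C, hC, hB⟩ := hco
    exact fun h => le_trans (by positivity) (hB h)
  have huniq : ∀ h, (∀ k, B h k = 0) → h = 0 := by
    obtain ⟨C, hC, hB⟩ := hco
    intro h hh
    have h1 := hB h
    rw [hh] at h1
    by_contra hne
    have : 0 < ‖h‖ := norm_pos_iff.2 hne
    have : 0 < C * ‖h‖ * ‖h‖ := by positivity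
    linarith
  refine ⟨J.comp R, hJ.comp_clm R, ?_, ?_, ?_, fun f => ⟨R f, rfl, hR f⟩, ?_⟩
  · intro f g
    change inner ℝ (J (R f)) g = inner ℝ f (J (R g))
    rw [real_inner_comm, ← hR, ← hR, hsymm]
  · intro f hf
    have hf : J (R f) = 0 := hf
    have h1 : B (R f) (R f) = 0 := by rw [hR, hf, inner_zero_right]
    have h2 : R f = 0 := by
      obtain ⟨C, hC, hB⟩ := hco
      have h3 := hB (R f)
      rw [h1] at h3
      by_contra hne
      have : 0 < ‖R f‖ := norm_pos_iff.2 hne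
      have : 0 < C * ‖R f‖ * ‖R f‖ := by positivity
      linarith
    refine hdense f fun k => ?_
    rw [← hR, h2]
    simp
  · intro f
    change 0 ≤ inner ℝ f (J (R f))
    rw [← hR]
    exact hpos _
  · intro f h hh
    have : R f - h = 0 := huniq _ fun k => by simp [hR, hh]
    change J (R f) = J h
    rw [sub_eq_zero.1 this]

end Abstract

/-! ### Square integrable functions on the line and their primitives -/

lemma intervalIntegrable_of_locallyIntegrable {f : ℝ → ℝ} (hf : LocallyIntegrable f volume)
    (a b : ℝ) : IntervalIntegrable f volume a b :=
  (hf.integrableOn_isCompact isCompact_uIcc).intervalIntegrable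

lemma locallyIntegrable_of_memLp {f : ℝ → ℝ} (hf : MemLp f 2 volume) :
    LocallyIntegrable f volume := hf.locallyIntegrable (by norm_num)

lemma intervalIntegrable_of_memLp {f : ℝ → ℝ} (hf : MemLp f 2 volume) (a b : ℝ) :
    IntervalIntegrable f volume a b :=
  intervalIntegrable_of_locallyIntegrable (locallyIntegrable_of_memLp hf) a b

/-- The function with value `c` at zero and derivative `g`. -/
noncomputable def primitive (c : ℝ) (g : ℝ → ℝ) (x : ℝ) : ℝ := c + ∫ t in (0 : ℝ)..x, g t

lemma primitive_sub {g : ℝ → ℝ} (hg : LocallyIntegrable g volume) (c x y : ℝ) :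
    primitive c g x - primitive c g y = ∫ t in y..x, g t := by
  unfold primitive
  rw [← intervalIntegral.integral_interval_sub_left (intervalIntegrable_of_locallyIntegrable hg 0 x)
    (intervalIntegrable_of_locallyIntegrable hg 0 y)]
  ring

lemma continuous_primitive {g : ℝ → ℝ} (hg : LocallyIntegrable g volume) (c : ℝ) :
    Continuous (primitive c g) :=
  continuous_const.add
    (intervalIntegral.continuous_primitive (intervalIntegrable_of_locallyIntegrable hg) 0)

lemma absolutelyContinuousOnInterval_primitive {g : ℝ → ℝ} (hg : LocallyIntegrable g volume)
    (c a b : ℝ) : AbsolutelyContinuousOnInterval (primitive c g) a b := by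
  have h1 : AbsolutelyContinuousOnInterval (fun _ : ℝ => c) a b :=
    contDiffOn_const.absolutelyContinuousOnInterval
  -- The interval is enlarged to contain the base point `0` of the integral.
  have hle : min (min a b) 0 ≤ max (max a b) 0 := (min_le_right _ _).trans (le_max_right _ _)
  have h2 := (intervalIntegrable_of_locallyIntegrable hg (min (min a b) 0) (max (max a b) 0)
    |>.absolutelyContinuousOnInterval_intervalIntegral (c := 0)
      (by rw [Set.uIcc_of_le hle]; simp))
  refine h1.add (h2.mono ?_)
  rw [Set.uIcc_of_le hle]
  exact Set.Icc_subset_Icc (min_le_left _ _) (le_max_left _ _)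

lemma ae_hasDerivAt_primitive {g : ℝ → ℝ} (hg : LocallyIntegrable g volume) (c : ℝ) :
    ∀ᵐ x, HasDerivAt (primitive c g) (g x) x := by
  filter_upwards [_root_.LocallyIntegrable.ae_hasDerivAt_integral hg] with x hx
  exact (hx 0).const_add c

lemma primitive_congr_ae {f g : ℝ → ℝ} (h : f =ᵐ[volume] g) (c : ℝ) :
    primitive c f = primitive c g := by
  funext x
  unfold primitive
  rw [intervalIntegral.integral_congr_ae (h.mono fun y hy _ => hy)]

lemma real_inner_Lp (f g : Lp ℝ 2 (volume : Measure ℝ)) : inner ℝ f g = ∫ x, f x * g x := by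
  rw [L2.inner_def]
  refine integral_congr_ae (Eventually.of_forall fun x => ?_)
  simp [mul_comm]

lemma integrable_mul_Lp (f g : Lp ℝ 2 (volume : Measure ℝ)) :
    Integrable fun x => f x * g x := (Lp.memLp f).integrable_mul (Lp.memLp g)

lemma norm_sq_Lp (f : Lp ℝ 2 (volume : Measure ℝ)) : ‖f‖ ^ 2 = ∫ x, f x ^ 2 := by
  rw [← real_inner_self_eq_norm_sq, real_inner_Lp]
  simp [sq]

lemma integrable_sq_Lp (f : Lp ℝ 2 (volume : Measure ℝ)) :
    Integrable fun x => f x ^ 2 := (Lp.memLp f).integrable_sq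

/-- Integration over the interval from `a` to `b` as an element of `L²`. -/
lemma exists_inner_eq_intervalIntegral (a b : ℝ) : ∃ e : Lp ℝ 2 (volume : Measure ℝ),
    ‖e‖ = √|b - a| ∧ ∀ g : Lp ℝ 2 (volume : Measure ℝ), inner ℝ e g = ∫ t in a..b, g t := by
  have key : ∀ a b : ℝ, a ≤ b → ∃ e : Lp ℝ 2 (volume : Measure ℝ),
      ‖e‖ = √|b - a| ∧ ∀ g : Lp ℝ 2 (volume : Measure ℝ), inner ℝ e g = ∫ t in a..b, g t := by
    intro a b hab
    refine ⟨indicatorConstLp 2 (measurableSet_Ioc (a := a) (b := b)) (by simp) 1, ?_, fun g => ?_⟩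
    · rw [norm_indicatorConstLp (by simp) (by simp)]
      simp [measureReal_def, Real.sqrt_eq_rpow, abs_of_nonneg (sub_nonneg.2 hab), hab]
    · rw [L2.inner_indicatorConstLp_one, intervalIntegral.integral_of_le hab]
  rcases le_total a b with hab | hab
  · exact key a b hab
  · obtain ⟨e, h1, h2⟩ := key b a hab
    refine ⟨-e, by rw [norm_neg, h1, abs_sub_comm], fun g => ?_⟩
    rw [inner_neg_left, h2, intervalIntegral.integral_symm]
    ring

lemma abs_intervalIntegral_Lp_le (g : Lp ℝ 2 (volume : Measure ℝ)) (a b : ℝ) :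
    |∫ t in a..b, g t| ≤ √|b - a| * ‖g‖ := by
  obtain ⟨e, h1, h2⟩ := exists_inner_eq_intervalIntegral a b
  rw [← h1, ← h2]
  exact abs_real_inner_le_norm e g

lemma sq_intervalIntegral_Lp_le (g : Lp ℝ 2 (volume : Measure ℝ)) (a b : ℝ) :
    (∫ t in a..b, g t) ^ 2 ≤ |b - a| * ‖g‖ ^ 2 := by
  have h := abs_intervalIntegral_Lp_le g a b
  rw [← sq_abs, ← Real.sq_sqrt (abs_nonneg (b - a)), ← mul_pow]
  exact pow_le_pow_left₀ (abs_nonneg _) h 2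

/-- A pointwise bound for functions with square integrable derivative. -/
lemma sq_primitive_le (c : ℝ) (u g : Lp ℝ 2 (volume : Measure ℝ))
    (h : ∀ᵐ x, u x = primitive c g x) (x : ℝ) {δ : ℝ} (hδ : 0 < δ) :
    primitive c g x ^ 2 ≤ 2 / δ * ‖u‖ ^ 2 + 2 * δ * ‖g‖ ^ 2 := by
  have hg := locallyIntegrable_of_memLp (Lp.memLp g)
  have hc := continuous_primitive hg c
  -- The value at `x` is compared with the value at a nearby `y`, and the estimate is averaged over
  -- `y`. The length `δ` stays free so that the derivative term can be made small.
  have h1 : ∀ y ∈ Set.Icc x (x + δ),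
      primitive c g x ^ 2 ≤ 2 * primitive c g y ^ 2 + 2 * δ * ‖g‖ ^ 2 := by
    intro y hy
    have h2 := primitive_sub hg c y x
    have h3 := sq_intervalIntegral_Lp_le g x y
    rw [← h2] at h3
    have h4 : |y - x| ≤ δ := by
      rw [abs_of_nonneg (by linarith [hy.1])]; linarith [hy.2]
    have h5 : |y - x| * ‖g‖ ^ 2 ≤ δ * ‖g‖ ^ 2 := by gcongr
    nlinarith [sq_nonneg (primitive c g x - 2 * primitive c g y)]
  have h2 : ∫ _ in x..(x + δ), primitive c g x ^ 2 ≤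
      ∫ y in x..(x + δ), (2 * primitive c g y ^ 2 + 2 * δ * ‖g‖ ^ 2) :=
    intervalIntegral.integral_mono_on (by linarith) (by simp)
      ((by fun_prop : Continuous fun y =>
        2 * primitive c g y ^ 2 + 2 * δ * ‖g‖ ^ 2).intervalIntegrable _ _) h1
  have hI : Integrable fun y => primitive c g y ^ 2 :=
    (integrable_sq_Lp u).congr (h.mono fun y hy => by simp only [hy])
  have h3 : ∫ y in x..(x + δ), primitive c g y ^ 2 ≤ ‖u‖ ^ 2 := by
    rw [intervalIntegral.integral_of_le (by linarith), norm_sq_Lp,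
      integral_congr_ae (h.mono fun y hy => by simp only [hy] :
        (fun y => u y ^ 2) =ᵐ[volume] fun y => primitive c g y ^ 2)]
    exact setIntegral_le_integral hI (Eventually.of_forall fun y => sq_nonneg _)
  rw [intervalIntegral.integral_add (hI.const_mul 2).intervalIntegrable (by simp),
    intervalIntegral.integral_const_mul] at h2
  simp only [intervalIntegral.integral_const, add_sub_cancel_left, smul_eq_mul] at h2
  have h6 : primitive c g x ^ 2 = δ * primitive c g x ^ 2 / δ := by field_simp
  rw [h6, div_le_iff₀ hδ]
  have h7 : (2 / δ * ‖u‖ ^ 2 + 2 * δ * ‖g‖ ^ 2) * δ = 2 * ‖u‖ ^ 2 + δ * (2 * δ * ‖g‖ ^ 2) := by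
    field_simp
  rw [h7]
  linarith

/-- Multiplication relations are preserved by limits in `L²`. -/
lemma ae_eq_mul_of_tendsto {p : ℝ → ℝ} {f g : ℕ → Lp ℝ 2 (volume : Measure ℝ)}
    {f' g' : Lp ℝ 2 (volume : Measure ℝ)} (hf : Tendsto f atTop (𝓝 f'))
    (hg : Tendsto g atTop (𝓝 g')) (h : ∀ n, ∀ᵐ x, g n x = p x * f n x) :
    ∀ᵐ x, g' x = p x * f' x := by
  obtain ⟨s, hs, h1⟩ := (tendstoInMeasure_of_tendsto_Lp hf).exists_seq_tendsto_ae
  obtain ⟨t, ht, h2⟩ := (tendstoInMeasure_of_tendsto_Lp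
    (hg.comp hs.tendsto_atTop)).exists_seq_tendsto_ae
  filter_upwards [h1, h2, ae_all_iff.2 h] with x hx1 hx2 hx3
  refine tendsto_nhds_unique hx2 ?_
  simp only [Function.comp_apply, hx3]
  exact (hx1.comp ht.tendsto_atTop).const_mul _

/-- Being a primitive is preserved by limits in `L²`. -/
lemma ae_eq_primitive_of_tendsto {f g : ℕ → Lp ℝ 2 (volume : Measure ℝ)}
    {f' g' : Lp ℝ 2 (volume : Measure ℝ)} (hf : Tendsto f atTop (𝓝 f'))
    (hg : Tendsto g atTop (𝓝 g')) (h : ∀ n, ∃ c, ∀ᵐ x, f n x = primitive c (g n) x) :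
    ∃ c, ∀ᵐ x, f' x = primitive c g' x := by
  choose c hc using h
  obtain ⟨s, hs, h1⟩ := (tendstoInMeasure_of_tendsto_Lp hf).exists_seq_tendsto_ae
  have h2 : ∀ x : ℝ, Tendsto (fun n => ∫ t in (0 : ℝ)..x, g n t) atTop
      (𝓝 (∫ t in (0 : ℝ)..x, g' t)) := by
    intro x
    obtain ⟨e, -, he⟩ := exists_inner_eq_intervalIntegral 0 x
    simp only [← he]
    exact (continuous_const.inner continuous_id).tendsto g' |>.comp hg
  -- The constants of integration do not depend on `x`, so neither does their limit.
  have h3 : ∀ᵐ x, Tendsto (fun n => c (s n)) atTop (𝓝 (f' x - ∫ t in (0 : ℝ)..x, g' t)) := by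
    filter_upwards [h1, ae_all_iff.2 hc] with x hx1 hx2
    refine (hx1.sub ((h2 x).comp hs.tendsto_atTop)).congr fun n => ?_
    simp [hx2, primitive]
  obtain ⟨x₀, hx₀⟩ := h3.exists
  refine ⟨f' x₀ - ∫ t in (0 : ℝ)..x₀, g' t, ?_⟩
  filter_upwards [h3] with x hx
  have := tendsto_nhds_unique hx₀ hx
  unfold primitive
  linarith

/-! ### The form domain of a Schrödinger operator -/

/-- The form domain of `-d²/dx² + V`: its elements are `(u, u', √V₊ u, √V₋ u)`, all components being
square integrable. -/
def formDomain (V : ℝ → ℝ) :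
    Submodule ℝ (PiLp 2 fun _ : Fin 4 => Lp ℝ 2 (volume : Measure ℝ)) where
  carrier := {f | (∃ c, ∀ᵐ x, f 0 x = primitive c (f 1) x) ∧
    (∀ᵐ x, f 2 x = √(V x) * f 0 x) ∧ ∀ᵐ x, f 3 x = √(-V x) * f 0 x}
  zero_mem' := by
    have h0 : ∀ i : Fin 4, ∀ᵐ x : ℝ,
        (0 : PiLp 2 fun _ : Fin 4 => Lp ℝ 2 (volume : Measure ℝ)) i x = 0 := fun i =>
      Lp.coeFn_zero ℝ 2 volume
    refine ⟨⟨0, ?_⟩, ?_, ?_⟩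
    · filter_upwards [h0 0] with x hx
      rw [hx, primitive_congr_ae (h0 1)]
      simp [primitive]
    · filter_upwards [h0 0, h0 2] with x h1 h2
      rw [h1, h2, mul_zero]
    · filter_upwards [h0 0, h0 3] with x h1 h2
      rw [h1, h2, mul_zero]
  add_mem' := by
    rintro f g ⟨⟨a, hf1⟩, hf2, hf3⟩ ⟨⟨b, hg1⟩, hg2, hg3⟩
    have h : ∀ i : Fin 4, ∀ᵐ x : ℝ, (f + g) i x = f i x + g i x := fun i =>
      Lp.coeFn_add (f i) (g i)
    refine ⟨⟨a + b, ?_⟩, ?_, ?_⟩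
    · filter_upwards [h 0, hf1, hg1] with x h1 h2 h3
      rw [h1, h2, h3, primitive_congr_ae (h 1)]
      unfold primitive
      rw [intervalIntegral.integral_add (intervalIntegrable_of_memLp (Lp.memLp _) _ _)
        (intervalIntegrable_of_memLp (Lp.memLp _) _ _)]
      ring
    · filter_upwards [h 0, h 2, hf2, hg2] with x h1 h2 h3 h4
      rw [h1, h2, h3, h4]; ring
    · filter_upwards [h 0, h 3, hf3, hg3] with x h1 h2 h3 h4
      rw [h1, h2, h3, h4]; ring
  smul_mem' := by
    rintro r f ⟨⟨a, hf1⟩, hf2, hf3⟩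
    have h : ∀ i : Fin 4, ∀ᵐ x : ℝ, (r • f) i x = r * f i x := fun i =>
      Lp.coeFn_smul r (f i)
    refine ⟨⟨r * a, ?_⟩, ?_, ?_⟩
    · filter_upwards [h 0, hf1] with x h1 h2
      rw [h1, h2, primitive_congr_ae (h 1)]
      unfold primitive
      rw [intervalIntegral.integral_const_mul]
      ring
    · filter_upwards [h 0, h 2, hf2] with x h1 h2 h3
      rw [h1, h2, h3]; ring
    · filter_upwards [h 0, h 3, hf3] with x h1 h2 h3
      rw [h1, h2, h3]; ring

/-- All defining relations survive `L²` limits. This makes the form domain a Hilbert space, as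
Lax–Milgram requires. -/
lemma isClosed_formDomain (V : ℝ → ℝ) : IsClosed (formDomain V : Set
    (PiLp 2 fun _ : Fin 4 => Lp ℝ 2 (volume : Measure ℝ))) := by
  refine IsSeqClosed.isClosed fun f f' hf hlim => ?_
  have h : ∀ i : Fin 4, Tendsto (fun n => f n i) atTop (𝓝 (f' i)) := fun i =>
    ((PiLp.proj (𝕜 := ℝ) 2 (fun _ : Fin 4 => Lp ℝ 2 (volume : Measure ℝ)) i).continuous.tendsto
      f').comp hlim
  exact ⟨ae_eq_primitive_of_tendsto (h 0) (h 1) fun n => (hf n).1,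
    ae_eq_mul_of_tendsto (h 0) (h 2) fun n => (hf n).2.1,
    ae_eq_mul_of_tendsto (h 0) (h 3) fun n => (hf n).2.2⟩

instance (V : ℝ → ℝ) : CompleteSpace (formDomain V) :=
  (isClosed_formDomain V).completeSpace_coe

namespace formDomain

variable {V : ℝ → ℝ}

/-- The components of an element of the form domain. -/
noncomputable def coord (V : ℝ → ℝ) (i : Fin 4) :
    formDomain V →L[ℝ] Lp ℝ 2 (volume : Measure ℝ) :=
  (PiLp.proj 2 (fun _ : Fin 4 => Lp ℝ 2 (volume : Measure ℝ)) i).comp (formDomain V).subtypeL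

lemma norm_sq_eq (h : formDomain V) : ‖h‖ ^ 2 =
    ‖coord V 0 h‖ ^ 2 + ‖coord V 1 h‖ ^ 2 + ‖coord V 2 h‖ ^ 2 + ‖coord V 3 h‖ ^ 2 := by
  have := PiLp.norm_sq_eq_of_L2 _ h.1
  rw [Fin.sum_univ_four] at this
  exact this

/-- The continuous representative of an element of the form domain. -/
noncomputable def rep (h : formDomain V) : ℝ → ℝ :=
  primitive h.2.1.choose (coord V 1 h)

lemma coord_zero_ae (h : formDomain V) : ∀ᵐ x, coord V 0 h x = rep h x := h.2.1.choose_spec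

lemma coord_two_ae (h : formDomain V) : ∀ᵐ x, coord V 2 h x = √(V x) * rep h x := by
  filter_upwards [h.2.2.1, coord_zero_ae h] with x h1 h2
  rw [← h2]; exact h1

lemma coord_three_ae (h : formDomain V) : ∀ᵐ x, coord V 3 h x = √(-V x) * rep h x := by
  filter_upwards [h.2.2.2, coord_zero_ae h] with x h1 h2
  rw [← h2]; exact h1

lemma locallyIntegrable_coord (h : formDomain V) (i : Fin 4) :
    LocallyIntegrable (coord V i h) volume := locallyIntegrable_of_memLp (Lp.memLp _)

lemma continuous_rep (h : formDomain V) : Continuous (rep h) :=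
  continuous_primitive (locallyIntegrable_coord h 1) _

lemma memLp_rep (h : formDomain V) : MemLp (rep h) 2 volume :=
  (Lp.memLp (coord V 0 h)).ae_eq (coord_zero_ae h)

lemma sq_rep_le (h : formDomain V) (x : ℝ) {δ : ℝ} (hδ : 0 < δ) :
    rep h x ^ 2 ≤ 2 / δ * ‖coord V 0 h‖ ^ 2 + 2 * δ * ‖coord V 1 h‖ ^ 2 :=
  sq_primitive_le _ _ _ (coord_zero_ae h) x hδ

lemma rep_eq_of_ae_eq {h : formDomain V} {u : ℝ → ℝ} (hu : Continuous u)
    (he : ∀ᵐ x, coord V 0 h x = u x) : rep h = u := by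
  refine ((continuous_rep h).ae_eq_iff_eq volume hu).1 ?_
  filter_upwards [he, coord_zero_ae h] with x h1 h2
  rw [← h1, ← h2]

lemma rep_add (h k : formDomain V) : rep (h + k) = rep h + rep k := by
  refine rep_eq_of_ae_eq ((continuous_rep h).add (continuous_rep k)) ?_
  have e : ∀ᵐ x, coord V 0 (h + k) x = coord V 0 h x + coord V 0 k x := by
    rw [map_add]; exact Lp.coeFn_add _ _
  filter_upwards [e, coord_zero_ae h, coord_zero_ae k] with x h1 h2 h3
  rw [h1, h2, h3, Pi.add_apply]

lemma rep_smul (r : ℝ) (h : formDomain V) : rep (r • h) = r • rep h := by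
  refine rep_eq_of_ae_eq ((continuous_rep h).const_smul r) ?_
  have e : ∀ᵐ x, coord V 0 (r • h) x = r * coord V 0 h x := by
    rw [map_smul]; exact Lp.coeFn_smul _ _
  filter_upwards [e, coord_zero_ae h] with x h1 h2
  rw [h1, h2, Pi.smul_apply, smul_eq_mul]

/-- Evaluation at a point. -/
noncomputable def eval (V : ℝ → ℝ) (x : ℝ) : formDomain V →L[ℝ] ℝ :=
  LinearMap.mkContinuous
    { toFun := fun h => rep h x
      map_add' := fun h k => by rw [rep_add]; rfl
      map_smul' := fun r h => by rw [rep_smul]; rfl } 2 fun h => by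
    have h1 := sq_rep_le h x one_pos
    have h2 := norm_sq_eq h
    refine abs_le_of_sq_le_sq (by
      simp only [LinearMap.coe_mk, AddHom.coe_mk]
      nlinarith [sq_nonneg ‖coord V 2 h‖, sq_nonneg ‖coord V 3 h‖, sq_nonneg ‖coord V 0 h‖,
        sq_nonneg ‖coord V 1 h‖]) (by positivity)

@[simp] lemma eval_apply (x : ℝ) (h : formDomain V) : eval V x h = rep h x := rfl

end formDomain

/-! ### The quadratic form -/

/-- Locally integrable potentials that tend to infinity. -/
structure IsConfining (V : ℝ → ℝ) : Prop where
  locallyIntegrable : LocallyIntegrable V volume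
  tendsto : Tendsto V (cocompact ℝ) atTop

/-- Dividing by the Gaussian factor, which is continuous and positive, preserves local
integrability. -/
lemma isConfining_of_memLp {V : ℝ → ℝ} (hV : MemLp V 2 hermiteMeasure)
    (hlim : Tendsto V (cocompact ℝ) atTop) : IsConfining V := by
  refine ⟨?_, hlim⟩
  have h1 := locallyIntegrable_of_memLp (memLp_hermiteMeasure_iff.1 hV)
  have h2 : LocallyIntegrable (fun x => V x * Real.exp (-x ^ 2 / 2) * Real.exp (x ^ 2 / 2)) := by
    rw [← locallyIntegrableOn_univ] at h1 ⊢
    exact h1.mul_continuousOn (by fun_prop) isOpen_univ.isLocallyClosed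
  refine h2.congr (Eventually.of_forall fun x => ?_)
  simp only
  rw [mul_assoc, ← Real.exp_add]
  ring_nf
  simp

lemma sq_sqrt_sub_sq_sqrt_neg (a : ℝ) : √a * √a - √(-a) * √(-a) = a := by
  rcases le_total 0 a with h | h
  · rw [Real.mul_self_sqrt h, Real.sqrt_eq_zero_of_nonpos (by linarith)]; ring
  · rw [Real.mul_self_sqrt (by linarith : 0 ≤ -a), Real.sqrt_eq_zero_of_nonpos h]; ring

lemma sq_sqrt_eq_max (a : ℝ) : √a ^ 2 = max a 0 := by
  rcases le_total 0 a with h | h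
  · rw [Real.sq_sqrt h, max_eq_left h]
  · rw [Real.sqrt_eq_zero_of_nonpos h, max_eq_right h]; ring

namespace IsConfining

variable {V : ℝ → ℝ}

lemma aestronglyMeasurable (hV : IsConfining V) : AEStronglyMeasurable V volume :=
  hV.locallyIntegrable.aestronglyMeasurable

/-- `V` is nonnegative off a compact set, and on that set it is integrable. -/
lemma integrable_negPart (hV : IsConfining V) : Integrable fun x => max (-V x) 0 := by
  obtain ⟨K, hK, hKV⟩ := mem_cocompact.1 (hV.tendsto.eventually_ge_atTop 0)
  have h1 : IntegrableOn (fun x => max (-V x) 0) K :=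
    (hV.locallyIntegrable.integrableOn_isCompact hK).neg.pos_part
  refine (integrableOn_iff_integrable_of_support_subset fun x hx => ?_).1 h1
  by_contra hc
  have : 0 ≤ V x := hKV hc
  exact hx (max_eq_right (by linarith))

lemma exists_gt_of_abs_ge (hV : IsConfining V) (R : ℝ) : ∃ N : ℝ, 0 < N ∧ ∀ x, N ≤ |x| → R ≤ V x := by
  have h1 := hV.tendsto.eventually_ge_atTop R
  rw [← Metric.cobounded_eq_cocompact, ← comap_norm_atTop, eventually_comap] at h1
  obtain ⟨N, hN⟩ := eventually_atTop.1 h1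
  exact ⟨max N 1, by positivity, fun x hx => hN |x| ((le_max_left _ _).trans hx) x rfl⟩

/-- Functions with square integrable derivative satisfy a bound on their negative potential
energy. -/
lemma integral_negPart_mul_sq_le (hV : IsConfining V) {u : ℝ → ℝ} (hu : Continuous u) {C : ℝ}
    (hC : ∀ x, u x ^ 2 ≤ C) : Integrable (fun x => (√(-V x) * u x) ^ 2) ∧
      ∫ x, (√(-V x) * u x) ^ 2 ≤ C * ∫ x, max (-V x) 0 := by
  have h1 : ∀ x, (√(-V x) * u x) ^ 2 ≤ C * max (-V x) 0 := fun x => by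
    rw [mul_pow, sq_sqrt_eq_max, mul_comm]
    exact mul_le_mul_of_nonneg_right (hC x) (le_max_right _ _)
  have hi := hV.integrable_negPart.const_mul C
  have h2 : Integrable (fun x => (√(-V x) * u x) ^ 2) := by
    refine hi.mono' ?_ (Eventually.of_forall fun x => ?_)
    · exact ((Real.continuous_sqrt.comp_aestronglyMeasurable hV.aestronglyMeasurable.neg).mul
        hu.aestronglyMeasurable).pow 2
    · rw [Real.norm_of_nonneg (sq_nonneg _)]; exact h1 x
  refine ⟨h2, ?_⟩
  rw [← integral_const_mul]
  exact integral_mono h2 hi h1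

end IsConfining

namespace formDomain

variable {V : ℝ → ℝ}

/-- Taking `δ` small makes the negative potential energy an arbitrarily small multiple of the
kinetic energy, up to a multiple of the `L²` norm. -/
lemma norm_sq_coord_three_le (hV : IsConfining V) (h : formDomain V) {δ : ℝ} (hδ : 0 < δ) :
    ‖coord V 3 h‖ ^ 2 ≤
      (2 / δ * ‖coord V 0 h‖ ^ 2 + 2 * δ * ‖coord V 1 h‖ ^ 2) * ∫ x, max (-V x) 0 := by
  rw [norm_sq_Lp, integral_congr_ae ((coord_three_ae h).mono fun x hx => by simp only [hx] :
    (fun x => coord V 3 h x ^ 2) =ᵐ[volume] fun x => (√(-V x) * rep h x) ^ 2)]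
  exact (hV.integral_negPart_mul_sq_le (continuous_rep h) fun x => sq_rep_le h x hδ).2

/-- The form `∫ u' v' + ∫ V u v + c ∫ u v`. -/
noncomputable def form (V : ℝ → ℝ) (c : ℝ) : formDomain V →L[ℝ] formDomain V →L[ℝ] ℝ :=
  (innerSL ℝ).bilinearComp (coord V 1) (coord V 1) +
    (innerSL ℝ).bilinearComp (coord V 2) (coord V 2) -
    (innerSL ℝ).bilinearComp (coord V 3) (coord V 3) +
    c • (innerSL ℝ).bilinearComp (coord V 0) (coord V 0)

lemma form_apply (c : ℝ) (h k : formDomain V) : form V c h k =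
    inner ℝ (coord V 1 h) (coord V 1 k) + inner ℝ (coord V 2 h) (coord V 2 k) -
      inner ℝ (coord V 3 h) (coord V 3 k) + c * inner ℝ (coord V 0 h) (coord V 0 k) := rfl

lemma form_comm (c : ℝ) (h k : formDomain V) : form V c h k = form V c k h := by
  simp only [form_apply, real_inner_comm]

lemma exists_isCoercive_form (hV : IsConfining V) : ∃ c, IsCoercive (form V c) := by
  have hM0 : 0 ≤ ∫ x, max (-V x) 0 := integral_nonneg fun x => le_max_right _ _
  set M := ∫ x, max (-V x) 0 with hM
  -- For this `δ` the kinetic term in the bound has coefficient `2δM ≤ 1/2`, so half of the kinetic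
  -- energy absorbs it. The `L²` term has coefficient `2M/δ = C`, which the shift `C + 1` outweighs.
  have hδ : 0 < 1 / (4 * (M + 1)) := by positivity
  set C := 8 * (M + 1) * M with hC
  have hC0 : 0 ≤ C := by positivity
  refine ⟨C + 1, (3 + C)⁻¹, by positivity, fun h => ?_⟩
  have h1 := norm_sq_coord_three_le hV h hδ
  rw [← hM] at h1
  have h2 : (2 / (1 / (4 * (M + 1))) * ‖coord V 0 h‖ ^ 2 +
      2 * (1 / (4 * (M + 1))) * ‖coord V 1 h‖ ^ 2) * M =
      C * ‖coord V 0 h‖ ^ 2 + M / (M + 1) * (‖coord V 1 h‖ ^ 2 / 2) := by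
    rw [hC]; field_simp; ring
  have h3 : M / (M + 1) ≤ 1 := by rw [div_le_one (by positivity)]; linarith
  have h4 : M / (M + 1) * (‖coord V 1 h‖ ^ 2 / 2) ≤ ‖coord V 1 h‖ ^ 2 / 2 :=
    mul_le_of_le_one_left (by positivity) h3
  rw [mul_assoc, ← sq, inv_mul_le_iff₀ (by positivity), form_apply, norm_sq_eq]
  simp only [real_inner_self_eq_norm_sq]
  have a0 := sq_nonneg ‖coord V 0 h‖
  have a1 := sq_nonneg ‖coord V 1 h‖
  have a2 := sq_nonneg ‖coord V 2 h‖
  have a5 : ‖coord V 3 h‖ ^ 2 ≤ C * ‖coord V 0 h‖ ^ 2 + ‖coord V 1 h‖ ^ 2 / 2 := by linarith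
  nlinarith [mul_nonneg hC0 a0, mul_nonneg hC0 a1, mul_nonneg hC0 a2]

lemma inner_coord_two_sub (h k : formDomain V) :
    Integrable (fun x => V x * (rep h x * rep k x)) ∧
      inner ℝ (coord V 2 h) (coord V 2 k) - inner ℝ (coord V 3 h) (coord V 3 k) =
        ∫ x, V x * (rep h x * rep k x) := by
  have e : (fun x => coord V 2 h x * coord V 2 k x - coord V 3 h x * coord V 3 k x) =ᵐ[volume]
      fun x => V x * (rep h x * rep k x) := by
    filter_upwards [coord_two_ae h, coord_two_ae k, coord_three_ae h, coord_three_ae k]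
      with x h1 h2 h3 h4
    rw [h1, h2, h3, h4]
    have := sq_sqrt_sub_sq_sqrt_neg (V x)
    linear_combination (rep h x * rep k x) * this
  have i2 := integrable_mul_Lp (coord V 2 h) (coord V 2 k)
  have i3 := integrable_mul_Lp (coord V 3 h) (coord V 3 k)
  refine ⟨(i2.sub i3).congr e, ?_⟩
  rw [real_inner_Lp, real_inner_Lp, ← integral_sub i2 i3]
  exact integral_congr_ae e

lemma inner_coord_zero (h k : formDomain V) :
    inner ℝ (coord V 0 h) (coord V 0 k) = ∫ x, rep h x * rep k x := by
  rw [real_inner_Lp]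
  refine integral_congr_ae ?_
  filter_upwards [coord_zero_ae h, coord_zero_ae k] with x h1 h2
  rw [h1, h2]

/-- Functions of finite energy are in the form domain. -/
lemma exists_of_memLp (hV : IsConfining V) {u g : ℝ → ℝ} (hu : MemLp u 2 volume)
    (hg : MemLp g 2 volume) (hug : ∃ c, u = primitive c g)
    (hVu : MemLp (fun x => √(V x) * u x) 2 volume) :
    ∃ h : formDomain V, rep h = u ∧ coord V 0 h = hu.toLp u ∧ coord V 1 h = hg.toLp g := by
  obtain ⟨c, hc⟩ := hug
  have hcont : Continuous u := hc ▸ continuous_primitive (locallyIntegrable_of_memLp hg) c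
  have hge : hg.toLp g =ᵐ[volume] g := hg.coeFn_toLp
  have hue : hu.toLp u =ᵐ[volume] u := hu.coeFn_toLp
  have hp : ∀ᵐ x, hu.toLp u x = primitive c (hg.toLp g) x := by
    filter_upwards [hue] with x hx
    rw [hx, primitive_congr_ae hge, hc]
  have hb : ∀ x, u x ^ 2 ≤ 2 / 1 * ‖hu.toLp u‖ ^ 2 + 2 * 1 * ‖hg.toLp g‖ ^ 2 := fun x => by
    have := sq_primitive_le c _ _ hp x one_pos
    rwa [primitive_congr_ae hge, ← hc] at this
  -- Since `u` is bounded, the negative part needs no hypothesis of its own.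
  have h3 : MemLp (fun x => √(-V x) * u x) 2 volume := by
    have hm : AEStronglyMeasurable (fun x => √(-V x) * u x) volume :=
      (Real.continuous_sqrt.comp_aestronglyMeasurable hV.aestronglyMeasurable.neg).mul
        hcont.aestronglyMeasurable
    exact (memLp_two_iff_integrable_sq hm).2 (hV.integral_negPart_mul_sq_le hcont hb).1
  let f : PiLp 2 fun _ : Fin 4 => Lp ℝ 2 (volume : Measure ℝ) :=
    WithLp.toLp 2 ![hu.toLp u, hg.toLp g, hVu.toLp _, h3.toLp _]
  have hf : f ∈ formDomain V := by
    refine ⟨⟨c, hp⟩, ?_, ?_⟩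
    · filter_upwards [hue, hVu.coeFn_toLp] with x h1 h2
      change hVu.toLp _ x = √(V x) * hu.toLp u x
      rw [h1, h2]
    · filter_upwards [hue, h3.coeFn_toLp] with x h1 h2
      change h3.toLp _ x = √(-V x) * hu.toLp u x
      rw [h1, h2]
  exact ⟨⟨f, hf⟩, rep_eq_of_ae_eq hcont hue, rfl, rfl⟩

lemma form_eq_integral (c : ℝ) (h k : formDomain V) : form V c h k =
    (∫ x, coord V 1 h x * coord V 1 k x) + (∫ x, V x * (rep h x * rep k x)) +
      c * ∫ x, rep h x * rep k x := by
  rw [form_apply, add_sub_assoc, (inner_coord_two_sub h k).2, real_inner_Lp, inner_coord_zero]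

/-! ### Compactness of the embedding -/

lemma coeFn_sum_smul_indicator {ι : Type*} (s : Finset ι) (a : ι → ℝ) (A : ι → Set ℝ)
    (hA : ∀ i, MeasurableSet (A i)) (hA' : ∀ i, volume (A i) ≠ ⊤) :
    ∀ᵐ x, (∑ i ∈ s, a i • indicatorConstLp 2 (hA i) (hA' i) (1 : ℝ) :
      Lp ℝ 2 (volume : Measure ℝ)) x = ∑ i ∈ s, a i * (A i).indicator (fun _ => 1) x := by
  classical
  induction s using Finset.induction_on with
  | empty =>
    simp only [Finset.sum_empty]
    exact Lp.coeFn_zero ℝ 2 volume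
  | insert i s hi ih =>
    rw [Finset.sum_insert hi]
    filter_upwards [ih, Lp.coeFn_add (a i • indicatorConstLp 2 (hA i) (hA' i) (1 : ℝ))
      (∑ i ∈ s, a i • indicatorConstLp 2 (hA i) (hA' i) (1 : ℝ)),
      Lp.coeFn_smul (a i) (indicatorConstLp 2 (hA i) (hA' i) (1 : ℝ)),
      indicatorConstLp_coeFn (p := 2) (hs := hA i) (hμs := hA' i) (c := (1 : ℝ))] with x h1 h2 h3 h4
    rw [h2, Pi.add_apply, h1, h3, Pi.smul_apply, h4, Finset.sum_insert hi, smul_eq_mul]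

/-- The embedding of the form domain into `L²` is approximated by sampling on a grid. -/
lemma exists_grid_approximation (hV : IsConfining V) {ε : ℝ} (hε : 0 < ε) :
    ∃ P : formDomain V →L[ℝ] Lp ℝ 2 (volume : Measure ℝ), IsCompactOperator P ∧
      ‖coord V 0 - P‖ ≤ ε := by
  -- Outside `[-N, N]`, `u²` is at most `ε²/2` times `V u²`. Inside, replacing `u` by its value at
  -- the left grid point costs at most `δ‖u'‖²` pointwise, hence `2Nδ‖u'‖²` in total, and `m` is
  -- chosen so that `2Nδ = 4N²/m ≤ ε²/2`.
  obtain ⟨N, hN0, hN⟩ := hV.exists_gt_of_abs_ge (2 / ε ^ 2)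
  obtain ⟨m, hm⟩ := exists_nat_gt (8 * N ^ 2 / ε ^ 2)
  have hm0 : (0 : ℝ) < m := lt_of_le_of_lt (by positivity) hm
  set δ := 2 * N / m with hδ
  have hδ0 : 0 < δ := by positivity
  have hmδ : m * δ = 2 * N := by rw [hδ]; field_simp
  let A : ℕ → Set ℝ := fun i => Set.Ico (-N + i * δ) (-N + (i + 1) * δ)
  have hA : ∀ i, MeasurableSet (A i) := fun i => measurableSet_Ico
  have hA' : ∀ i, volume (A i) ≠ ⊤ := fun i => by simp [A]
  let e : ℕ → Lp ℝ 2 (volume : Measure ℝ) := fun i => indicatorConstLp 2 (hA i) (hA' i) 1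
  -- A finite sum of point evaluations times step functions, so of finite rank.
  let P : formDomain V →L[ℝ] Lp ℝ 2 (volume : Measure ℝ) :=
    ∑ i ∈ Finset.range m, (eval V (-N + i * δ)).smulRight (e i)
  have hP : ∀ h, P h = ∑ i ∈ Finset.range m, rep h (-N + i * δ) • e i := fun h => by
    simp only [P, _root_.sum_apply, ContinuousLinearMap.smulRight_apply, eval_apply]
  refine ⟨P, ?_, ContinuousLinearMap.opNorm_le_bound _ hε.le fun h => ?_⟩
  · have : P ∈ compactOperator (RingHom.id ℝ) (formDomain V) (Lp ℝ 2 (volume : Measure ℝ)) := by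
      refine Submodule.sum_mem _ fun i _ => ?_
      exact (isCompactOperator_of_locallyCompactSpace_dom (eval V (-N + i * δ))).clm_comp
        (ContinuousLinearMap.toSpanSingleton ℝ (e i))
    exact this
  · have hpt : ∀ᵐ x, (coord V 0 h - P h) x ^ 2 ≤
        (Set.Ico (-N) N).indicator (fun _ => δ * ‖coord V 1 h‖ ^ 2) x +
          ε ^ 2 / 2 * coord V 2 h x ^ 2 := by
      have h1 := coeFn_sum_smul_indicator (Finset.range m) (fun i => rep h (-N + i * δ)) A hA hA'
      filter_upwards [h1, Lp.coeFn_sub (coord V 0 h) (P h), coord_zero_ae h, coord_two_ae h]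
        with x h1 h2 h3 h4
      rw [h2, Pi.sub_apply, h3, hP, h1, h4]
      by_cases hx : x ∈ Set.Ico (-N) N
      · rw [Set.indicator_of_mem hx]
        have hq : 0 ≤ (x + N) / δ := div_nonneg (by linarith [hx.1]) hδ0.le
        set j := ⌊(x + N) / δ⌋₊ with hj
        have hj1 : (j : ℝ) * δ ≤ x + N := by
          rw [← le_div_iff₀ hδ0]; exact Nat.floor_le hq
        have hj2 : x + N < (j + 1) * δ := by
          rw [← div_lt_iff₀ hδ0]; exact Nat.lt_floor_add_one _
        have hjm : j < m := by
          rw [hj, Nat.floor_lt hq, div_lt_iff₀ hδ0, hmδ]; linarith [hx.2]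
        rw [Finset.sum_eq_single j]
        · rw [Set.indicator_of_mem (show x ∈ A j from ⟨by linarith, by linarith⟩), mul_one]
          unfold rep
          rw [primitive_sub (locallyIntegrable_coord h 1)]
          have h5 := sq_intervalIntegral_Lp_le (coord V 1 h) (-N + j * δ) x
          have h6 : |x - (-N + j * δ)| ≤ δ := by
            rw [abs_of_nonneg (by linarith)]; linarith
          have h7 : |x - (-N + j * δ)| * ‖coord V 1 h‖ ^ 2 ≤ δ * ‖coord V 1 h‖ ^ 2 := by gcongr
          have : 0 ≤ ε ^ 2 / 2 * (√(V x) * primitive h.2.1.choose (coord V 1 h) x) ^ 2 := by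
            positivity
          linarith
        · intro i _ hij
          rw [Set.indicator_of_notMem, mul_zero]
          rintro ⟨ha, hb⟩
          rcases Nat.lt_or_gt_of_ne hij with hlt | hlt
          · have : ((i : ℝ) + 1) ≤ j := by exact_mod_cast hlt
            nlinarith
          · have : ((j : ℝ) + 1) ≤ i := by exact_mod_cast hlt
            nlinarith
        · intro hc
          exact absurd (Finset.mem_range.2 hjm) hc
      · rw [Set.indicator_of_notMem hx, Finset.sum_eq_zero, sub_zero, zero_add]
        · have hxN : N ≤ |x| := by
            by_contra! hc
            exact hx ⟨(abs_lt.1 hc).1.le, (abs_lt.1 hc).2⟩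
          have h5 := hN x hxN
          have h6 : 0 ≤ V x := le_trans (by positivity) h5
          rw [mul_pow, Real.sq_sqrt h6]
          have h7 : 1 ≤ ε ^ 2 / 2 * V x := by
            have : ε ^ 2 / 2 * (2 / ε ^ 2) ≤ ε ^ 2 / 2 * V x := by gcongr
            refine le_trans (le_of_eq ?_) this
            field_simp
          nlinarith [sq_nonneg (rep h x)]
        · intro i hi
          rw [Set.indicator_of_notMem, mul_zero]
          rintro ⟨ha, hb⟩
          have him : ((i : ℝ) + 1) ≤ m := by exact_mod_cast Finset.mem_range.1 hi
          refine hx ⟨?_, ?_⟩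
          · have : 0 ≤ (i : ℝ) * δ := by positivity
            linarith
          · have : ((i : ℝ) + 1) * δ ≤ m * δ := by gcongr
            linarith
    have i1 : Integrable ((Set.Ico (-N) N).indicator fun _ => δ * ‖coord V 1 h‖ ^ 2) := by
      rw [integrable_indicator_iff measurableSet_Ico]
      exact integrableOn_const (by simp)
    have i2 : Integrable fun x => ε ^ 2 / 2 * coord V 2 h x ^ 2 :=
      (integrable_sq_Lp _).const_mul _
    have hint := integral_mono_ae (integrable_sq_Lp (coord V 0 h - P h)) (i1.add i2) hpt
    rw [← norm_sq_Lp, integral_add' i1 i2, integral_indicator measurableSet_Ico,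
      setIntegral_const, integral_const_mul (ε ^ 2 / 2), ← norm_sq_Lp, Real.volume_real_Ico,
      smul_eq_mul] at hint
    rw [max_eq_left (by linarith)] at hint
    have h8 : (N - -N) * δ ≤ ε ^ 2 / 2 := by
      rw [div_lt_iff₀ (by positivity)] at hm
      have : (N - -N) * δ = 4 * N ^ 2 / m := by rw [hδ]; field_simp; ring
      rw [this, div_le_iff₀ hm0]
      linarith
    have h9 := norm_sq_eq h
    have h10 : ‖coord V 0 h - P h‖ ^ 2 ≤ (ε * ‖h‖) ^ 2 := by
      rw [mul_pow, h9]
      have : (N - -N) * (δ * ‖coord V 1 h‖ ^ 2) ≤ ε ^ 2 / 2 * ‖coord V 1 h‖ ^ 2 := by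
        rw [← mul_assoc]; gcongr
      have b0 : 0 ≤ ε ^ 2 * ‖coord V 0 h‖ ^ 2 := by positivity
      have b1 : 0 ≤ ε ^ 2 * ‖coord V 1 h‖ ^ 2 := by positivity
      have b2 : 0 ≤ ε ^ 2 * ‖coord V 2 h‖ ^ 2 := by positivity
      have b3 : 0 ≤ ε ^ 2 * ‖coord V 3 h‖ ^ 2 := by positivity
      linarith
    exact le_of_sq_le_sq h10 (by positivity)

/-- The form domain of a confining potential is compactly embedded in `L²`. -/
theorem isCompactOperator_coord_zero (hV : IsConfining V) : IsCompactOperator (coord V 0) := by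
  choose P hP hPε using fun n : ℕ =>
    exists_grid_approximation hV (Nat.one_div_pos_of_nat (α := ℝ) (n := n))
  have hlim : Tendsto (fun n => ‖P n - coord V 0‖) atTop (𝓝 0) :=
    squeeze_zero (fun n => norm_nonneg (P n - coord V 0))
      (fun n => (norm_sub_rev (P n) (coord V 0)).trans_le (hPε n)) tendsto_one_div_add_atTop_nhds_zero_nat
  exact isCompactOperator_of_tendsto (F := P) (l := atTop)
    ((tendsto_iff_norm_sub_tendsto_zero
      (E := formDomain V →L[ℝ] Lp ℝ 2 (volume : Measure ℝ))).2 hlim) (Eventually.of_forall hP)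

end formDomain

/-! ### Solutions of the differential equation have finite energy -/

/-- A cutoff function on `[-N, N]`. -/
noncomputable def cutoff (N x : ℝ) : ℝ := 1 - x ^ 2 / N ^ 2

lemma hasDerivAt_cutoff (N x : ℝ) : HasDerivAt (cutoff N) (-(2 * x / N ^ 2)) x := by
  have h := ((hasDerivAt_pow 2 x).div_const (N ^ 2)).const_sub 1
  exact h.congr_deriv (by simp)

lemma continuous_cutoff (N : ℝ) : Continuous (cutoff N) := by
  unfold cutoff; fun_prop

lemma contDiff_cutoff (N : ℝ) : ContDiff ℝ 1 (cutoff N) := by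
  unfold cutoff; fun_prop

lemma cutoff_le_one (N x : ℝ) : cutoff N x ≤ 1 := by
  unfold cutoff
  have : 0 ≤ x ^ 2 / N ^ 2 := by positivity
  linarith

lemma cutoff_nonneg {N x : ℝ} (hN : 0 < N) (hx : |x| ≤ N) : 0 ≤ cutoff N x := by
  unfold cutoff
  have : x ^ 2 / N ^ 2 ≤ 1 := by
    rw [div_le_one (by positivity), ← sq_abs]
    exact pow_le_pow_left₀ (abs_nonneg x) hx 2
  linarith

lemma abs_two_mul_div_sq_le {N x : ℝ} (hN : 0 < N) (hx : |x| ≤ N) : |2 * x / N ^ 2| ≤ 2 / N := by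
  rw [abs_div, abs_mul, abs_two, abs_of_pos (by positivity : 0 < N ^ 2),
    div_le_div_iff₀ (by positivity) hN]
  nlinarith

lemma cutoff_self {N : ℝ} (hN : 0 < N) : cutoff N N = 0 := by
  unfold cutoff; field_simp; ring

lemma cutoff_neg_self {N : ℝ} (hN : 0 < N) : cutoff N (-N) = 0 := by
  unfold cutoff; field_simp; ring

/-- Dominated convergence: the cutoff lies in `[0, 1]` on its interval and tends to `1` pointwise.
-/
lemma tendsto_integral_cutoff_mul {F : ℝ → ℝ} (hF : Integrable F) :
    Tendsto (fun n : ℕ => ∫ x in (-((n : ℝ) + 1))..(n + 1), cutoff (n + 1) x * F x) atTop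
      (𝓝 (∫ x, F x)) := by
  have e : ∀ n : ℕ, ∫ x in (-((n : ℝ) + 1))..(n + 1), cutoff (n + 1) x * F x =
      ∫ x, (Set.Ioc (-((n : ℝ) + 1)) (n + 1)).indicator (fun x => cutoff (n + 1) x * F x) x := by
    intro n
    rw [integral_indicator measurableSet_Ioc, intervalIntegral.integral_of_le (by linarith)]
  simp only [e]
  refine tendsto_integral_of_dominated_convergence (fun x => ‖F x‖) (fun n => ?_) hF.norm
    (fun n => Eventually.of_forall fun x => ?_) (Eventually.of_forall fun x => ?_)
  · exact ((continuous_cutoff _).aestronglyMeasurable.mul hF.1).indicator measurableSet_Ioc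
  · by_cases hx : x ∈ Set.Ioc (-((n : ℝ) + 1)) (n + 1)
    · rw [Set.indicator_of_mem hx, norm_mul, Real.norm_eq_abs (cutoff _ _),
        abs_of_nonneg (cutoff_nonneg (by positivity) (abs_le.2 ⟨hx.1.le, hx.2⟩))]
      exact mul_le_of_le_one_left (norm_nonneg _) (cutoff_le_one _ _)
    · rw [Set.indicator_of_notMem hx, norm_zero]; exact norm_nonneg _
  · have h1 : Tendsto (fun n : ℕ => cutoff ((n : ℝ) + 1) x * F x) atTop (𝓝 (F x)) := by
      have h2 : Tendsto (fun n : ℕ => (n : ℝ) + 1) atTop atTop :=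
        tendsto_natCast_atTop_atTop.atTop_add tendsto_const_nhds
      have h3 : Tendsto (fun n : ℕ => x ^ 2 / ((n : ℝ) + 1) ^ 2) atTop (𝓝 0) :=
        tendsto_const_nhds.div_atTop ((tendsto_pow_atTop two_ne_zero).comp h2)
      have h4 := (h3.const_sub 1).mul_const (F x)
      simpa [cutoff] using h4
    refine h1.congr' ?_
    obtain ⟨m, hm⟩ := exists_nat_gt |x|
    filter_upwards [eventually_ge_atTop m] with n hn
    have : (m : ℝ) ≤ n := by exact_mod_cast hn
    obtain ⟨h5, h6⟩ := abs_lt.1 hm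
    rw [Set.indicator_of_mem
      (show x ∈ Set.Ioc (-((n : ℝ) + 1)) (n + 1) from ⟨by linarith, by linarith⟩)]

/-- The cutoff vanishes at both endpoints, so integration by parts leaves no boundary term and needs
no decay at infinity. -/
lemma integral_deriv_mul_cutoff {w v v' : ℝ → ℝ} (hw : ∀ a b, AbsolutelyContinuousOnInterval w a b)
    (hv : ∀ a b, AbsolutelyContinuousOnInterval v a b) (hv' : ∀ᵐ x, HasDerivAt v (v' x) x)
    {N : ℝ} (hN : 0 < N) : ∫ x in -N..N, deriv w x * (cutoff N x * v x) =
      -∫ x in -N..N, w x * (-(2 * x / N ^ 2) * v x + cutoff N x * v' x) := by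
  have hη : AbsolutelyContinuousOnInterval (cutoff N) (-N) N :=
    (contDiff_cutoff N).contDiffOn.absolutelyContinuousOnInterval
  have h := (hw (-N) N).integral_mul_deriv_eq_deriv_mul (hη.fun_mul (hv (-N) N))
  rw [cutoff_self hN, cutoff_neg_self hN] at h
  simp only [zero_mul, mul_zero, sub_zero, zero_sub] at h
  rw [← neg_eq_iff_eq_neg, ← h]
  refine intervalIntegral.integral_congr_ae ?_
  filter_upwards [hv'] with x hx _
  rw [((hasDerivAt_cutoff N x).fun_mul hx).deriv]

lemma continuous_of_absolutelyContinuous {w : ℝ → ℝ}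
    (hw : ∀ a b, AbsolutelyContinuousOnInterval w a b) : Continuous w := by
  refine continuous_iff_continuousAt.2 fun x => ?_
  refine (hw (x - 1) (x + 1)).continuousOn.continuousAt ?_
  rw [Set.uIcc_of_le (by linarith)]
  exact Icc_mem_nhds (by linarith) (by linarith)

lemma IsConfining.integrable_negPart_mul {V : ℝ → ℝ} (hV : IsConfining V) {f : ℝ → ℝ}
    (hf : Continuous f) : Integrable fun x => max (-V x) 0 * f x := by
  obtain ⟨K, hK, hKV⟩ := mem_cocompact.1 (hV.tendsto.eventually_ge_atTop 0)
  have h1 : IntegrableOn (fun x => max (-V x) 0 * f x) K :=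
    IntegrableOn.mul_continuousOn hV.integrable_negPart.integrableOn hf.continuousOn hK
  refine (integrableOn_iff_integrable_of_support_subset fun x hx => ?_).1 h1
  by_contra hc
  have : 0 ≤ V x := hKV hc
  exact hx (by simp only [max_eq_right (by linarith : -V x ≤ 0), zero_mul])

namespace IsL2Solution

variable {V : ℝ → ℝ} {μ : ℝ} {u : ℝ → ℝ}

lemma continuous_deriv (h : IsL2Solution V μ u) : Continuous (deriv u) :=
  continuous_of_absolutelyContinuous h.absolutelyContinuous_deriv

lemma eq_primitive (h : IsL2Solution V μ u) : u = primitive (u 0) (deriv u) := by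
  funext x
  unfold primitive
  rw [intervalIntegral.integral_deriv_eq_sub (fun y _ => h.differentiable y)
    (h.continuous_deriv.intervalIntegrable _ _)]
  ring

lemma absolutelyContinuous (h : IsL2Solution V μ u) (a b : ℝ) :
    AbsolutelyContinuousOnInterval u a b := by
  rw [h.eq_primitive]
  exact absolutelyContinuousOnInterval_primitive h.continuous_deriv.locallyIntegrable _ _ _

lemma locallyIntegrable_mul_sq (hV : IsConfining V) (h : IsL2Solution V μ u) :
    LocallyIntegrable (fun x => max (V x) 0 * u x ^ 2) volume := by
  have h1 : LocallyIntegrable (fun x => max (V x) 0) volume := fun x => by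
    obtain ⟨s, hs, hs'⟩ := hV.locallyIntegrable x
    exact ⟨s, hs, hs'.pos_part⟩
  rw [← locallyIntegrableOn_univ] at h1 ⊢
  exact h1.mul_continuousOn (by have := h.differentiable.continuous; fun_prop)
    isOpen_univ.isLocallyClosed

/-- The equation is tested with `η² u`, where `η` is the cutoff, and the cross term `2 η η' u u'` is
split by Young's inequality. The gain is a right-hand side independent of `N`. -/
lemma energy_le (hV : IsConfining V) (h : IsL2Solution V μ u) {N : ℝ} (hN : 1 ≤ N) :
    ∫ x in -N..N, cutoff N x ^ 2 * (deriv u x ^ 2 / 2 + max (V x) 0 * u x ^ 2) ≤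
      ∫ x, ((8 + |μ|) * u x ^ 2 + max (-V x) 0 * u x ^ 2) := by
  have hN0 : 0 < N := by linarith
  have hu := h.differentiable.continuous
  have hd := h.continuous_deriv
  have hη := continuous_cutoff N
  have hηAC : ∀ a b, AbsolutelyContinuousOnInterval (fun x => cutoff N x * u x) a b := fun a b =>
    (contDiff_cutoff N).contDiffOn.absolutelyContinuousOnInterval.fun_mul
      (h.absolutelyContinuous a b)
  have hηd : ∀ᵐ x, HasDerivAt (fun x => cutoff N x * u x)
      (-(2 * x / N ^ 2) * u x + cutoff N x * deriv u x) x := Eventually.of_forall fun x =>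
    (hasDerivAt_cutoff N x).fun_mul (h.differentiable x).hasDerivAt
  have key := integral_deriv_mul_cutoff h.absolutelyContinuous_deriv hηAC hηd hN0
  set D : ℝ → ℝ := fun x => deriv u x * (-(2 * x / N ^ 2) * (cutoff N x * u x) +
    cutoff N x * (-(2 * x / N ^ 2) * u x + cutoff N x * deriv u x)) with hD
  have hDc : Continuous D := by fun_prop
  set E : ℝ → ℝ := fun x => deriv (deriv u) x * (cutoff N x * (cutoff N x * u x)) with hE
  have hEi : IntervalIntegrable E volume (-N) N :=
    (h.absolutelyContinuous_deriv (-N) N).intervalIntegrable_deriv.mul_continuousOn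
      (by fun_prop)
  have hsum : ∫ x in -N..N, (E x + D x) = 0 := by
    rw [intervalIntegral.integral_add hEi (hDc.intervalIntegrable _ _), key]
    ring
  have hi1 : Integrable fun x => (8 + |μ|) * u x ^ 2 + max (-V x) 0 * u x ^ 2 :=
    (h.memLp.integrable_sq.const_mul _).add (hV.integrable_negPart_mul (by fun_prop))
  have hi2 : IntervalIntegrable (fun x => cutoff N x ^ 2 *
      (deriv u x ^ 2 / 2 + max (V x) 0 * u x ^ 2)) volume (-N) N := by
    refine IntervalIntegrable.continuousOn_mul ?_ (by fun_prop)
    exact ((by fun_prop : Continuous fun x => deriv u x ^ 2 / 2).intervalIntegrable _ _).add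
      (intervalIntegrable_of_locallyIntegrable (locallyIntegrable_mul_sq hV h) _ _)
  have hpt : ∀ᵐ x, x ∈ Set.Icc (-N) N → cutoff N x ^ 2 *
      (deriv u x ^ 2 / 2 + max (V x) 0 * u x ^ 2) ≤
        (E x + D x) + ((8 + |μ|) * u x ^ 2 + max (-V x) 0 * u x ^ 2) := by
    filter_upwards [h.equation] with x hx hxN
    have hxN' : |x| ≤ N := abs_le.2 hxN
    have e1 : deriv (deriv u) x = (V x - μ) * u x := by linarith
    have e2 : V x = max (V x) 0 - max (-V x) 0 := by
      rcases le_total 0 (V x) with hv | hv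
      · rw [max_eq_left hv, max_eq_right (by linarith)]; ring
      · rw [max_eq_right hv, max_eq_left (by linarith)]; ring
    have b0 := cutoff_nonneg hN0 hxN'
    have b1 := cutoff_le_one N x
    have b2 := abs_two_mul_div_sq_le hN0 hxN'
    have b3 : (2 * x / N ^ 2) ^ 2 ≤ 4 := by
      have : |2 * x / N ^ 2| ≤ 2 := b2.trans (by rw [div_le_iff₀ hN0]; linarith)
      rw [← sq_abs]
      nlinarith [abs_nonneg (2 * x / N ^ 2)]
    have b4 : cutoff N x ^ 2 ≤ 1 := by nlinarith
    have c1 : 0 ≤ max (-V x) 0 * u x ^ 2 := mul_nonneg (le_max_right _ _) (sq_nonneg _)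
    have c2 : μ * u x ^ 2 ≤ |μ| * u x ^ 2 :=
      mul_le_mul_of_nonneg_right (le_abs_self μ) (sq_nonneg _)
    have c3 : cutoff N x ^ 2 * (μ * u x ^ 2) ≤ |μ| * u x ^ 2 := by
      have h0 : 0 ≤ |μ| * u x ^ 2 := by positivity
      have := mul_le_mul_of_nonneg_left c2 (sq_nonneg (cutoff N x))
      nlinarith
    have c4 : cutoff N x ^ 2 * (max (-V x) 0 * u x ^ 2) ≤ max (-V x) 0 * u x ^ 2 :=
      mul_le_of_le_one_left c1 b4
    have c5 : (2 * x / N ^ 2) ^ 2 * u x ^ 2 ≤ 4 * u x ^ 2 :=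
      mul_le_mul_of_nonneg_right b3 (sq_nonneg _)
    simp only [hE, hD, e1]
    generalize hz : 2 * x / N ^ 2 = z at *
    generalize max (V x) 0 = p at *
    generalize max (-V x) 0 = q at *
    rw [e2]
    -- Half of this square absorbs the cross term at the price of `2 z² u²`. Since `z² ≤ 4`, this is
    -- the `8 u²` of the bound.
    nlinarith [sq_nonneg (cutoff N x * deriv u x - 2 * z * u x)]
  have hmono := intervalIntegral.integral_mono_ae_restrict (by linarith : -N ≤ N) hi2
    ((hEi.add (hDc.intervalIntegrable _ _)).add hi1.intervalIntegrable)
    ((ae_restrict_iff' measurableSet_Icc).2 hpt)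
  rw [intervalIntegral.integral_add (hEi.add (hDc.intervalIntegrable _ _)) hi1.intervalIntegrable,
    hsum, zero_add] at hmono
  refine hmono.trans ?_
  rw [intervalIntegral.integral_of_le (by linarith)]
  refine setIntegral_le_integral hi1 (Eventually.of_forall fun x => ?_)
  have : 0 ≤ max (-V x) 0 := le_max_right _ _
  simp only [Pi.zero_apply]
  positivity

/-- On the inner half of the interval of `energy_le` the cutoff is at least `3/4`, so the energy
there is at most `16/9` of a fixed constant, and the inner halves exhaust the line. -/
lemma integrable_energy (hV : IsConfining V) (h : IsL2Solution V μ u) :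
    Integrable fun x => deriv u x ^ 2 / 2 + max (V x) 0 * u x ^ 2 := by
  have hd := h.continuous_deriv
  have hnn : ∀ x, 0 ≤ deriv u x ^ 2 / 2 + max (V x) 0 * u x ^ 2 := fun x => by
    have : 0 ≤ max (V x) 0 := le_max_right _ _
    positivity
  have hloc : LocallyIntegrable (fun x => deriv u x ^ 2 / 2 + max (V x) 0 * u x ^ 2) volume :=
    (by fun_prop : Continuous fun x => deriv u x ^ 2 / 2).locallyIntegrable.add
      (locallyIntegrable_mul_sq hV h)
  set K := ∫ x, ((8 + |μ|) * u x ^ 2 + max (-V x) 0 * u x ^ 2)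
  refine integrable_of_intervalIntegral_norm_bounded (16 / 9 * K) (a := fun n : ℕ => -((n : ℝ) + 1))
    (b := fun n : ℕ => (n : ℝ) + 1) (l := atTop)
    (fun n => (hloc.integrableOn_isCompact isCompact_Icc).mono_set Set.Ioc_subset_Icc_self)
    (tendsto_neg_atTop_atBot.comp
      (tendsto_natCast_atTop_atTop.atTop_add tendsto_const_nhds))
    (tendsto_natCast_atTop_atTop.atTop_add tendsto_const_nhds)
    (Eventually.of_forall fun n => ?_)
  have hn : (0 : ℝ) < n + 1 := by positivity
  have h1 := energy_le hV h (N := 2 * ((n : ℝ) + 1)) (by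
    have : (0 : ℝ) ≤ n := n.cast_nonneg
    linarith)
  have hi : ∀ a b, IntervalIntegrable (fun x => cutoff (2 * ((n : ℝ) + 1)) x ^ 2 *
      (deriv u x ^ 2 / 2 + max (V x) 0 * u x ^ 2)) volume a b := fun a b =>
    (intervalIntegrable_of_locallyIntegrable hloc a b).continuousOn_mul
      ((continuous_cutoff _).pow 2).continuousOn
  have h2 : ∫ x in (-((n : ℝ) + 1))..(n + 1), 9 / 16 * (deriv u x ^ 2 / 2 + max (V x) 0 * u x ^ 2) ≤
      ∫ x in (-((n : ℝ) + 1))..(n + 1), cutoff (2 * ((n : ℝ) + 1)) x ^ 2 *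
        (deriv u x ^ 2 / 2 + max (V x) 0 * u x ^ 2) := by
    refine intervalIntegral.integral_mono_on (by linarith)
      ((intervalIntegrable_of_locallyIntegrable hloc _ _).const_mul _) (hi _ _) fun x hx => ?_
    refine mul_le_mul_of_nonneg_right ?_ (hnn x)
    have h3 : x ^ 2 / (2 * ((n : ℝ) + 1)) ^ 2 ≤ 1 / 4 := by
      rw [div_le_div_iff₀ (by positivity) (by norm_num)]
      nlinarith [hx.1, hx.2]
    have h4 : 3 / 4 ≤ cutoff (2 * ((n : ℝ) + 1)) x := by unfold cutoff; linarith
    nlinarith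
  have h3 : ∫ x in (-((n : ℝ) + 1))..(n + 1), cutoff (2 * ((n : ℝ) + 1)) x ^ 2 *
        (deriv u x ^ 2 / 2 + max (V x) 0 * u x ^ 2) ≤
      ∫ x in (-(2 * ((n : ℝ) + 1)))..(2 * (n + 1)), cutoff (2 * ((n : ℝ) + 1)) x ^ 2 *
        (deriv u x ^ 2 / 2 + max (V x) 0 * u x ^ 2) := by
    refine intervalIntegral.integral_mono_interval (by linarith) (by linarith) (by linarith)
      (Eventually.of_forall fun x => ?_) (hi _ _)
    exact mul_nonneg (sq_nonneg _) (hnn x)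
  rw [intervalIntegral.integral_const_mul] at h2
  simp only [Real.norm_of_nonneg (hnn _)]
  linarith

lemma memLp_deriv (hV : IsConfining V) (h : IsL2Solution V μ u) : MemLp (deriv u) 2 volume := by
  rw [memLp_two_iff_integrable_sq h.continuous_deriv.aestronglyMeasurable]
  refine ((integrable_energy hV h).const_mul 2).mono'
    (h.continuous_deriv.pow 2).aestronglyMeasurable (Eventually.of_forall fun x => ?_)
  rw [Real.norm_of_nonneg (sq_nonneg _)]
  have : 0 ≤ max (V x) 0 * u x ^ 2 := mul_nonneg (le_max_right _ _) (sq_nonneg _)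
  linarith

lemma memLp_sqrt_mul (hV : IsConfining V) (h : IsL2Solution V μ u) :
    MemLp (fun x => √(V x) * u x) 2 volume := by
  have hm : AEStronglyMeasurable (fun x => √(V x) * u x) volume :=
    (Real.continuous_sqrt.comp_aestronglyMeasurable hV.aestronglyMeasurable).mul
      h.differentiable.continuous.aestronglyMeasurable
  rw [memLp_two_iff_integrable_sq hm]
  refine (integrable_energy hV h).mono' (hm.pow 2) (Eventually.of_forall fun x => ?_)
  rw [Real.norm_of_nonneg (sq_nonneg _), mul_pow, sq_sqrt_eq_max]
  have : 0 ≤ deriv u x ^ 2 / 2 := by positivity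
  linarith

/-- Solutions in `L²` belong to the form domain and satisfy the weak form of the equation. -/
lemma exists_formDomain (hV : IsConfining V) (h : IsL2Solution V μ u) (c : ℝ) :
    ∃ f : formDomain V, formDomain.rep f = u ∧ formDomain.coord V 0 f = h.memLp.toLp u ∧
      ∀ k, formDomain.form V c f k =
        (μ + c) * inner ℝ (formDomain.coord V 0 f) (formDomain.coord V 0 k) := by
  obtain ⟨f, hf1, hf2, hf3⟩ := formDomain.exists_of_memLp hV h.memLp (h.memLp_deriv hV)
    ⟨u 0, h.eq_primitive⟩ (h.memLp_sqrt_mul hV)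
  refine ⟨f, hf1, hf2, fun k => ?_⟩
  have hd := h.continuous_deriv
  have hu := h.differentiable.continuous
  set v := formDomain.rep k with hv
  have hvc : Continuous v := formDomain.continuous_rep k
  set g : ℝ → ℝ := ⇑(formDomain.coord V 1 k) with hg
  have hgl := formDomain.locallyIntegrable_coord k 1
  have hvAC : ∀ a b, AbsolutelyContinuousOnInterval v a b :=
    absolutelyContinuousOnInterval_primitive hgl _
  have hvd : ∀ᵐ x, HasDerivAt v (g x) x := ae_hasDerivAt_primitive hgl _
  have i1 : Integrable fun x => deriv u x * g x := (h.memLp_deriv hV).integrable_mul (Lp.memLp _)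
  have i2 : Integrable fun x => V x * (u x * v x) := by
    have := (formDomain.inner_coord_two_sub f k).1
    rwa [hf1] at this
  have i3 : Integrable fun x => u x * v x := h.memLp.integrable_mul (formDomain.memLp_rep k)
  have i4 : Integrable fun x => deriv u x * v x :=
    (h.memLp_deriv hV).integrable_mul (formDomain.memLp_rep k)
  have i6 : Integrable fun x => V x * (u x * v x) - μ * (u x * v x) := i2.sub (i3.const_mul μ)
  have i7 : Integrable fun x => deriv u x * g x + V x * (u x * v x) := i1.add i2
  have i5 : Integrable fun x => deriv u x * g x + V x * (u x * v x) - μ * (u x * v x) :=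
    i7.sub (i3.const_mul μ)
  -- The weak equation holds up to the term from the derivative of the cutoff. That derivative is
  -- `O(1/n)` on the interval and multiplies the integrable function `u' v`, so the error disappears
  -- in the limit.
  have key : ∀ n : ℕ, ∫ x in (-((n : ℝ) + 1))..(n + 1), cutoff (n + 1) x *
      (deriv u x * g x + V x * (u x * v x) - μ * (u x * v x)) =
        ∫ x in (-((n : ℝ) + 1))..(n + 1), 2 * x / ((n : ℝ) + 1) ^ 2 * (deriv u x * v x) := by
    intro n
    have hn : (0 : ℝ) < n + 1 := by positivity
    have h1 := integral_deriv_mul_cutoff h.absolutelyContinuous_deriv hvAC hvd hn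
    have e1 : ∫ x in (-((n : ℝ) + 1))..(n + 1), deriv (deriv u) x * (cutoff (n + 1) x * v x) =
        ∫ x in (-((n : ℝ) + 1))..(n + 1),
          (cutoff (n + 1) x * (V x * (u x * v x) - μ * (u x * v x))) := by
      refine intervalIntegral.integral_congr_ae ?_
      filter_upwards [h.equation] with x hx _
      have : deriv (deriv u) x = (V x - μ) * u x := by linarith
      rw [this]; ring
    have j1 : ∀ F : ℝ → ℝ, Integrable F → IntervalIntegrable (fun x => cutoff (n + 1) x * F x)
        volume (-((n : ℝ) + 1)) (n + 1) := fun F hF =>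
      hF.intervalIntegrable.continuousOn_mul (continuous_cutoff _).continuousOn
    have j2 : IntervalIntegrable (fun x => 2 * x / ((n : ℝ) + 1) ^ 2 * (deriv u x * v x)) volume
        (-((n : ℝ) + 1)) (n + 1) := i4.intervalIntegrable.continuousOn_mul (by fun_prop)
    have e2 : ∫ x in (-((n : ℝ) + 1))..(n + 1), deriv u x * (-(2 * x / ((n : ℝ) + 1) ^ 2) * v x +
        cutoff (n + 1) x * g x) =
          (∫ x in (-((n : ℝ) + 1))..(n + 1), cutoff (n + 1) x * (deriv u x * g x)) -
          ∫ x in (-((n : ℝ) + 1))..(n + 1), 2 * x / ((n : ℝ) + 1) ^ 2 * (deriv u x * v x) := by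
      rw [← intervalIntegral.integral_sub (j1 _ i1) j2]
      refine intervalIntegral.integral_congr fun x _ => ?_
      ring
    rw [e1, e2] at h1
    have e3 : ∫ x in (-((n : ℝ) + 1))..(n + 1), cutoff (n + 1) x *
      (deriv u x * g x + V x * (u x * v x) - μ * (u x * v x)) =
        (∫ x in (-((n : ℝ) + 1))..(n + 1), cutoff (n + 1) x * (deriv u x * g x)) +
        ∫ x in (-((n : ℝ) + 1))..(n + 1),
          cutoff (n + 1) x * (V x * (u x * v x) - μ * (u x * v x)) := by
      rw [← intervalIntegral.integral_add (j1 _ i1) (j1 _ i6)]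
      refine intervalIntegral.integral_congr fun x _ => ?_
      ring
    rw [e3, h1]
    ring
  have hlim := tendsto_integral_cutoff_mul i5
  simp only [key] at hlim
  have hzero : Tendsto (fun n : ℕ => ∫ x in (-((n : ℝ) + 1))..(n + 1),
      2 * x / ((n : ℝ) + 1) ^ 2 * (deriv u x * v x)) atTop (𝓝 0) := by
    have hb : ∀ n : ℕ, ‖∫ x in (-((n : ℝ) + 1))..(n + 1),
        2 * x / ((n : ℝ) + 1) ^ 2 * (deriv u x * v x)‖ ≤
          2 * (∫ x, ‖deriv u x * v x‖) * (1 / ((n : ℝ) + 1)) := by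
      intro n
      have hn : (0 : ℝ) < n + 1 := by positivity
      have hle : -((n : ℝ) + 1) ≤ n + 1 := by linarith
      refine (intervalIntegral.norm_integral_le_of_norm_le hle (g := fun x =>
        2 / ((n : ℝ) + 1) * ‖deriv u x * v x‖) (Eventually.of_forall fun x hx => ?_)
        (i4.norm.const_mul _).intervalIntegrable).trans ?_
      · rw [norm_mul]
        exact mul_le_mul_of_nonneg_right
          (abs_two_mul_div_sq_le hn (abs_le.2 ⟨hx.1.le, hx.2⟩)) (norm_nonneg _)
      · rw [intervalIntegral.integral_const_mul, intervalIntegral.integral_of_le hle]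
        have := setIntegral_le_integral (s := Set.Ioc (-((n : ℝ) + 1)) (n + 1)) i4.norm
          (Eventually.of_forall fun x => norm_nonneg _)
        calc 2 / ((n : ℝ) + 1) * ∫ x in Set.Ioc (-((n : ℝ) + 1)) (n + 1), ‖deriv u x * v x‖
            ≤ 2 / ((n : ℝ) + 1) * ∫ x, ‖deriv u x * v x‖ := by gcongr
          _ = _ := by ring
    refine squeeze_zero_norm hb ?_
    simpa using tendsto_one_div_add_atTop_nhds_zero_nat.const_mul (2 * ∫ x, ‖deriv u x * v x‖)
  have hfin := tendsto_nhds_unique hlim hzero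
  rw [integral_sub i7 (i3.const_mul μ), integral_add i1 i2, integral_const_mul] at hfin
  have e4 : ∫ x, formDomain.coord V 1 f x * formDomain.coord V 1 k x = ∫ x, deriv u x * g x := by
    refine integral_congr_ae ?_
    filter_upwards [(h.memLp_deriv hV).coeFn_toLp] with x hx
    rw [hf3, hx]
  rw [formDomain.form_eq_integral, formDomain.inner_coord_zero, hf1, e4]
  linarith

end IsL2Solution

/-! ### Regularity of weak solutions -/

lemma IsConfining.memLp_sqrt_mul_of_support {V : ℝ → ℝ} (hV : IsConfining V) {v : ℝ → ℝ}
    (hv : Continuous v) {a b : ℝ} (hs : Function.support v ⊆ Set.Icc a b) :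
    MemLp (fun x => √(V x) * v x) 2 volume := by
  have hm : AEStronglyMeasurable (fun x => √(V x) * v x) volume :=
    (Real.continuous_sqrt.comp_aestronglyMeasurable hV.aestronglyMeasurable).mul
      hv.aestronglyMeasurable
  rw [memLp_two_iff_integrable_sq hm]
  have h1 : IntegrableOn (fun x => max (V x) 0 * v x ^ 2) (Set.Icc a b) :=
    IntegrableOn.mul_continuousOn
      (hV.locallyIntegrable.integrableOn_isCompact isCompact_Icc).pos_part
      (by fun_prop) isCompact_Icc
  have h2 : Integrable fun x => max (V x) 0 * v x ^ 2 := by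
    refine (integrableOn_iff_integrable_of_support_subset fun x hx => hs fun h0 => hx ?_).1 h1
    simp [h0]
  refine h2.congr (Eventually.of_forall fun x => ?_)
  simp only [mul_pow, sq_sqrt_eq_max]

namespace formDomain

variable {V : ℝ → ℝ}

/-- Test functions with support in `[-N, N]` and prescribed derivative. -/
lemma exists_of_indicator (hV : IsConfining V) {p : ℝ → ℝ} {N : ℝ} (hN : 0 < N)
    (hp : MemLp ((Set.Ioc (-N) N).indicator p) 2 volume) (hp0 : ∫ x in -N..N, p x = 0) :
    ∃ k : formDomain V, coord V 1 k = hp.toLp _ ∧ (∀ x, x ∉ Set.Ioc (-N) N → rep k x = 0) := by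
  set q := (Set.Ioc (-N) N).indicator p with hq
  have hql := locallyIntegrable_of_memLp hp
  -- The constant makes the primitive vanish at `-N`; the zero mean of `p` then makes it vanish at
  -- `N`.
  have hv : ∀ x, primitive (-∫ t in (0 : ℝ)..(-N), q t) q x = ∫ t in -N..x, q t := fun x => by
    rw [← primitive_sub hql (-∫ t in (0 : ℝ)..(-N), q t) x (-N)]
    simp [primitive]
  set v := primitive (-∫ t in (0 : ℝ)..(-N), q t) q with hvdef
  have hvc : Continuous v := continuous_primitive hql _
  have hleft : ∀ x, x ≤ -N → v x = 0 := by
    intro x hx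
    rw [hv, intervalIntegral.integral_symm, intervalIntegral.integral_of_le hx,
      setIntegral_eq_zero_of_forall_eq_zero, neg_zero]
    intro t ht
    exact Set.indicator_of_notMem (fun h => absurd h.1 (not_lt.2 ht.2)) _
  have hright : ∀ x, N ≤ x → v x = 0 := by
    intro x hx
    have h1 : ∫ t in -N..N, q t = 0 := by
      rw [← hp0]
      refine intervalIntegral.integral_congr_ae (Eventually.of_forall fun t ht => ?_)
      rw [Set.uIoc_of_le (by linarith)] at ht
      exact Set.indicator_of_mem ht _
    have h2 : ∫ t in N..x, q t = 0 := by
      rw [intervalIntegral.integral_of_le hx, setIntegral_eq_zero_of_forall_eq_zero]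
      intro t ht
      exact Set.indicator_of_notMem (fun h => absurd h.2 (not_le.2 ht.1)) _
    rw [hv, ← intervalIntegral.integral_add_adjacent_intervals
      (intervalIntegrable_of_memLp hp (-N) N) (intervalIntegrable_of_memLp hp N x), h1, h2, add_zero]
  have hsupp : Function.support v ⊆ Set.Icc (-N) N := by
    intro x hx
    by_contra hc
    rw [Set.mem_Icc, not_and_or, not_le, not_le] at hc
    rcases hc with hc | hc
    · exact hx (hleft x hc.le)
    · exact hx (hright x hc.le)
  have hvL : MemLp v 2 volume :=
    hvc.memLp_of_hasCompactSupport
      (HasCompactSupport.of_support_subset_isCompact isCompact_Icc hsupp)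
  obtain ⟨k, h1, -, h3⟩ := exists_of_memLp hV hvL hp ⟨_, rfl⟩
    (hV.memLp_sqrt_mul_of_support hvc hsupp)
  refine ⟨k, h3, fun x hx => ?_⟩
  rw [h1]
  rw [Set.mem_Ioc, not_and_or, not_lt, not_le] at hx
  rcases hx with hx | hx
  · exact hleft x hx
  · exact hright x hx.le

lemma locallyIntegrable_potential_mul (hV : IsConfining V) (f : formDomain V) (a : ℝ) :
    LocallyIntegrable (fun x => (V x - a) * rep f x) volume := by
  have h1 : LocallyIntegrable (fun x => V x - a) volume :=
    hV.locallyIntegrable.sub (locallyIntegrable_const a)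
  rw [← locallyIntegrableOn_univ] at h1 ⊢
  exact h1.mul_continuousOn (continuous_rep f).continuousOn isOpen_univ.isLocallyClosed

/-- The derivative of a weak solution agrees with a primitive of `(V - μ) u` on any interval, up to
a constant. -/
lemma ae_coord_one_eq_on (hV : IsConfining V) {c s : ℝ} {f : formDomain V}
    (hf : ∀ k, form V c f k = s * inner ℝ (coord V 0 f) (coord V 0 k)) {N : ℝ} (hN : 0 < N) :
    ∃ m, ∀ᵐ x, x ∈ Set.Ioc (-N) N →
      coord V 1 f x = primitive 0 (fun x => (V x - (s - c)) * rep f x) x + m := by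
  set F : ℝ → ℝ := fun x => (V x - (s - c)) * rep f x with hF
  have hFl : LocallyIntegrable F volume := locallyIntegrable_potential_mul hV f _
  set G := primitive 0 F with hG
  have hGc : Continuous G := continuous_primitive hFl 0
  set g : ℝ → ℝ := ⇑(coord V 1 f) with hg
  have hgL : MemLp g 2 volume := Lp.memLp _
  have hle : -N ≤ N := by linarith
  -- The du Bois-Reymond argument: `m` is the mean of `g - G`, so `p = g - G - m` is the derivative
  -- of an admissible test function. Testing the weak equation with that function yields `∫ p² = 0`.
  set m := (∫ x in -N..N, (g x - G x)) / (2 * N) with hm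
  set p : ℝ → ℝ := fun x => g x - G x - m with hp
  have hgi : ∀ a b, IntervalIntegrable g volume a b := intervalIntegrable_of_memLp hgL
  have hGi : ∀ a b, IntervalIntegrable G volume a b := fun a b => hGc.intervalIntegrable a b
  have hp0 : ∫ x in -N..N, p x = 0 := by
    rw [intervalIntegral.integral_sub ((hgi _ _).sub (hGi _ _)) (by simp)]
    simp only [intervalIntegral.integral_const, smul_eq_mul, hm]
    field_simp
    ring
  have hpL : MemLp ((Set.Ioc (-N) N).indicator p) 2 volume := by
    rw [memLp_indicator_iff_restrict measurableSet_Ioc]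
    obtain ⟨C, hC⟩ := isCompact_Icc.exists_bound_of_continuousOn
      (f := fun x => G x + m) (s := Set.Icc (-N) N) (by fun_prop)
    have h1 : MemLp (fun x => G x + m) 2 (volume.restrict (Set.Ioc (-N) N)) := by
      refine MemLp.of_bound (by fun_prop) C ?_
      rw [ae_restrict_iff' measurableSet_Ioc]
      exact Eventually.of_forall fun x hx => hC x (Set.Ioc_subset_Icc_self hx)
    refine (hgL.restrict _ |>.sub h1).ae_eq (Eventually.of_forall fun x => ?_)
    simp only [Pi.sub_apply, hp]; ring
  obtain ⟨k, hk1, hk0⟩ := exists_of_indicator hV hN hpL hp0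
  have hk1' : ∀ᵐ x, coord V 1 k x = (Set.Ioc (-N) N).indicator p x := by
    rw [hk1]; exact hpL.coeFn_toLp
  have hpi : IntervalIntegrable p volume (-N) N := ((hgi _ _).sub (hGi _ _)).sub (by simp)
  have hsplit : ∀ w : ℝ → ℝ, (∀ x, x ∉ Set.Ioc (-N) N → w x = 0) →
      ∫ x, w x = ∫ x in -N..N, w x := by
    intro w hw
    rw [intervalIntegral.integral_of_le hle, setIntegral_eq_integral_of_forall_compl_eq_zero hw]
  have i2 := (inner_coord_two_sub f k).1
  have i3 : Integrable fun x => rep f x * rep k x := (memLp_rep f).integrable_mul (memLp_rep k)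
  have hweak := hf k
  rw [form_eq_integral, inner_coord_zero] at hweak
  have e1 : ∫ x, coord V 1 f x * coord V 1 k x = ∫ x in -N..N, g x * p x := by
    rw [integral_congr_ae (hk1'.mono fun x hx => by simp only [hx]; rfl :
      (fun x => coord V 1 f x * coord V 1 k x) =ᵐ[volume]
        fun x => g x * (Set.Ioc (-N) N).indicator p x), hsplit]
    · refine intervalIntegral.integral_congr_ae (Eventually.of_forall fun x hx => ?_)
      rw [Set.uIoc_of_le hle] at hx
      rw [Set.indicator_of_mem hx]
    · intro x hx
      rw [Set.indicator_of_notMem hx, mul_zero]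
  have e2 : ∫ x, F x * rep k x = (∫ x, V x * (rep f x * rep k x)) -
      (s - c) * ∫ x, rep f x * rep k x := by
    rw [← integral_const_mul, ← integral_sub i2 (i3.const_mul _)]
    refine integral_congr_ae (Eventually.of_forall fun x => ?_)
    simp only [hF]; ring
  rw [hsplit _ fun x hx => by rw [hk0 x hx, mul_zero]] at e2
  have hkl := locallyIntegrable_coord k 1
  have hparts := (absolutelyContinuousOnInterval_primitive hFl 0 (-N) N).integral_deriv_mul_eq_sub
    (absolutelyContinuousOnInterval_primitive hkl k.2.1.choose (-N) N)
  have hN1 : primitive k.2.1.choose (coord V 1 k) (-N) = 0 := hk0 (-N) (by simp)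
  -- The half-open interval contains `N`, so the value there comes from continuity on the right.
  have hN2 : primitive k.2.1.choose (coord V 1 k) N = 0 := by
    have hc : Continuous (rep k) := continuous_rep k
    have hcl : IsClosed {x | rep k x = 0} := isClosed_eq hc continuous_const
    have : Set.Ici N ⊆ {x | rep k x = 0} := by
      rw [← closure_Ioi]
      exact hcl.closure_subset_iff.2 fun x hx => hk0 x fun h => absurd h.2 (not_le.2 hx)
    exact this Set.self_mem_Ici
  rw [hN1, hN2, mul_zero, mul_zero, sub_zero] at hparts
  have e3 : ∫ x in -N..N, (F x * rep k x + G x * p x) = 0 := by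
    rw [← hparts]
    refine intervalIntegral.integral_congr_ae ?_
    filter_upwards [ae_hasDerivAt_primitive hFl 0, ae_hasDerivAt_primitive hkl k.2.1.choose, hk1']
      with x h1 h2 h3 hx
    rw [Set.uIoc_of_le hle] at hx
    rw [h1.deriv, h2.deriv, h3, Set.indicator_of_mem hx]
    rfl
  have j1 : IntervalIntegrable (fun x => F x * rep k x) volume (-N) N :=
    (intervalIntegrable_of_locallyIntegrable hFl _ _).mul_continuousOn
      (continuous_rep k).continuousOn
  have j2 : IntervalIntegrable (fun x => G x * p x) volume (-N) N :=
    hpi.continuousOn_mul hGc.continuousOn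
  have j3 : IntervalIntegrable (fun x => g x * p x) volume (-N) N := by
    have := (hgL.integrable_mul hpL).intervalIntegrable (a := -N) (b := N)
    refine this.congr_ae ?_
    rw [Set.uIoc_of_le hle]
    filter_upwards [ae_restrict_mem measurableSet_Ioc] with x hx
    change g x * (Set.Ioc (-N) N).indicator p x = g x * p x
    rw [Set.indicator_of_mem hx]
  rw [intervalIntegral.integral_add j1 j2] at e3
  have e4 : ∫ x in -N..N, p x * p x = 0 := by
    have : ∫ x in -N..N, p x * p x = (∫ x in -N..N, g x * p x) - (∫ x in -N..N, G x * p x) -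
        m * ∫ x in -N..N, p x := by
      rw [← intervalIntegral.integral_const_mul, ← intervalIntegral.integral_sub j3 j2,
        ← intervalIntegral.integral_sub (j3.sub j2) (hpi.const_mul m)]
      refine intervalIntegral.integral_congr fun x _ => ?_
      simp only [hp]; ring
    rw [this, hp0]
    linarith
  refine ⟨m, ?_⟩
  have j4 : IntervalIntegrable (fun x => p x * p x) volume (-N) N := by
    refine ((j3.sub j2).sub (hpi.const_mul m)).congr_ae (Eventually.of_forall fun x => ?_)
    have h1 : p x = g x - G x - m := rfl
    change g x * p x - G x * p x - m * p x = p x * p x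
    linear_combination (-p x) * h1
  rw [intervalIntegral.integral_of_le hle, setIntegral_eq_zero_iff_of_nonneg_ae
    (Eventually.of_forall fun x => mul_self_nonneg _)
    ((intervalIntegrable_iff_integrableOn_Ioc_of_le hle).1 j4), EventuallyEq,
    ae_restrict_iff' measurableSet_Ioc] at e4
  filter_upwards [e4] with x hx hxN
  have := mul_self_eq_zero.1 (hx hxN)
  simp only [hp] at this
  linarith

/-- Weak solutions in the form domain solve the differential equation. -/
theorem isL2Solution_rep (hV : IsConfining V) {c s : ℝ} {f : formDomain V}
    (hf : ∀ k, form V c f k = s * inner ℝ (coord V 0 f) (coord V 0 k)) :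
    IsL2Solution V (s - c) (rep f) := by
  set F : ℝ → ℝ := fun x => (V x - (s - c)) * rep f x with hF
  have hFl : LocallyIntegrable F volume := locallyIntegrable_potential_mul hV f _
  have hn : ∀ n : ℕ, (0 : ℝ) < n + 1 := fun n => by positivity
  choose m hm using fun n : ℕ => ae_coord_one_eq_on hV hf (hn n)
  -- The constants of different intervals are compared at a common point of `(-1, 1]`.
  have hm0 : ∀ n, m n = m 0 := by
    intro n
    have : NeBot (ae (volume.restrict (Set.Ioc (-1 : ℝ) 1))) := by
      rw [ae_neBot, Ne, Measure.restrict_eq_zero]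
      simp
    have h := ((ae_restrict_mem measurableSet_Ioc).and
      ((ae_restrict_of_ae (hm n)).and (ae_restrict_of_ae (hm 0)))).exists
      (f := ae (volume.restrict (Set.Ioc (-1 : ℝ) 1)))
    obtain ⟨x, hx, h1, h2⟩ := h
    have hn' : (0 : ℝ) ≤ n := n.cast_nonneg
    have h3 := h1 ⟨by linarith [hx.1], by linarith [hx.2]⟩
    have h4 := h2 ⟨by simpa using hx.1, by simpa using hx.2⟩
    linarith
  have hae : ∀ᵐ x, coord V 1 f x = primitive (m 0) F x := by
    filter_upwards [ae_all_iff.2 hm] with x hx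
    obtain ⟨n, hn⟩ := exists_nat_gt |x|
    obtain ⟨h1, h2⟩ := abs_lt.1 hn
    rw [hx n ⟨by linarith, by linarith⟩, hm0]
    unfold primitive
    ring
  have hG : Continuous (primitive (m 0) F) := continuous_primitive hFl _
  -- The weak derivative has a continuous representative, so the derivative exists at every point.
  have hd : ∀ x, HasDerivAt (rep f) (primitive (m 0) F x) x := by
    intro x
    have : rep f = primitive f.2.1.choose (primitive (m 0) F) := by
      unfold rep
      exact primitive_congr_ae hae _
    rw [this]
    exact (intervalIntegral.integral_hasDerivAt_right (hG.intervalIntegrable _ _)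
      (hG.stronglyMeasurableAtFilter _ _) hG.continuousAt).const_add _
  have hderiv : deriv (rep f) = primitive (m 0) F := funext fun x => (hd x).deriv
  refine ⟨memLp_rep f, fun x => (hd x).differentiableAt, fun a b => ?_, ?_⟩
  · rw [hderiv]
    exact absolutelyContinuousOnInterval_primitive hFl _ _ _
  · filter_upwards [ae_hasDerivAt_primitive hFl (m 0)] with x hx
    rw [hderiv, hx.deriv]
    simp only [hF]
    ring

end formDomain

/-! ### Eigenspaces -/

lemma IsL2Solution.continuous {V : ℝ → ℝ} {μ : ℝ} {u : ℝ → ℝ} (h : IsL2Solution V μ u) :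
    Continuous u := h.differentiable.continuous

/-- The eigenspaces of the Schrödinger operator have the dimensions of the eigenspaces of its
resolvent. -/
lemma rank_schrodingerEigenspace {V : ℝ → ℝ} (hV : IsConfining V) {c : ℝ}
    {T : Lp ℝ 2 (volume : Measure ℝ) →L[ℝ] Lp ℝ 2 (volume : Measure ℝ)}
    (hinj : ∀ f, T f = 0 → f = 0)
    (hT : ∀ f, ∃ h, formDomain.coord V 0 h = T f ∧
      ∀ k, formDomain.form V c h k = inner ℝ f (formDomain.coord V 0 k))
    (hT' : ∀ f h, (∀ k, formDomain.form V c h k = inner ℝ f (formDomain.coord V 0 k)) →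
      T f = formDomain.coord V 0 h) (μ : ℝ) :
    Module.rank ℝ (schrodingerEigenspace V μ) =
      Module.rank ℝ (Module.End.eigenspace (T : Module.End ℝ (Lp ℝ 2 (volume : Measure ℝ)))
        (μ + c)⁻¹) := by
  have hsol : ∀ u : schrodingerEigenspace V μ, IsL2Solution V μ u.1 := fun u => u.2
  have hmem : ∀ u : schrodingerEigenspace V μ, (hsol u).memLp.toLp u.1 ∈
      Module.End.eigenspace (T : Module.End ℝ (Lp ℝ 2 (volume : Measure ℝ))) (μ + c)⁻¹ := by
    intro u
    rw [Module.End.mem_eigenspace_iff]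
    obtain ⟨f, -, hf2, hf3⟩ := (hsol u).exists_formDomain hV c
    have h1 : T ((μ + c) • (hsol u).memLp.toLp u.1) = (hsol u).memLp.toLp u.1 := by
      rw [hT' _ f fun k => by rw [hf3, real_inner_smul_left, hf2], hf2]
    change T _ = _
    -- In the degenerate case `μ = -c` both spaces are trivial: `u = T 0 = 0` here, and `0⁻¹ = 0`
    -- turns the other eigenspace into the kernel of `T`.
    by_cases h0 : μ + c = 0
    · rw [h0, zero_smul, map_zero] at h1
      rw [← h1]; simp
    · rw [map_smul] at h1
      rw [eq_inv_smul_iff₀ h0, h1]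
  let Φ : schrodingerEigenspace V μ →ₗ[ℝ]
      Module.End.eigenspace (T : Module.End ℝ (Lp ℝ 2 (volume : Measure ℝ))) (μ + c)⁻¹ :=
    { toFun := fun u => ⟨(hsol u).memLp.toLp u.1, hmem u⟩
      map_add' := fun u v => rfl
      map_smul' := fun r u => rfl }
  refine LinearEquiv.rank_eq (LinearEquiv.ofBijective Φ ⟨fun u v huv => ?_, fun f => ?_⟩)
  · have h1 : (hsol u).memLp.toLp u.1 = (hsol v).memLp.toLp v.1 := congrArg Subtype.val huv
    rw [MemLp.toLp_eq_toLp_iff] at h1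
    exact Subtype.ext (((hsol u).continuous.ae_eq_iff_eq volume (hsol v).continuous).1 h1)
  · have hf : T f.1 = (μ + c)⁻¹ • f.1 := Module.End.mem_eigenspace_iff.1 f.2
    by_cases h0 : μ + c = 0
    · have hf0 : f = 0 := Subtype.ext (hinj _ (hf.trans (smul_eq_zero_of_left (by rw [h0, inv_zero]) _)))
      exact ⟨0, by rw [hf0, map_zero]⟩
    · obtain ⟨h, h1, h2⟩ := hT f.1
      have h3 : formDomain.coord V 0 ((μ + c) • h) = f.1 := by
        rw [map_smul, h1, hf, smul_inv_smul₀ h0]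
      have h4 : IsL2Solution V (μ + c - c) (formDomain.rep ((μ + c) • h)) := by
        refine formDomain.isL2Solution_rep hV fun k => ?_
        rw [h3, map_smul, _root_.smul_apply, h2, smul_eq_mul]
      rw [add_sub_cancel_right] at h4
      refine ⟨⟨_, h4⟩, Subtype.ext ?_⟩
      change h4.memLp.toLp _ = f.1
      apply Lp.ext
      refine h4.memLp.coeFn_toLp.trans ?_
      rw [← h3]
      exact (formDomain.coord_zero_ae _).mono fun x hx => hx.symm

/-! ### Hermite functions -/

/-- The product of a polynomial with the Gaussian `e^{-x^2/2}`. -/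
noncomputable def gaussPoly (P : ℝ[X]) (x : ℝ) : ℝ := P.eval x * Real.exp (-x ^ 2 / 2)

lemma continuous_gaussPoly (P : ℝ[X]) : Continuous (gaussPoly P) :=
  P.continuous.mul (by fun_prop)

lemma memLp_gaussPoly (P : ℝ[X]) : MemLp (gaussPoly P) 2 volume :=
  memLp_hermiteMeasure_iff.1 (memLp_polynomial_hermiteMeasure P)

lemma hasDerivAt_gaussPoly (P : ℝ[X]) (x : ℝ) :
    HasDerivAt (gaussPoly P) (gaussPoly (derivative P - X * P) x) x := by
  have h1 : HasDerivAt (fun x : ℝ => -x ^ 2 / 2) (-x) x := by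
    refine ((hasDerivAt_pow 2 x).neg.div_const 2).congr_deriv ?_
    push_cast
    ring
  refine ((P.hasDerivAt x).mul h1.exp).congr_deriv ?_
  simp only [gaussPoly, eval_sub, eval_mul, eval_X]
  ring

lemma gaussPoly_eq_primitive (P : ℝ[X]) :
    gaussPoly P = primitive (gaussPoly P 0) (gaussPoly (derivative P - X * P)) := by
  funext x
  unfold primitive
  rw [intervalIntegral.integral_eq_sub_of_hasDerivAt (fun y _ => hasDerivAt_gaussPoly P y)
    ((continuous_gaussPoly _).intervalIntegrable _ _)]
  ring

lemma gaussPoly_mul_gaussPoly (P Q : ℝ[X]) (x : ℝ) :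
    gaussPoly P x * gaussPoly Q x = (P * Q).eval x * Real.exp (-x ^ 2) := by
  have h : Real.exp (-x ^ 2) = Real.exp (-x ^ 2 / 2) * Real.exp (-x ^ 2 / 2) := by
    rw [← Real.exp_add]; congr 1; ring
  rw [h, gaussPoly, gaussPoly, eval_mul]
  ring

lemma integral_gaussPoly_mul (P Q : ℝ[X]) :
    ∫ x, gaussPoly P x * gaussPoly Q x = gaussInt (P * Q) := by
  simp only [gaussPoly_mul_gaussPoly, gaussInt]

lemma integrable_mul_polynomial {V : ℝ → ℝ} (hV : MemLp V 2 hermiteMeasure) (P : ℝ[X]) :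
    Integrable (fun x => V x * P.eval x) hermiteMeasure :=
  hV.integrable_mul (memLp_polynomial_hermiteMeasure P)

/-- Here the weighted integrability of `V` puts Hermite functions in the form domain: `V` and `P²`
are both in the weighted `L²`, so `V P²` is integrable against the weight. -/
lemma memLp_sqrt_mul_gaussPoly {V : ℝ → ℝ} (hV : MemLp V 2 hermiteMeasure) (P : ℝ[X]) :
    MemLp (fun x => √(V x) * gaussPoly P x) 2 volume := by
  have hm : AEStronglyMeasurable V volume := hV.1.mono_ac volume_absolutelyContinuous_hermiteMeasure
  have hs : AEStronglyMeasurable (fun x => √(V x) * gaussPoly P x) volume :=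
    (Real.continuous_sqrt.comp_aestronglyMeasurable hm).mul
      (continuous_gaussPoly P).aestronglyMeasurable
  rw [memLp_two_iff_integrable_sq hs]
  have h1 := integrable_hermiteMeasure_iff.1 (integrable_mul_polynomial hV (P * P))
  refine h1.mono (hs.pow 2) (Eventually.of_forall fun x => ?_)
  have h2 : (√(V x) * gaussPoly P x) ^ 2 = max (V x) 0 * (gaussPoly P x * gaussPoly P x) := by
    rw [mul_pow, sq_sqrt_eq_max, sq (gaussPoly P x)]
  rw [h2, mul_assoc, ← gaussPoly_mul_gaussPoly, norm_mul, norm_mul (V x)]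
  refine mul_le_mul_of_nonneg_right ?_ (norm_nonneg _)
  rw [Real.norm_eq_abs, Real.norm_eq_abs, abs_of_nonneg (le_max_right _ _)]
  exact max_le (le_abs_self _) (abs_nonneg _)

lemma ae_eq_zero_of_forall_gaussPoly {f : ℝ → ℝ} (hf : MemLp f 2 volume)
    (h : ∀ n, ∫ x, f x * gaussPoly (physHermite n) x = 0) : ∀ᵐ x, f x = 0 := by
  have hinv : ∀ x : ℝ, Real.exp (x ^ 2 / 2) * Real.exp (-x ^ 2 / 2) = 1 := fun x => by
    rw [← Real.exp_add, ← Real.exp_zero]; congr 1; ring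
  have hg : MemLp (fun x => f x * Real.exp (x ^ 2 / 2)) 2 hermiteMeasure := by
    rw [memLp_hermiteMeasure_iff]
    simpa only [mul_assoc, hinv, mul_one] using hf
  have h0 := ae_eq_zero_of_forall_physHermite hg fun n => by
    rw [integral_hermiteMeasure, ← h n]
    refine integral_congr_ae (Eventually.of_forall fun x => ?_)
    have h1 : Real.exp (-x ^ 2) = Real.exp (-x ^ 2 / 2) * Real.exp (-x ^ 2 / 2) := by
      rw [← Real.exp_add]; congr 1; ring
    simp only [h1, gaussPoly]
    linear_combination (eval x (physHermite n) * f x * Real.exp (-x ^ 2 / 2)) * hinv x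
  filter_upwards [h0] with x hx
  exact (mul_eq_zero.1 hx).resolve_right (Real.exp_ne_zero _)

namespace formDomain

variable {V : ℝ → ℝ}

lemma exists_gaussPoly (hV : MemLp V 2 hermiteMeasure) (hlim : Tendsto V (cocompact ℝ) atTop)
    (P : ℝ[X]) : ∃ h : formDomain V, coord V 0 h = (memLp_gaussPoly P).toLp _ ∧
      ∀ c, form V c h h =
        gaussInt ((derivative P - X * P) * (derivative P - X * P)) +
          (∫ x, V x * (P * P).eval x ∂hermiteMeasure) + c * gaussInt (P * P) := by
  obtain ⟨h, h1, h2, h3⟩ := exists_of_memLp (isConfining_of_memLp hV hlim) (memLp_gaussPoly P)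
    (memLp_gaussPoly (derivative P - X * P)) ⟨_, gaussPoly_eq_primitive P⟩
    (memLp_sqrt_mul_gaussPoly hV P)
  refine ⟨h, h2, fun c => ?_⟩
  rw [form_eq_integral, h1, h3, ← integral_gaussPoly_mul, ← integral_gaussPoly_mul P P,
    integral_hermiteMeasure]
  congr 2
  · refine integral_congr_ae ?_
    filter_upwards [(memLp_gaussPoly (derivative P - X * P)).coeFn_toLp] with x hx
    rw [hx]
  · simp only [gaussPoly_mul_gaussPoly, mul_assoc]

/-- The form domain contains all Hermite functions, which are complete in `L²`. -/
lemma eq_zero_of_forall_inner_coord (hV : MemLp V 2 hermiteMeasure)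
    (hlim : Tendsto V (cocompact ℝ) atTop) (f : Lp ℝ 2 (volume : Measure ℝ))
    (hf : ∀ k, inner ℝ f (coord V 0 k) = 0) : f = 0 := by
  rw [Lp.eq_zero_iff_ae_eq_zero]
  refine ae_eq_zero_of_forall_gaussPoly (Lp.memLp f) fun n => ?_
  obtain ⟨h, h1, -⟩ := exists_gaussPoly hV hlim (physHermite n)
  rw [← hf h, h1, real_inner_Lp]
  refine integral_congr_ae ?_
  filter_upwards [(memLp_gaussPoly (physHermite n)).coeFn_toLp] with x hx
  rw [hx]

end formDomain

/-! ### Normalized Hermite functions and their energies -/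

lemma inner_toLp_gaussPoly (P Q : ℝ[X]) :
    inner ℝ ((memLp_gaussPoly P).toLp _) ((memLp_gaussPoly Q).toLp _) = gaussInt (P * Q) := by
  rw [real_inner_Lp, ← integral_gaussPoly_mul]
  refine integral_congr_ae ?_
  filter_upwards [(memLp_gaussPoly P).coeFn_toLp, (memLp_gaussPoly Q).coeFn_toLp] with x h1 h2
  rw [h1, h2]

/-- The Hermite polynomials normalized in `L²(e^{-x^2} dx)`. -/
noncomputable def unitHermite (n : ℕ) : ℝ[X] := C (√(hermiteNormSq n))⁻¹ * physHermite n

lemma unitHermite_mul_unitHermite (m n : ℕ) : unitHermite m * unitHermite n =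
    C ((√(hermiteNormSq m))⁻¹ * (√(hermiteNormSq n))⁻¹) * (physHermite m * physHermite n) := by
  rw [unitHermite, unitHermite, C_mul]
  ring

lemma inv_sqrt_hermiteNormSq_mul_self (n : ℕ) :
    (√(hermiteNormSq n))⁻¹ * (√(hermiteNormSq n))⁻¹ = (hermiteNormSq n)⁻¹ := by
  rw [← mul_inv, Real.mul_self_sqrt (hermiteNormSq_pos n).le]

lemma gaussInt_unitHermite_mul_unitHermite (m n : ℕ) :
    gaussInt (unitHermite m * unitHermite n) = if m = n then 1 else 0 := by
  rw [unitHermite_mul_unitHermite, gaussInt_C_mul, gaussInt_physHermite_mul_physHermite]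
  split_ifs with h
  · rw [h, inv_sqrt_hermiteNormSq_mul_self, inv_mul_cancel₀ (hermiteNormSq_pos n).ne']
  · rw [mul_zero]

lemma orthonormal_toLp_unitHermite :
    Orthonormal ℝ fun n => (memLp_gaussPoly (unitHermite n)).toLp _ := by
  rw [orthonormal_iff_ite]
  intro m n
  rw [inner_toLp_gaussPoly, gaussInt_unitHermite_mul_unitHermite]

lemma gaussInt_derivative_mul_derivative (n : ℕ) :
    gaussInt (derivative (physHermite n) * derivative (physHermite n)) =
      2 * n * hermiteNormSq n := by
  cases n with
  | zero => simp [physHermite, gaussInt]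
  | succ n =>
    have h : C (2 * ((n : ℝ) + 1)) * physHermite n * (C (2 * ((n : ℝ) + 1)) * physHermite n) =
        C (2 * ((n : ℝ) + 1) * (2 * ((n : ℝ) + 1))) * (physHermite n * physHermite n) := by
      rw [C_mul (a := 2 * ((n : ℝ) + 1))]; ring
    rw [derivative_physHermite_succ, h, gaussInt_C_mul, gaussInt_physHermite_mul_physHermite,
      if_pos rfl]
    simp only [hermiteNormSq, Nat.factorial_succ]
    push_cast
    ring

lemma gaussInt_derivative_mul_physHermite_succ (n : ℕ) :
    gaussInt (derivative (physHermite n) * physHermite (n + 1)) = 0 := by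
  cases n with
  | zero => simp [physHermite, gaussInt]
  | succ n =>
    rw [derivative_physHermite_succ, mul_assoc, gaussInt_C_mul,
      gaussInt_physHermite_mul_physHermite, if_neg (by omega), mul_zero]

/-- From `2x H_n = H_{n+1} + H_n'`, twice the factor is `H_n' - H_{n+1}`, an orthogonal difference.
Its squared norm is `2n + 2(n+1)` times that of `H_n`. -/
lemma gaussInt_sq_derivative_sub (n : ℕ) :
    gaussInt ((derivative (physHermite n) - X * physHermite n) *
      (derivative (physHermite n) - X * physHermite n)) = (n + 1 / 2) * hermiteNormSq n := by
  have h : C (4 : ℝ) * ((derivative (physHermite n) - X * physHermite n) *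
      (derivative (physHermite n) - X * physHermite n)) =
      derivative (physHermite n) * derivative (physHermite n)
        - C 2 * (derivative (physHermite n) * physHermite (n + 1))
        + physHermite (n + 1) * physHermite (n + 1) := by
    have h4 : (C (4 : ℝ)) = 4 := rfl
    have h2 : (C (2 : ℝ)) = 2 := rfl
    rw [h4, h2, physHermite]
    ring
  have h' := congrArg gaussInt h
  rw [gaussInt_C_mul, gaussInt_add, gaussInt_sub, gaussInt_C_mul, gaussInt_derivative_mul_derivative,
    gaussInt_derivative_mul_physHermite_succ, gaussInt_physHermite_mul_physHermite, if_pos rfl] at h'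
  have h3 : hermiteNormSq (n + 1) = 2 * (n + 1) * hermiteNormSq n := by
    simp only [hermiteNormSq, Nat.factorial_succ]
    push_cast
    ring
  linarith

lemma gaussInt_sq_X_mul (n : ℕ) :
    gaussInt (X ^ 2 * (physHermite n * physHermite n)) = (n + 1 / 2) * hermiteNormSq n := by
  have h : C (4 : ℝ) * (X ^ 2 * (physHermite n * physHermite n)) =
      derivative (physHermite n) * derivative (physHermite n)
        + C 2 * (derivative (physHermite n) * physHermite (n + 1))
        + physHermite (n + 1) * physHermite (n + 1) := by
    have h4 : (C (4 : ℝ)) = 4 := rfl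
    have h2 : (C (2 : ℝ)) = 2 := rfl
    rw [h4, h2, physHermite]
    ring
  have h' := congrArg gaussInt h
  rw [gaussInt_C_mul, gaussInt_add, gaussInt_add, gaussInt_C_mul, gaussInt_derivative_mul_derivative,
    gaussInt_derivative_mul_physHermite_succ, gaussInt_physHermite_mul_physHermite, if_pos rfl] at h'
  have h3 : hermiteNormSq (n + 1) = 2 * (n + 1) * hermiteNormSq n := by
    simp only [hermiteNormSq, Nat.factorial_succ]
    push_cast
    ring
  linarith

/-- The energy of the `k`-th Hermite function for the potential `V`. -/
noncomputable def hermiteEnergy (V : ℝ → ℝ) (k : ℕ) : ℝ :=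
  (k + 1 / 2) + (∫ x, V x * (physHermite k * physHermite k).eval x ∂hermiteMeasure) /
    hermiteNormSq k

lemma formDomain.exists_unitHermite {V : ℝ → ℝ} (hV : MemLp V 2 hermiteMeasure)
    (hlim : Tendsto V (cocompact ℝ) atTop) (n : ℕ) : ∃ h : formDomain V,
      coord V 0 h = (memLp_gaussPoly (unitHermite n)).toLp _ ∧
      ∀ c, form V c h h = hermiteEnergy V n + c := by
  obtain ⟨h, h1, h2⟩ := exists_gaussPoly hV hlim (unitHermite n)
  refine ⟨h, h1, fun c => ?_⟩
  have e1 : (derivative (unitHermite n) - X * unitHermite n) *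
      (derivative (unitHermite n) - X * unitHermite n) = C (hermiteNormSq n)⁻¹ *
        ((derivative (physHermite n) - X * physHermite n) *
          (derivative (physHermite n) - X * physHermite n)) := by
    rw [← inv_sqrt_hermiteNormSq_mul_self, C_mul, unitHermite, derivative_C_mul]
    ring
  have h0 := (hermiteNormSq_pos n).ne'
  have e2 : ∫ x, V x * (unitHermite n * unitHermite n).eval x ∂hermiteMeasure =
      (∫ x, V x * (physHermite n * physHermite n).eval x ∂hermiteMeasure) / hermiteNormSq n := by
    rw [unitHermite_mul_unitHermite, inv_sqrt_hermiteNormSq_mul_self, div_eq_inv_mul,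
      ← integral_const_mul]
    refine integral_congr_ae (Eventually.of_forall fun x => ?_)
    simp only [eval_mul, eval_C]
    ring
  rw [h2, e1, e2, gaussInt_C_mul, gaussInt_sq_derivative_sub, gaussInt_unitHermite_mul_unitHermite,
    if_pos rfl, hermiteEnergy]
  field_simp

/-! ### The bound as a sum of energies -/

/-- By Hölder, `L²` convergence of the expansion becomes `L¹` convergence after multiplication by a
polynomial, so the series may be integrated termwise. -/
lemma HasHermiteExpansion.tendsto_integral_mul {V : ℝ → ℝ} {v : ℕ → ℝ}
    (hV : MemLp V 2 hermiteMeasure) (h : HasHermiteExpansion V v) (P : ℝ[X]) :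
    Tendsto (fun N => ∑ j ∈ Finset.range N, v j * gaussInt (physHermite j * P)) atTop
      (𝓝 (∫ x, V x * P.eval x ∂hermiteMeasure)) := by
  have hP := memLp_polynomial_hermiteMeasure P
  have hS : ∀ N, MemLp (fun x => ∑ j ∈ Finset.range N, v j * (physHermite j).eval x) 2
      hermiteMeasure := fun N =>
    memLp_finsetSum _ fun j _ => (memLp_polynomial_hermiteMeasure (physHermite j)).const_mul _
  have hlim : Tendsto (fun N => eLpNorm ((fun x =>
      (∑ j ∈ Finset.range N, v j * (physHermite j).eval x) * P.eval x) -
        fun x => V x * P.eval x) 1 hermiteMeasure) atTop (𝓝 0) := by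
    have h1 := ENNReal.Tendsto.mul_const (b := eLpNorm (fun x => P.eval x) 2 hermiteMeasure) h
      (Or.inr hP.2.ne)
    rw [zero_mul] at h1
    refine tendsto_of_tendsto_of_tendsto_of_le_of_le tendsto_const_nhds h1 (fun _ => zero_le) fun N => ?_
    refine le_trans (le_of_eq ?_) (eLpNorm_smul_le_mul_eLpNorm (p := 2) (q := 2) (r := 1) hP.1
      (hV.sub (hS N)).1)
    rw [← eLpNorm_neg]
    congr 1
    funext x
    simp only [Pi.neg_apply, Pi.sub_apply, Pi.smul_apply', smul_eq_mul]
    ring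
  have h2 := tendsto_integral_of_L1' _ (integrable_mul_polynomial hV P).1
    (Eventually.of_forall fun N => (hS N).integrable_mul hP) hlim
  refine h2.congr fun N => ?_
  have h3 : ∀ x, (∑ j ∈ Finset.range N, v j * (physHermite j).eval x) * P.eval x =
      ∑ j ∈ Finset.range N, v j * (physHermite j * P).eval x := fun x => by
    rw [Finset.sum_mul]
    exact Finset.sum_congr rfl fun j _ => by rw [eval_mul]; ring
  refine (integral_congr_ae (Eventually.of_forall h3)).trans ?_
  rw [integral_finsetSum _ fun j _ =>
    ((memLp_polynomial_hermiteMeasure (physHermite j * P)).integrable (by norm_num)).const_mul _]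
  refine Finset.sum_congr rfl fun j _ => ?_
  rw [integral_const_mul, integral_hermiteMeasure, gaussInt]

lemma sum_range_two_mul_eq (f : ℕ → ℝ) (h : ∀ r, f (2 * r + 1) = 0) (m : ℕ) :
    ∑ j ∈ Finset.range (2 * m), f j = ∑ r ∈ Finset.range m, f (2 * r) := by
  induction m with
  | zero => simp
  | succ m ih =>
    rw [mul_add_one, Finset.sum_range_succ, Finset.sum_range_succ, ih, h, add_zero,
      Finset.sum_range_succ]

/-- Only the even indices `2r` with `r ≤ k` contribute, so the series is a finite sum. Running it to
any `n ≥ k` gives all `k ≤ n` the same range of summation. -/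
lemma HasHermiteExpansion.integral_mul_sq {V : ℝ → ℝ} {v : ℕ → ℝ}
    (hV : MemLp V 2 hermiteMeasure) (h : HasHermiteExpansion V v) {k n : ℕ} (hk : k ≤ n) :
    ∫ x, V x * (physHermite k * physHermite k).eval x ∂hermiteMeasure =
      ∑ r ∈ Finset.range (n + 1), v (2 * r) *
        gaussInt (physHermite (2 * r) * (physHermite k * physHermite k)) := by
  have h1 := (h.tendsto_integral_mul hV (physHermite k * physHermite k)).comp
    (tendsto_id.const_mul_atTop' (two_pos : 0 < 2))
  refine tendsto_nhds_unique h1 (tendsto_const_nhds.congr' ?_)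
  filter_upwards [eventually_ge_atTop (n + 1)] with m hm
  simp only [Function.comp_apply, id]
  rw [sum_range_two_mul_eq _ fun r => by rw [gaussInt_physHermite_odd_mul_sq, mul_zero]]
  refine Finset.sum_subset (Finset.range_mono hm) fun r _ hr => ?_
  rw [gaussInt_physHermite_even_mul_sq, Nat.choose_eq_zero_of_lt]
  · simp
  · have := Finset.mem_range.not.1 hr
    omega

/-- The hockey-stick identity, the source of `binom(n+1, k+1)` in the bound. -/
lemma sum_range_choose_eq (n r : ℕ) :
    ∑ k ∈ Finset.range n, (k.choose r : ℝ) = (n.choose (r + 1) : ℝ) := by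
  induction n with
  | zero => simp
  | succ n ih => rw [Finset.sum_range_succ, ih, Nat.choose_succ_succ]; push_cast; ring

lemma hermiteBound_eq_sum_hermiteEnergy {V : ℝ → ℝ} {v : ℕ → ℝ}
    (hV : MemLp V 2 hermiteMeasure) (h : HasHermiteExpansion V v) (n : ℕ) :
    hermiteBound v n = ∑ k ∈ Finset.range (n + 1), hermiteEnergy V k := by
  unfold hermiteEnergy
  have h1 : ∀ k ∈ Finset.range (n + 1),
      (∫ x, V x * (physHermite k * physHermite k).eval x ∂hermiteMeasure) / hermiteNormSq k =
        ∑ r ∈ Finset.range (n + 1), 2 ^ r * ((2 * r).factorial : ℝ) / (r.factorial : ℝ) *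
          v (2 * r) * (k.choose r : ℝ) := by
    intro k hk
    rw [h.integral_mul_sq hV (Nat.lt_succ_iff.1 (Finset.mem_range.1 hk)), Finset.sum_div]
    refine Finset.sum_congr rfl fun r _ => ?_
    rw [gaussInt_physHermite_even_mul_sq]
    have := (hermiteNormSq_pos k).ne'
    field_simp
  have h2 : ∀ n : ℕ, ∑ k ∈ Finset.range (n + 1), ((k : ℝ) + 1 / 2) = ((n : ℝ) + 1) ^ 2 / 2 := by
    intro n
    induction n with
    | zero => norm_num
    | succ n ih => rw [Finset.sum_range_succ, ih]; push_cast; ring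
  rw [Finset.sum_add_distrib, h2, Finset.sum_congr rfl h1, Finset.sum_comm, hermiteBound, add_comm]
  congr 1
  refine Finset.sum_congr rfl fun r _ => ?_
  rw [← Finset.mul_sum, sum_range_choose_eq]
  ring

/-! ### The eigenvalue bound -/

section Resolvent

variable {V : ℝ → ℝ}

/-- The resolvent of the Schrödinger operator at a point below the spectrum. -/
lemma exists_resolvent (hV : MemLp V 2 hermiteMeasure) (hlim : Tendsto V (cocompact ℝ) atTop) :
    ∃ (c : ℝ) (T : Lp ℝ 2 (volume : Measure ℝ) →L[ℝ] Lp ℝ 2 (volume : Measure ℝ)),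
      IsCoercive (formDomain.form V c) ∧ IsCompactOperator T ∧ T.IsSymmetric ∧
      (∀ f, T f = 0 → f = 0) ∧ (∀ f, 0 ≤ inner ℝ f (T f)) ∧
      (∀ f, ∃ h, formDomain.coord V 0 h = T f ∧
        ∀ k, formDomain.form V c h k = inner ℝ f (formDomain.coord V 0 k)) ∧
      ∀ μ, Module.rank ℝ (schrodingerEigenspace V μ) =
        Module.rank ℝ (Module.End.eigenspace (T : Module.End ℝ (Lp ℝ 2 (volume : Measure ℝ)))
          (μ + c)⁻¹) := by
  have hc := isConfining_of_memLp hV hlim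
  obtain ⟨c, hco⟩ := formDomain.exists_isCoercive_form hc
  obtain ⟨T, h1, h2, h3, h4, h5, h6⟩ := exists_compact_operator_of_form (formDomain.form V c)
    (formDomain.form_comm c) hco (formDomain.coord V 0) (formDomain.isCompactOperator_coord_zero hc)
    (formDomain.eq_zero_of_forall_inner_coord hV hlim)
  exact ⟨c, T, hco, h1, h2, h3, h4, h5, rank_schrodingerEigenspace hc h3 h5 h6⟩

lemma exists_isEigenvalueSequence (hV : MemLp V 2 hermiteMeasure)
    (hlim : Tendsto V (cocompact ℝ) atTop) : ∃ lam, IsEigenvalueSequence V lam := by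
  obtain ⟨c, T, -, hT, hs, hinj, hpos, -, hrank⟩ := exists_resolvent hV hlim
  have hdim : ¬ FiniteDimensional ℝ (Lp ℝ 2 (volume : Measure ℝ)) := by
    intro h
    have := orthonormal_toLp_unitHermite.linearIndependent.finite
    exact _root_.not_finite ℕ
  obtain ⟨lam, h1, h2, h3⟩ := exists_sequence_of_isCompactOperator hT hs hinj hpos hdim c
  refine ⟨lam, h1, h2, fun μ => ?_⟩
  -- Needed to pass from `finrank` to `rank`. Compactness gives it for nonzero eigenvalues,
  -- injectivity for the value `0⁻¹ = 0`.
  have hfin : FiniteDimensional ℝ (Module.End.eigenspace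
      (T : Module.End ℝ (Lp ℝ 2 (volume : Measure ℝ))) (μ + c)⁻¹) := by
    by_cases h0 : (μ + c)⁻¹ = 0
    · have : Module.End.eigenspace (T : Module.End ℝ (Lp ℝ 2 (volume : Measure ℝ))) (μ + c)⁻¹ = ⊥ := by
        rw [eq_bot_iff]
        intro f hf
        exact hinj f ((Module.End.mem_eigenspace_iff.1 hf).trans (smul_eq_zero_of_left h0 _))
      rw [this]
      infer_instance
    · exact ContinuousLinearMap.finite_dimensional_eigenspace hT _ h0
  rw [h3, hrank, Module.finrank_eq_rank]

lemma sum_le_sum_hermiteEnergy (hV : MemLp V 2 hermiteMeasure)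
    (hlim : Tendsto V (cocompact ℝ) atTop) {lam : ℕ → ℝ} (hlam : IsEigenvalueSequence V lam)
    (n : ℕ) : ∑ k ∈ Finset.range (n + 1), lam k ≤
      ∑ k ∈ Finset.range (n + 1), hermiteEnergy V k := by
  obtain ⟨c, T, ⟨C, hC, hco⟩, hT, hs, hinj, -, hres, hrank⟩ := exists_resolvent hV hlim
  obtain ⟨b, hb⟩ := exists_hilbertBasis_of_multiplicities hT hs c hlam.tendsto
    fun μ => (hlam.multiplicity μ).trans (hrank μ)
  have hne : ∀ k, lam k + c ≠ 0 := by
    intro k h0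
    refine b.orthonormal.ne_zero k (hinj _ ((hb k).trans ?_))
    rw [h0, inv_zero, zero_smul]
  choose h hh1 hh2 using fun k => hres (b k)
  choose w hw1 hw2 using formDomain.exists_unitHermite hV hlim
  have hle := sum_le_sum_of_orthonormal b (a := fun k => lam k + c)
    (fun i j hij => by simpa using hlam.monotone hij) n orthonormal_toLp_unitHermite
    (q := fun k => hermiteEnergy V k + c) fun i N => by
      rw [← hw1, ← hw2]
      refine sum_mul_inner_sq_le (formDomain.form V c) (formDomain.form_comm c)
        (fun k => le_trans (by positivity) (hco k)) (formDomain.coord V 0) b.orthonormal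
        -- The scaling undoes the resolvent, so that these elements of the form domain embed as the
        -- eigenvectors themselves.
        (h := fun k => (lam k + c) • h k) (fun j => ?_) (fun j k => ?_) (w i) N
      · rw [map_smul, hh1, hb, smul_inv_smul₀ (hne j)]
      · rw [map_smul, _root_.smul_apply, hh2, smul_eq_mul]
  simpa [Finset.sum_add_distrib] using hle

end Resolvent

/-! ### The harmonic oscillator -/

lemma memLp_sq_hermiteMeasure : MemLp (fun x : ℝ => x ^ 2) 2 hermiteMeasure := by
  have h := memLp_polynomial_hermiteMeasure (X ^ 2)
  simp only [eval_pow, eval_X] at h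
  exact h

lemma tendsto_sq_cocompact : Tendsto (fun x : ℝ => x ^ 2) (cocompact ℝ) atTop := by
  refine ((tendsto_pow_atTop two_ne_zero).comp (tendsto_norm_cocompact_atTop (E := ℝ))).congr
    fun x => ?_
  simp

lemma hermiteEnergy_sq (k : ℕ) : hermiteEnergy (fun x => x ^ 2) k = 2 * k + 1 := by
  have h : ∫ x, x ^ 2 * (physHermite k * physHermite k).eval x ∂hermiteMeasure =
      (k + 1 / 2) * hermiteNormSq k := by
    rw [← gaussInt_sq_X_mul, integral_hermiteMeasure, gaussInt]
    simp
  rw [hermiteEnergy, h, mul_div_cancel_right₀ _ (hermiteNormSq_pos k).ne']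
  ring

lemma isL2Solution_gaussPoly_physHermite (n : ℕ) :
    IsL2Solution (fun x => x ^ 2) (2 * n + 1) (gaussPoly (physHermite n)) := by
  have hd : ∀ P, deriv (gaussPoly P) = gaussPoly (derivative P - X * P) := fun P =>
    funext fun x => (hasDerivAt_gaussPoly P x).deriv
  refine ⟨memLp_gaussPoly _, fun x => (hasDerivAt_gaussPoly _ x).differentiableAt, fun a b => ?_,
    Eventually.of_forall fun x => ?_⟩
  · rw [hd, gaussPoly_eq_primitive]
    exact absolutelyContinuousOnInterval_primitive (continuous_gaussPoly _).locallyIntegrable _ _ _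
  · have h1 := congrArg (eval x) (derivative_physHermite_succ n)
    rw [physHermite, derivative_sub, derivative_mul, derivative_mul, derivative_X] at h1
    simp at h1
    rw [hd, hd]
    simp only [gaussPoly, derivative_sub, derivative_mul, derivative_X, eval_sub, eval_add,
      eval_mul, eval_X, eval_one]
    linear_combination Real.exp (-x ^ 2 / 2) * h1

/-- Eigenfunctions for different eigenvalues are orthogonal. -/
lemma IsL2Solution.integral_mul_eq_zero {V : ℝ → ℝ} (hV : IsConfining V) {μ ν : ℝ} {u w : ℝ → ℝ}
    (hu : IsL2Solution V μ u) (hw : IsL2Solution V ν w) (hne : μ ≠ ν) : ∫ x, u x * w x = 0 := by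
  obtain ⟨f, hf, hf0, hf'⟩ := hu.exists_formDomain hV 0
  obtain ⟨g, hg, hg0, hg'⟩ := hw.exists_formDomain hV 0
  have h1 := hf' g
  rw [formDomain.form_comm, hg' f, real_inner_comm, formDomain.inner_coord_zero, hf, hg] at h1
  have h2 : (ν - μ) * ∫ x, u x * w x = 0 := by linarith
  exact (mul_eq_zero.1 h2).resolve_left (sub_ne_zero.2 hne.symm)

open scoped Classical in
-- A solution is orthogonal to every Hermite function whose eigenvalue differs from `μ`. At most one
-- Hermite function remains, and completeness makes the solution a multiple of it, or zero.
lemma rank_schrodingerEigenspace_sq (μ : ℝ) :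
    Module.rank ℝ (schrodingerEigenspace (fun x => x ^ 2) μ) ≤
      if ∃ j : ℕ, μ = 2 * j + 1 then 1 else 0 := by
  have hV := isConfining_of_memLp memLp_sq_hermiteMeasure tendsto_sq_cocompact
  have hzero : ∀ u, IsL2Solution (fun x => x ^ 2) μ u →
      (∀ j : ℕ, μ = 2 * j + 1 → ∫ x, u x * gaussPoly (physHermite j) x = 0) → u = 0 := by
    intro u hu h
    have h0 := ae_eq_zero_of_forall_gaussPoly hu.memLp fun j => by
      by_cases hj : μ = 2 * j + 1
      · exact h j hj
      · exact hu.integral_mul_eq_zero hV (isL2Solution_gaussPoly_physHermite j) hj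
    exact (hu.continuous.ae_eq_iff_eq volume continuous_zero).1 h0
  split_ifs with hj
  · obtain ⟨j, rfl⟩ := hj
    have hj' := isL2Solution_gaussPoly_physHermite j
    rw [rank_submodule_le_one_iff']
    refine ⟨gaussPoly (physHermite j), fun u hu => ?_⟩
    have hu : IsL2Solution (fun x => x ^ 2) (2 * j + 1) u := hu
    rw [Submodule.mem_span_singleton]
    set r := (∫ x, u x * gaussPoly (physHermite j) x) / hermiteNormSq j with hr
    refine ⟨r, (sub_eq_zero.1 (hzero (u - r • gaussPoly (physHermite j)) ?_ ?_)).symm⟩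
    · exact (schrodingerEigenspace (fun x => x ^ 2) (2 * j + 1)).sub_mem hu
        ((schrodingerEigenspace (fun x => x ^ 2) (2 * j + 1)).smul_mem r hj')
    · intro i hi
      have hij : i = j := by
        have : (i : ℝ) = j := by linarith
        exact_mod_cast this
      subst hij
      have i1 : Integrable fun x => u x * gaussPoly (physHermite i) x :=
        hu.memLp.integrable_mul (memLp_gaussPoly _)
      have i2 : Integrable fun x => r * (gaussPoly (physHermite i) x * gaussPoly (physHermite i) x) :=
        ((memLp_gaussPoly _).integrable_mul (memLp_gaussPoly _)).const_mul r
      have h1 : ∀ x, (u - r • gaussPoly (physHermite i)) x * gaussPoly (physHermite i) x =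
          u x * gaussPoly (physHermite i) x -
            r * (gaussPoly (physHermite i) x * gaussPoly (physHermite i) x) := fun x => by
        simp only [Pi.sub_apply, Pi.smul_apply, smul_eq_mul]
        ring
      simp only [h1]
      rw [integral_sub i1 i2, integral_const_mul, integral_gaussPoly_mul,
        gaussInt_physHermite_mul_physHermite, if_pos rfl, hr,
        div_mul_cancel₀ _ (hermiteNormSq_pos i).ne', sub_self]
  · have hbot : schrodingerEigenspace (fun x => x ^ 2) μ = ⊥ :=
      (Submodule.eq_bot_iff _).2 fun u hu => hzero u hu fun j h => absurd ⟨j, h⟩ hj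
    rw [hbot, rank_bot]

/-- Each listed value is `2j + 1` for some `j` and none repeats, so `j` is a strictly increasing
function of `k`. That every `2j + 1` occurs is not needed: the variational bound supplies the other
inequality. -/
lemma IsEigenvalueSequence.two_mul_add_one_le {lam : ℕ → ℝ}
    (h : IsEigenvalueSequence (fun x => x ^ 2) lam) (k : ℕ) : 2 * (k : ℝ) + 1 ≤ lam k := by
  have hcard : ∀ k, ∃ j : ℕ, lam k = 2 * j + 1 := by
    intro k
    by_contra hk
    have h1 := (h.multiplicity (lam k)).trans_le (rank_schrodingerEigenspace_sq _)
    rw [if_neg hk, nonpos_iff_eq_zero, Cardinal.mk_eq_zero_iff] at h1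
    exact h1.false ⟨k, rfl⟩
  have hinj : Function.Injective lam := by
    intro i j hij
    have h1 := (h.multiplicity (lam j)).trans_le (rank_schrodingerEigenspace_sq _)
    rw [if_pos (hcard j), Cardinal.le_one_iff_subsingleton] at h1
    exact congrArg Subtype.val (h1.elim ⟨i, hij⟩ ⟨j, rfl⟩)
  choose m hm using hcard
  have hmono : StrictMono m := by
    intro i j hij
    have h1 := h.monotone.strictMono_of_injective hinj hij
    rw [hm, hm] at h1
    have h2 : (m i : ℝ) < m j := by linarith
    exact_mod_cast h2
  have h3 : (k : ℝ) ≤ m k := by exact_mod_cast hmono.le_apply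
  rw [hm]
  linarith

theorem theorem5p1 :
    (∀ V : ℝ → ℝ, MemLp V 2 hermiteMeasure → Tendsto V (cocompact ℝ) atTop →
      (∃ v : ℕ → ℝ, HasHermiteExpansion V v) ∧
      (∃ lam : ℕ → ℝ, IsEigenvalueSequence V lam) ∧
      ∀ v lam : ℕ → ℝ, HasHermiteExpansion V v → IsEigenvalueSequence V lam →
        ∀ n : ℕ, ∑ k ∈ Finset.range (n + 1), lam k ≤ hermiteBound v n) ∧
    (MemLp (fun x : ℝ => x ^ 2) 2 hermiteMeasure ∧
      Tendsto (fun x : ℝ => x ^ 2) (cocompact ℝ) atTop ∧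
      ∀ v lam : ℕ → ℝ, HasHermiteExpansion (fun x => x ^ 2) v →
        IsEigenvalueSequence (fun x => x ^ 2) lam →
        ∀ n : ℕ, ∑ k ∈ Finset.range (n + 1), lam k = hermiteBound v n) := by
  refine ⟨fun V hV hlim => ⟨exists_hasHermiteExpansion hV, exists_isEigenvalueSequence hV hlim,
    fun v lam hv hlam n => ?_⟩, memLp_sq_hermiteMeasure, tendsto_sq_cocompact,
    fun v lam hv hlam n => ?_⟩
  · rw [hermiteBound_eq_sum_hermiteEnergy hV hv]
    exact sum_le_sum_hermiteEnergy hV hlim hlam n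
  · rw [hermiteBound_eq_sum_hermiteEnergy memLp_sq_hermiteMeasure hv]
    refine le_antisymm (sum_le_sum_hermiteEnergy memLp_sq_hermiteMeasure tendsto_sq_cocompact hlam n)
      (Finset.sum_le_sum fun k _ => ?_)
    rw [hermiteEnergy_sq]
    exact hlam.two_mul_add_one_le k
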